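/- Let $(a_i)_{i\ge 1}$ be positive reals with $\sum_i a_i<\infty$, let $r>0$, and let $s,t\ge 0$ be integers. Let $\ell^2$ be the space of square-summable complex sequences $\mathbf z=(z_i)_{i\ge1}$, $z_i=x_i+\sqrt{-1}\,y_i$, and let $P_r$ be the Borel probability measure on $\ell^2$ obtained by restricting to $\ell^2$ the product measure $\prod_{i}\mathcal N_{ra_i}\times\mathcal N_{ra_i}$ of the coordinates $(x_i,y_i)$, where $\mathcal N_\sigma$ is the centred Gaussian law on $\mathbb R$ with standard deviation $\sigma$. In the following, primed sums run over strictly increasing multi-indices. For integers $p,q\ge0$ let $L^2_{(p,q)}(\ell^2,P_r)$ be the Hilbert space of formal sums $f=\sum'_{|I|=p}\sum'_{|J|=q}f_{I,J}\,dz_I\wedge d\overline{z_J}$ with $f_{I,J}\in L^2(\ell^2,P_r)$ and $$\|f\|^2_{L^2_{(p,q)}(\ell^2,P_r)}=\sum_{|I|=p}'\sum_{|J|=q}'\mathbf a^{I,J}\int_{\ell^2}|f_{I,J}|^2\,dP_r<\infty,\qquad \mathbf a^{I,J}=\prod_{i\in I}a_i^2\prod_{j\in J}a_j^2 .$$ Let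 $\mathscr C_c^\infty$ be the set of functions on $\ell^2$ of the form $\varphi(\mathbf z)=F(z_1,\dots,z_n)$ with $n\ge1$ and $F:\mathbb C^n\to\mathbb C$ smooth with compact support, and put $\delta_j\varphi=\partial_j\varphi-\frac{\overline{z_j}}{2r^2a_j^2}\varphi$ with $\partial_j=\frac12(D_{x_j}-\sqrt{-1}D_{y_j})$. For strictly increasing $J$, $K$ with $|J|=q$, $|K|=q+1$ let $\varepsilon^K_{j,J}$ be the sign of the permutation taking $(j,j_1,\dots,j_q)$ to $K$ if $K=J\cup\{j\}$, and $0$ otherwise. A form $f\in L^2_{(p,q)}(\ell^2,P_r)$ lies in $D_{\overline\partial}$, with $\overline\partial f=(-1)^p\sum'_{|I|=p,|K|=q+1}g_{I,K}\,dz_I\wedge d\overline{z_K}$, if this last form lies in $L^2_{(p,q+1)}(\ell^2,P_r)$ and $$\int_{\ell^2}g_{I,K}\,\overline\varphi\,dP_r=-\int_{\ell^2}\sum_{i\ge1}\sum_{|J|=q}'\varepsilon^K_{i,J}f_{I,J}\,\overline{\delta_i\varphi}\,dP_r\qquad\text{for all }I,K\text{ and all }\varphi\in\mathscr C_c^\infty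 .$$ Let $T$ be the operator $\overline\partial$ from $L^2_{(s,t)}(\ell^2,P_r)$ to $L^2_{(s,t+1)}(\ell^2,P_r)$ and $S$ the operator $\overline\partial$ from $L^2_{(s,t+1)}(\ell^2,P_r)$ to $L^2_{(s,t+2)}(\ell^2,P_r)$, both with domain $D_{\overline\partial}$ (denoted $D_T$ and $D_S$), and let $T^*$, with domain $D_{T^*}$, be the Hilbert space adjoint of the densely defined operator $T$. Then for every $f\in D_S\cap D_{T^*}$, $$\frac{t+1}{2r^2}\,\|f\|^2_{L^2_{(s,t+1)}(\ell^2,P_r)}\le\|T^*f\|^2_{L^2_{(s,t)}(\ell^2,P_r)}+\|Sf\|^2_{L^2_{(s,t+2)}(\ell^2,P_r)} .$$ -/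

import Mathlib

open MeasureTheory ProbabilityTheory
open scoped ComplexConjugate ContDiff

noncomputable section

/-- The Hilbert space `ℓ²` of square-summable complex sequences `z = (z_i)`, `z_i = x_i + √-1 y_i`. -/
abbrev Ell2 : Type := lp (fun _ : ℕ => ℂ) 2

instance Ell2.instMeasurableSpace : MeasurableSpace Ell2 := borel Ell2

instance Ell2.instBorelSpace : BorelSpace Ell2 := ⟨rfl⟩

/-- The real coordinates `(x_i, y_i)` of a point of `ℓ²`; this is the inclusion of `ℓ²` into
`(ℝ × ℝ)^ℕ`. -/
def Ell2.coords (z : Ell2) : ℕ → ℝ × ℝ := fun i => ((z i).re, (z i).im)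

/-- The product, over all `i`, of `N_{r a_i} × N_{r a_i}` on `(ℝ × ℝ)^ℕ`, where `N_σ` is the centred
Gaussian law on `ℝ` with standard deviation `σ`. -/
def gaussProduct (a : ℕ → ℝ) (r : ℝ) : Measure (ℕ → ℝ × ℝ) :=
  Measure.infinitePi fun i =>
    (gaussianReal 0 (Real.toNNReal ((r * a i) ^ 2))).prod
      (gaussianReal 0 (Real.toNNReal ((r * a i) ^ 2)))

/-- The measure `P_r`: the restriction of the Gaussian product measure to the Borel sets of `ℓ²`,
that is, `P_r(B)` is the product measure of `B`, seen as a subset of `(ℝ × ℝ)^ℕ`. -/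
def gaussP (a : ℕ → ℝ) (r : ℝ) : Measure Ell2 :=
  (gaussProduct a r).comap Ell2.coords

/-- Strictly increasing multi-indices of length `s`, recorded as the set of their entries. -/
abbrev MultiIdx (s : ℕ) : Type := {I : Finset ℕ // I.card = s}

/-- The weight `∏_{i ∈ I} a_i² ∏_{j ∈ J} a_j²`. -/
def weight (a : ℕ → ℝ) {s t : ℕ} (p : MultiIdx s × MultiIdx t) : ℝ :=
  (∏ i ∈ p.1.1, a i ^ 2) * ∏ j ∈ p.2.1, a j ^ 2

/-- The Hilbert space `L²_{(s,t)}(ℓ², P_r)` of `(s,t)`-forms `∑' f_{I,J} dz_I ∧ dz̄_J`. A form is the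
family of its coefficients `f_{I,J}`; these lie in `L²(P_r)` and
`‖f‖² = ∑'_{I,J} weight(I,J) ∫ |f_{I,J}|² dP_r < ∞`. The weight is put on the measure: the summand
with index `(I,J)` is `L²(ℓ², weight(I,J) • P_r)`, which for a positive weight has the same elements
as `L²(ℓ², P_r)`. -/
abbrev L2Form (a : ℕ → ℝ) (r : ℝ) (s t : ℕ) : Type :=
  lp (fun p : MultiIdx s × MultiIdx t => Lp ℂ 2 (ENNReal.ofReal (weight a p) • gaussP a r)) 2

/-- `D_{x_j} φ`. -/
def dX (j : ℕ) (φ : Ell2 → ℂ) (z : Ell2) : ℂ := lineDeriv ℝ φ z (lp.single 2 j (1 : ℂ))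

/-- `D_{y_j} φ`. -/
def dY (j : ℕ) (φ : Ell2 → ℂ) (z : Ell2) : ℂ := lineDeriv ℝ φ z (lp.single 2 j Complex.I)

/-- `∂_j φ = (D_{x_j} φ - √-1 D_{y_j} φ) / 2`. -/
def partialZ (j : ℕ) (φ : Ell2 → ℂ) (z : Ell2) : ℂ := (1 / 2) * (dX j φ z - Complex.I * dY j φ z)

/-- `δ_j φ = ∂_j φ - (z̄_j / (2 r² a_j²)) φ`. -/
def deltaOp (a : ℕ → ℝ) (r : ℝ) (j : ℕ) (φ : Ell2 → ℂ) (z : Ell2) : ℂ :=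
  partialZ j φ z - conj (z j) / (2 * (r : ℂ) ^ 2 * (a j : ℂ) ^ 2) * φ z

/-- The class `𝒞_c^∞` of smooth cylinder functions: `φ` is a compactly supported smooth complex-valued
function of finitely many (and at least one) of the first coordinates. -/
def IsTest (φ : Ell2 → ℂ) : Prop :=
  ∃ (n : ℕ) (F : (Fin (n + 1) → ℂ) → ℂ), ContDiff ℝ ∞ F ∧ HasCompactSupport F ∧
    ∀ z : Ell2, φ z = F fun i => z i

/-- The sign `ε_{j,J}^K`: it is `0` unless `K = J ∪ {j}` with `j ∉ J`, and then it is the sign of the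
permutation that sorts `(j, j_1, …, j_t)`; this permutation moves `j` past the entries of `J` that
are smaller than `j`. -/
def epsSign (j : ℕ) (J K : Finset ℕ) : ℂ :=
  if j ∉ J ∧ K = insert j J then (-1) ^ (J.filter (· < j)).card else 0

/-- The pointwise sum `∑_i ∑'_{|J|=t} ε_{i,J}^K f_{I,J} \overline{δ_i φ}`, which has at most `t + 1`
nonzero terms. -/
def dbarPairing (a : ℕ → ℝ) (r : ℝ) {s t : ℕ} (f : L2Form a r s t) (I : MultiIdx s)
    (K : MultiIdx (t + 1)) (φ : Ell2 → ℂ) (z : Ell2) : ℂ :=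
  ∑' (i : ℕ) (J : MultiIdx t), epsSign i J.1 K.1 * f (I, J) z * conj (deltaOp a r i φ z)

/-- `g = ∂̄ f` in the weak sense: `g = (-1)^s ∑' g_{I,K} dz_I ∧ dz̄_K`, where
`∫ g_{I,K} φ̄ dP_r = - ∫ ∑_i ∑'_J ε_{i,J}^K f_{I,J} \overline{δ_i φ} dP_r` for all test functions `φ`. -/
def IsWeakDbar (a : ℕ → ℝ) (r : ℝ) {s t : ℕ} (f : L2Form a r s t) (g : L2Form a r s (t + 1)) :
    Prop :=
  ∀ (I : MultiIdx s) (K : MultiIdx (t + 1)) (φ : Ell2 → ℂ), IsTest φ →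
    ∫ z, ((-1) ^ s * g (I, K) z) * conj (φ z) ∂(gaussP a r)
      = - ∫ z, dbarPairing a r f I K φ z ∂(gaussP a r)


theorem Ell2.coords_continuous : Continuous Ell2.coords := by
  refine continuous_pi fun i => ?_
  have h : Continuous fun z : Ell2 => z i := (lp.evalCLM ℂ (fun _ : ℕ => ℂ) 2 i).continuous
  exact (Complex.continuous_re.comp h).prodMk (Complex.continuous_im.comp h)

theorem Ell2.coords_injective : Function.Injective Ell2.coords := by
  intro z w h
  ext i
  have := congrFun h i
  simp only [Ell2.coords, Prod.mk.injEq] at this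
  exact Complex.ext this.1 this.2

instance Ell2.instSeparableSpace : TopologicalSpace.SeparableSpace Ell2 := by
  let S : Set Ell2 := Set.range fun i : ℕ => lp.single 2 i (1 : ℂ)
  have hS : TopologicalSpace.IsSeparable (Submodule.span ℂ S : Set Ell2) :=
    (Set.countable_range _).isSeparable.span (R := ℂ)
  rw [← TopologicalSpace.isSeparable_univ_iff]
  refine hS.closure.mono fun z _ => ?_
  have hz : HasSum (fun i => lp.single 2 i (z i)) z := lp.hasSum_single (by norm_num) z
  refine mem_closure_of_tendsto hz (Filter.Eventually.of_forall fun s => ?_)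
  refine Submodule.sum_mem _ fun i _ => ?_
  have : (lp.single 2 i (z i) : Ell2) = z i • lp.single 2 i (1 : ℂ) := by
    rw [← lp.single_smul]; simp
  rw [this]
  exact Submodule.smul_mem _ _ (Submodule.subset_span ⟨i, rfl⟩)

theorem Ell2.coords_measurableEmbedding : MeasurableEmbedding Ell2.coords :=
  haveI : SecondCountableTopology Ell2 := UniformSpace.secondCountable_of_separable Ell2
  Ell2.coords_continuous.measurableEmbedding Ell2.coords_injective

theorem gaussP_map_coords_le (a : ℕ → ℝ) (r : ℝ) :
    (gaussP a r).map Ell2.coords ≤ gaussProduct a r := by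
  rw [gaussP, Ell2.coords_measurableEmbedding.map_comap]
  exact Measure.restrict_le_self

instance gaussProduct_prob (a : ℕ → ℝ) (r : ℝ) : IsProbabilityMeasure (gaussProduct a r) := by
  unfold gaussProduct; infer_instance

instance gaussP_finite (a : ℕ → ℝ) (r : ℝ) : IsFiniteMeasure (gaussP a r) := by
  refine ⟨?_⟩
  rw [gaussP, Ell2.coords_measurableEmbedding.comap_apply]
  exact measure_lt_top _ _

theorem gauss_sq (v : NNReal) : ∫⁻ x, ENNReal.ofReal (x ^ 2) ∂(gaussianReal 0 v) = v := by
  have h := memLp_id_gaussianReal (μ := 0) (v := v) 2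
  have h2 : ∫ x, x ^ 2 ∂(gaussianReal 0 v) = v := by
    have := variance_fun_id_gaussianReal (μ := 0) (v := v)
    rw [variance_eq_integral (by fun_prop)] at this
    simpa using this
  rw [← ofReal_integral_eq_lintegral_ofReal _ (Filter.Eventually.of_forall fun x => sq_nonneg x), h2]
  · simp
  · simpa using h.integrable_sq

theorem gaussProduct_sq (a : ℕ → ℝ) (r : ℝ) (i : ℕ) :
    ∫⁻ x, ENNReal.ofReal ((x i).1 ^ 2 + (x i).2 ^ 2) ∂(gaussProduct a r)
      = ENNReal.ofReal (2 * (r * a i) ^ 2) := by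
  have hm := measurePreserving_eval_infinitePi (fun i =>
    (gaussianReal 0 (Real.toNNReal ((r * a i) ^ 2))).prod
      (gaussianReal 0 (Real.toNNReal ((r * a i) ^ 2)))) i
  have h1 := hm.lintegral_comp (f := fun y : ℝ × ℝ => ENNReal.ofReal (y.1 ^ 2 + y.2 ^ 2))
    (by fun_prop)
  unfold gaussProduct
  refine h1.trans ?_
  have : (fun y : ℝ × ℝ => ENNReal.ofReal (y.1 ^ 2 + y.2 ^ 2))
      = fun y => ENNReal.ofReal (y.1 ^ 2) + ENNReal.ofReal (y.2 ^ 2) := by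
    ext y; rw [ENNReal.ofReal_add (sq_nonneg _) (sq_nonneg _)]
  rw [this, lintegral_add_left (by fun_prop)]
  have e1 := (measurePreserving_fst (μ := gaussianReal 0 (Real.toNNReal ((r * a i) ^ 2)))
    (ν := gaussianReal 0 (Real.toNNReal ((r * a i) ^ 2)))).lintegral_comp
    (f := fun y : ℝ => ENNReal.ofReal (y ^ 2)) (by fun_prop)
  have e2 := (measurePreserving_snd (μ := gaussianReal 0 (Real.toNNReal ((r * a i) ^ 2)))
    (ν := gaussianReal 0 (Real.toNNReal ((r * a i) ^ 2)))).lintegral_comp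
    (f := fun y : ℝ => ENNReal.ofReal (y ^ 2)) (by fun_prop)
  rw [e1, e2, gauss_sq, two_mul, ENNReal.ofReal_add (sq_nonneg _) (sq_nonneg _)]
  rfl

theorem gaussP_prob (a : ℕ → ℝ) (r : ℝ) (hsum : Summable fun i => a i ^ 2) :
    IsProbabilityMeasure (gaussP a r) := by
  refine ⟨?_⟩
  rw [gaussP, Ell2.coords_measurableEmbedding.comap_apply, Set.image_univ]
  have hfin : ∫⁻ x, ∑' i, ENNReal.ofReal ((x i).1 ^ 2 + (x i).2 ^ 2) ∂(gaussProduct a r) ≠ ⊤ := by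
    rw [lintegral_tsum (fun i => by fun_prop)]
    simp_rw [gaussProduct_sq]
    have : Summable fun i => 2 * (r * a i) ^ 2 := by
      simp_rw [mul_pow]; exact (hsum.mul_left _).mul_left _
    exact this.tsum_ofReal_ne_top
  have hae := ae_lt_top' (by fun_prop) hfin
  rw [prob_compl_eq_zero_iff Ell2.coords_measurableEmbedding.measurableSet_range |>.symm]
  refine measure_mono_null (fun x hx => ?_) hae
  contrapose hx
  have hx' : ∑' i, ENNReal.ofReal ((x i).1 ^ 2 + (x i).2 ^ 2) ≠ ⊤ := by
    intro h; apply hx; simp [h]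
  have hs := ENNReal.summable_toReal hx'
  rw [Set.notMem_compl_iff]
  have hmem : Memℓp (fun i => (⟨(x i).1, (x i).2⟩ : ℂ)) 2 := by
    refine memℓp_gen ?_
    refine hs.congr fun i => ?_
    rw [ENNReal.toReal_ofReal (by positivity)]
    simp [Complex.sq_norm, Complex.normSq_apply]
    ring
  exact ⟨⟨_, hmem⟩, by ext i <;> simp [Ell2.coords]⟩

theorem Ell2.measurable_coord (i : ℕ) : Measurable fun z : Ell2 => z i :=
  (lp.evalCLM ℂ (fun _ : ℕ => ℂ) 2 i).continuous.measurable

theorem memLp_coord (a : ℕ → ℝ) (r : ℝ) (i : ℕ) :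
    MemLp (fun z : Ell2 => z i) 2 (gaussP a r) := by
  refine ⟨(Ell2.measurable_coord i).aestronglyMeasurable, ?_⟩
  rw [eLpNorm_lt_top_iff_lintegral_rpow_enorm_lt_top (by norm_num) (by norm_num)]
  have h1 : ∫⁻ z : Ell2, ‖z i‖ₑ ^ (2 : ENNReal).toReal ∂(gaussP a r)
      = ∫⁻ x, ENNReal.ofReal ((x i).1 ^ 2 + (x i).2 ^ 2) ∂((gaussP a r).map Ell2.coords) := by
    rw [Ell2.coords_measurableEmbedding.lintegral_map]
    refine lintegral_congr fun z => ?_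
    rw [← ofReal_norm, ENNReal.toReal_ofNat, ENNReal.rpow_ofNat,
      ← ENNReal.ofReal_pow (norm_nonneg _), Complex.sq_norm, Complex.normSq_apply]
    simp [Ell2.coords, sq]
  rw [h1]
  refine (lintegral_mono' (gaussP_map_coords_le a r) le_rfl).trans_lt ?_
  rw [gaussProduct_sq]
  exact ENNReal.ofReal_lt_top

theorem weight_pos {a : ℕ → ℝ} (ha : ∀ i, 0 < a i) {s t : ℕ} (p : MultiIdx s × MultiIdx t) :
    0 < weight a p :=
  mul_pos (Finset.prod_pos fun i _ => pow_pos (ha i) 2)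
    (Finset.prod_pos fun i _ => pow_pos (ha i) 2)

theorem ae_weight {a : ℕ → ℝ} (ha : ∀ i, 0 < a i) (r : ℝ) {s t : ℕ} (p : MultiIdx s × MultiIdx t) :
    ae (ENNReal.ofReal (weight a p) • gaussP a r) = ae (gaussP a r) :=
  Measure.ae_ennreal_smul_measure_eq (by simpa using weight_pos ha p) _

theorem memLp_coeff {a : ℕ → ℝ} (ha : ∀ i, 0 < a i) (r : ℝ) {s t : ℕ} (f : L2Form a r s t)
    (p : MultiIdx s × MultiIdx t) : MemLp (f p : Ell2 → ℂ) 2 (gaussP a r) := by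
  have h0 : ENNReal.ofReal (weight a p) ≠ 0 := by simpa using weight_pos ha p
  have h := (Lp.memLp (f p)).smul_measure (c := (ENNReal.ofReal (weight a p))⁻¹)
    (ENNReal.inv_ne_top.2 h0)
  rwa [smul_smul, ENNReal.inv_mul_cancel h0 ENNReal.ofReal_ne_top, one_smul] at h

/-- The first `n + 1` coordinates. -/
def Ell2.proj (n : ℕ) : Ell2 →L[ℝ] (Fin (n + 1) → ℂ) :=
  ContinuousLinearMap.pi fun i => (lp.evalCLM ℂ (fun _ : ℕ => ℂ) 2 (i : ℕ)).restrictScalars ℝ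

theorem memLp_cyl (a : ℕ → ℝ) (r : ℝ) {n : ℕ} {G : (Fin (n + 1) → ℂ) → ℂ} (hG : Continuous G)
    (hc : HasCompactSupport G) (q : ENNReal) :
    MemLp (fun z => G (Ell2.proj n z)) q (gaussP a r) := by
  obtain ⟨C, hC⟩ := hG.bounded_above_of_compact_support hc
  exact MemLp.of_bound (hG.comp (Ell2.proj n).continuous).measurable.aestronglyMeasurable C
    (Filter.Eventually.of_forall fun z => hC _)

theorem memLp_lineDeriv (a : ℕ → ℝ) (r : ℝ) {φ : Ell2 → ℂ} (hφ : IsTest φ) (v : Ell2) :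
    MemLp (fun z => lineDeriv ℝ φ z v) 2 (gaussP a r) := by
  obtain ⟨n, F, hF, hc, hφF⟩ := hφ
  have h1 : (fun z => lineDeriv ℝ φ z v)
      = fun z => (fun x => fderiv ℝ F x (Ell2.proj n v)) (Ell2.proj n z) := by
    funext z
    have hd : DifferentiableAt ℝ F (Ell2.proj n z) := hF.differentiable (by simp) _
    change _ = fderiv ℝ F (Ell2.proj n z) (Ell2.proj n v)
    rw [← hd.lineDeriv_eq_fderiv]
    unfold lineDeriv
    congr 1
    funext t
    rw [hφF, ← map_smul, ← map_add]
    rfl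
  rw [h1]
  exact memLp_cyl a r ((hF.continuous_fderiv (by simp)).clm_apply continuous_const)
    (hc.fderiv_apply (𝕜 := ℝ) _) 2

theorem memLp_test (a : ℕ → ℝ) (r : ℝ) {φ : Ell2 → ℂ} (hφ : IsTest φ) (q : ENNReal) :
    MemLp φ q (gaussP a r) := by
  obtain ⟨n, F, hF, hc, hφF⟩ := hφ
  have : φ = fun z => F (Ell2.proj n z) := by funext z; rw [hφF]; rfl
  rw [this]
  exact memLp_cyl a r hF.continuous hc q

theorem memLp_deltaOp (a : ℕ → ℝ) (r : ℝ) {φ : Ell2 → ℂ} (hφ : IsTest φ) (j : ℕ) :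
    MemLp (deltaOp a r j φ) 2 (gaussP a r) := by
  have h1 : MemLp (partialZ j φ) 2 (gaussP a r) :=
    ((memLp_lineDeriv a r hφ _).sub ((memLp_lineDeriv a r hφ _).const_mul Complex.I)).const_mul _
  have h2 : MemLp (fun z : Ell2 => conj (z j)) 2 (gaussP a r) :=
    (memLp_coord a r j).star
  have h3 : MemLp (fun z : Ell2 => conj (z j) / (2 * (r : ℂ) ^ 2 * (a j : ℂ) ^ 2)) 2
      (gaussP a r) := by
    simp_rw [div_eq_inv_mul]
    exact h2.const_mul _
  exact h1.sub ((memLp_test a r hφ ⊤).mul' h3)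

theorem epsSign_ne_zero {j : ℕ} {J K : Finset ℕ} (h : epsSign j J K ≠ 0) :
    j ∈ K ∧ J = K.erase j := by
  unfold epsSign at h
  split_ifs at h with h1
  · obtain ⟨h1, rfl⟩ := h1
    exact ⟨Finset.mem_insert_self _ _, (Finset.erase_insert h1).symm⟩
  · exact absurd rfl h

/-- The infinite sum in `dbarPairing` is the finite sum over `i ∈ K` and `J = K \ {i}`. -/
theorem dbarPairing_eq (a : ℕ → ℝ) (r : ℝ) {s t : ℕ} (f : L2Form a r s t) (I : MultiIdx s)
    (K : MultiIdx (t + 1)) (φ : Ell2 → ℂ) (z : Ell2) :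
    dbarPairing a r f I K φ z = ∑ i ∈ K.1.attach,
      epsSign i.1 (K.1.erase i.1) K.1
        * f (I, ⟨K.1.erase i.1, by rw [Finset.card_erase_of_mem i.2, K.2]; rfl⟩) z
        * conj (deltaOp a r i.1 φ z) := by
  have hin : ∀ (i : ℕ) (hi : i ∈ K.1),
      ∑' J : MultiIdx t, epsSign i J.1 K.1 * f (I, J) z * conj (deltaOp a r i φ z)
        = epsSign i (K.1.erase i) K.1
        * f (I, ⟨K.1.erase i, by rw [Finset.card_erase_of_mem hi, K.2]; rfl⟩) z
        * conj (deltaOp a r i φ z) := by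
    intro i hi
    rw [tsum_eq_single ⟨K.1.erase i, by rw [Finset.card_erase_of_mem hi, K.2]; rfl⟩]
    intro J hJ
    have : epsSign i J.1 K.1 = 0 := by
      by_contra h
      exact hJ (Subtype.ext (epsSign_ne_zero h).2)
    simp [this]
  unfold dbarPairing
  rw [tsum_eq_sum (s := K.1), ← Finset.sum_attach]
  · exact Finset.sum_congr rfl fun i _ => hin i.1 i.2
  · intro i hi
    have : ∀ J : MultiIdx t, epsSign i J.1 K.1 = 0 := by
      intro J
      by_contra h
      exact hi (epsSign_ne_zero h).1
    simp [this]

theorem integrable_dbarPairing {a : ℕ → ℝ} (ha : ∀ i, 0 < a i) (r : ℝ) {s t : ℕ}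
    (f : L2Form a r s t) (I : MultiIdx s) (K : MultiIdx (t + 1)) {φ : Ell2 → ℂ} (hφ : IsTest φ) :
    Integrable (dbarPairing a r f I K φ) (gaussP a r) := by
  have : dbarPairing a r f I K φ = _ := funext fun z => dbarPairing_eq a r f I K φ z
  rw [this]
  refine integrable_finsetSum _ fun i _ => ?_
  exact ((memLp_coeff ha r f _).const_mul _).integrable_mul (memLp_deltaOp a r hφ i.1).star

theorem integrable_coeff_test {a : ℕ → ℝ} (ha : ∀ i, 0 < a i) (r : ℝ) {s t : ℕ}
    (f : L2Form a r s t) (p : MultiIdx s × MultiIdx t) {φ : Ell2 → ℂ} (hφ : IsTest φ) (c : ℂ) :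
    Integrable (fun z => (c * f p z) * conj (φ z)) (gaussP a r) :=
  ((memLp_coeff ha r f p).const_mul c).integrable_mul (memLp_test a r hφ 2).star

theorem coeff_add {a : ℕ → ℝ} (ha : ∀ i, 0 < a i) (r : ℝ) {s t : ℕ} (f g : L2Form a r s t)
    (p : MultiIdx s × MultiIdx t) : ∀ᵐ z ∂(gaussP a r), (f + g) p z = f p z + g p z := by
  rw [← ae_weight ha r p]
  exact Lp.coeFn_add (f p) (g p)

theorem coeff_smul {a : ℕ → ℝ} (ha : ∀ i, 0 < a i) (r : ℝ) {s t : ℕ} (c : ℂ) (f : L2Form a r s t)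
    (p : MultiIdx s × MultiIdx t) : ∀ᵐ z ∂(gaussP a r), (c • f) p z = c * f p z := by
  rw [← ae_weight ha r p]
  exact Lp.coeFn_smul c (f p)

theorem coeff_zero {a : ℕ → ℝ} (ha : ∀ i, 0 < a i) (r : ℝ) {s t : ℕ}
    (p : MultiIdx s × MultiIdx t) :
    ∀ᵐ z ∂(gaussP a r), (0 : L2Form a r s t) p z = 0 := by
  rw [← ae_weight ha r p]
  exact Lp.coeFn_zero ℂ 2 _

theorem IsWeakDbar.add {a : ℕ → ℝ} (ha : ∀ i, 0 < a i) {r : ℝ} {s t : ℕ} {f₁ f₂ : L2Form a r s t}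
    {g₁ g₂ : L2Form a r s (t + 1)} (h₁ : IsWeakDbar a r f₁ g₁) (h₂ : IsWeakDbar a r f₂ g₂) :
    IsWeakDbar a r (f₁ + f₂) (g₁ + g₂) := by
  intro I K φ hφ
  have e1 : ∫ z, dbarPairing a r (f₁ + f₂) I K φ z ∂(gaussP a r)
      = ∫ z, (dbarPairing a r f₁ I K φ z + dbarPairing a r f₂ I K φ z) ∂(gaussP a r) := by
    refine integral_congr_ae ?_
    have : ∀ᵐ z ∂(gaussP a r), ∀ i : {x // x ∈ K.1},
        (f₁ + f₂) (I, ⟨K.1.erase i.1, by rw [Finset.card_erase_of_mem i.2, K.2]; rfl⟩) z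
        = f₁ (I, ⟨K.1.erase i.1, by rw [Finset.card_erase_of_mem i.2, K.2]; rfl⟩) z
          + f₂ (I, ⟨K.1.erase i.1, by rw [Finset.card_erase_of_mem i.2, K.2]; rfl⟩) z :=
      ae_all_iff.2 fun i => coeff_add ha r f₁ f₂ _
    filter_upwards [this] with z hz
    rw [dbarPairing_eq, dbarPairing_eq, dbarPairing_eq, ← Finset.sum_add_distrib]
    refine Finset.sum_congr rfl fun i _ => ?_
    rw [hz i]; ring
  have e2 : ∫ z, ((-1) ^ s * (g₁ + g₂) (I, K) z) * conj (φ z) ∂(gaussP a r)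
      = ∫ z, (((-1) ^ s * g₁ (I, K) z) * conj (φ z) + ((-1) ^ s * g₂ (I, K) z) * conj (φ z))
        ∂(gaussP a r) := by
    refine integral_congr_ae ?_
    filter_upwards [coeff_add ha r g₁ g₂ (I, K)] with z hz
    rw [hz]; ring
  rw [e1, e2, integral_add (integrable_dbarPairing ha r _ I K hφ)
    (integrable_dbarPairing ha r _ I K hφ), integral_add (integrable_coeff_test ha r _ _ hφ _)
    (integrable_coeff_test ha r _ _ hφ _), h₁ I K φ hφ, h₂ I K φ hφ]
  ring

theorem IsWeakDbar.smul {a : ℕ → ℝ} (ha : ∀ i, 0 < a i) {r : ℝ} {s t : ℕ} (c : ℂ)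
    {f : L2Form a r s t} {g : L2Form a r s (t + 1)} (h : IsWeakDbar a r f g) :
    IsWeakDbar a r (c • f) (c • g) := by
  intro I K φ hφ
  have e1 : ∫ z, dbarPairing a r (c • f) I K φ z ∂(gaussP a r)
      = ∫ z, c * dbarPairing a r f I K φ z ∂(gaussP a r) := by
    refine integral_congr_ae ?_
    have : ∀ᵐ z ∂(gaussP a r), ∀ i : {x // x ∈ K.1},
        (c • f) (I, ⟨K.1.erase i.1, by rw [Finset.card_erase_of_mem i.2, K.2]; rfl⟩) z
        = c * f (I, ⟨K.1.erase i.1, by rw [Finset.card_erase_of_mem i.2, K.2]; rfl⟩) z :=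
      ae_all_iff.2 fun i => coeff_smul ha r c f _
    filter_upwards [this] with z hz
    rw [dbarPairing_eq, dbarPairing_eq, Finset.mul_sum]
    refine Finset.sum_congr rfl fun i _ => ?_
    rw [hz i]; ring
  have e2 : ∫ z, ((-1) ^ s * (c • g) (I, K) z) * conj (φ z) ∂(gaussP a r)
      = ∫ z, c * (((-1) ^ s * g (I, K) z) * conj (φ z)) ∂(gaussP a r) := by
    refine integral_congr_ae ?_
    filter_upwards [coeff_smul ha r c g (I, K)] with z hz
    rw [hz]; ring
  rw [e1, e2, integral_const_mul, integral_const_mul, h I K φ hφ]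
  ring

theorem IsWeakDbar.zero {a : ℕ → ℝ} (ha : ∀ i, 0 < a i) (r : ℝ) (s t : ℕ) :
    IsWeakDbar a r (0 : L2Form a r s t) 0 := by
  intro I K φ hφ
  have e1 : ∫ z, dbarPairing a r (0 : L2Form a r s t) I K φ z ∂(gaussP a r) = 0 := by
    refine integral_eq_zero_of_ae ?_
    have : ∀ᵐ z ∂(gaussP a r), ∀ i : {x // x ∈ K.1}, (0 : L2Form a r s t)
        (I, ⟨K.1.erase i.1, by rw [Finset.card_erase_of_mem i.2, K.2]; rfl⟩) z = 0 :=
      ae_all_iff.2 fun i => coeff_zero ha r _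
    filter_upwards [this] with z hz
    rw [dbarPairing_eq]
    exact Finset.sum_eq_zero fun i _ => by rw [hz i]; ring
  rw [e1, neg_zero]
  refine integral_eq_zero_of_ae ?_
  filter_upwards [coeff_zero ha r (I, K)] with z hz
  rw [hz]; simp

/-- The graph of the weak `∂̄`. -/
def dbarGraph (a : ℕ → ℝ) (ha : ∀ i, 0 < a i) (r : ℝ) (s t : ℕ) :
    Submodule ℂ (L2Form a r s t × L2Form a r s (t + 1)) where
  carrier := {p | IsWeakDbar a r p.1 p.2}
  add_mem' h₁ h₂ := IsWeakDbar.add ha h₁ h₂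
  zero_mem' := IsWeakDbar.zero ha r s t
  smul_mem' c _ h := IsWeakDbar.smul ha c h

/-- A function in `L²(P_r)` that is orthogonal to all test functions vanishes. -/
theorem ae_zero_of_test (a : ℕ → ℝ) (r : ℝ) {g : Ell2 → ℂ} (hg : MemLp g 2 (gaussP a r))
    (h : ∀ φ, IsTest φ → ∫ z, g z * conj (φ z) ∂(gaussP a r) = 0) : g =ᵐ[gaussP a r] 0 := by
  have hgi : Integrable g (gaussP a r) := hg.integrable (by norm_num)
  -- integrals over cylinder sets vanish
  have key : ∀ (n : ℕ) (A : Set (Fin (n + 1) → ℂ)), MeasurableSet A →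
      ∫ z in Ell2.proj n ⁻¹' A, g z ∂(gaussP a r) = 0 := by
    intro n A hA
    have hp : Measurable (Ell2.proj n) := (Ell2.proj n).continuous.measurable
    obtain ⟨ν, hν⟩ : ∃ ν, ν = (gaussP a r).map (Ell2.proj n) := ⟨_, rfl⟩
    have hfin : IsFiniteMeasure ν := hν ▸ inferInstance
    have hbdd : ∀ G : (Fin (n + 1) → ℂ) → ℝ, ContDiff ℝ ∞ G → HasCompactSupport G →
        Integrable (fun z => G (Ell2.proj n z) • g z) (gaussP a r) := by
      intro G hG hGc
      obtain ⟨C, hC⟩ := hG.continuous.bounded_above_of_compact_support hGc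
      exact hgi.bdd_smul C (hG.continuous.comp (Ell2.proj n).continuous).aestronglyMeasurable
        (Filter.Eventually.of_forall fun z => hC _)
    have himap : ∀ k : (Fin (n + 1) → ℂ) → ℂ, StronglyMeasurable k →
        ∀ G : (Fin (n + 1) → ℂ) → ℝ, ContDiff ℝ ∞ G →
        ∫ x, G x • k x ∂ν
          = ∫ z, G (Ell2.proj n z) • k (Ell2.proj n z) ∂(gaussP a r) := fun k hk G hG => hν ▸
      integral_map hp.aemeasurable
        (hG.continuous.aestronglyMeasurable.smul hk.aestronglyMeasurable)
    have hkint : ∀ k : (Fin (n + 1) → ℂ) → ℂ, StronglyMeasurable k →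
        Integrable (k ∘ Ell2.proj n) (gaussP a r) →
        Integrable k ν := fun k hk h => hν ▸
      (integrable_map_measure hk.aestronglyMeasurable hp.aemeasurable).2 h
    have hae : ∀ k : (Fin (n + 1) → ℂ) → ℂ,
        (∀ᵐ x ∂ν, k x = 0) →
        ∀ᵐ z ∂(gaussP a r), k (Ell2.proj n z) = 0 := fun k h =>
      ae_of_ae_map hp.aemeasurable (hν ▸ h)
    set m : MeasurableSpace Ell2 := MeasurableSpace.comap (Ell2.proj n) inferInstance with hm
    have hle : m ≤ Ell2.instMeasurableSpace := hp.comap_le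
    obtain ⟨k, hk, hkc⟩ := (stronglyMeasurable_condExp (μ := gaussP a r) (m := m)
      (f := g)).exists_eq_measurable_comp
    have hint : Integrable (k ∘ Ell2.proj n) (gaussP a r) := hkc ▸ integrable_condExp
    have hk0 : ∀ᵐ x ∂ν, k x = 0 := by
      have hki : Integrable k ν :=
        hkint k hk hint
      refine ae_eq_zero_of_integral_contDiff_smul_eq_zero hki.locallyIntegrable fun G hG hGc => ?_
      rw [himap k hk G hG]
      have hT : IsTest fun z => ((G (Ell2.proj n z) : ℝ) : ℂ) :=
        ⟨n, fun x => (G x : ℂ), Complex.ofRealCLM.contDiff.comp hG,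
          hGc.comp_left (g := fun x : ℝ => (x : ℂ)) (by simp), fun z => rfl⟩
      have e := h _ hT
      have hGm : StronglyMeasurable[m] fun z => G (Ell2.proj n z) :=
        hG.continuous.stronglyMeasurable.comp_measurable (comap_measurable (Ell2.proj n))
      have hGg := hbdd G hG hGc
      have e2 : (gaussP a r)[fun z => G (Ell2.proj n z) • g z | m]
          =ᵐ[gaussP a r] fun z => G (Ell2.proj n z) • ((gaussP a r)[g | m]) z :=
        condExp_smul_of_aestronglyMeasurable_left hGm.aestronglyMeasurable hGg hgi
      have e3 := integral_congr_ae e2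
      rw [integral_condExp hle, hkc] at e3
      refine e3.symm.trans ?_
      rw [← e]
      refine integral_congr_ae (Filter.Eventually.of_forall fun z => ?_)
      simp [mul_comm]
    have hs : MeasurableSet[m] (Ell2.proj n ⁻¹' A) := ⟨A, hA, rfl⟩
    rw [← setIntegral_condExp hle hgi hs, hkc]
    refine integral_eq_zero_of_ae (ae_restrict_of_ae ?_)
    exact hae k hk0
  -- cylinder sets generate the Borel sets
  let C : Set (Set Ell2) :=
    {S | ∃ (n : ℕ) (A : Set (Fin (n + 1) → ℂ)), MeasurableSet A ∧ S = Ell2.proj n ⁻¹' A}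
  have hgen : Ell2.instMeasurableSpace = MeasurableSpace.generateFrom C := by
    refine le_antisymm ?_ (MeasurableSpace.generateFrom_le ?_)
    · have h1 := Ell2.coords_measurableEmbedding.comap_eq
      rw [← h1, ← measurable_iff_comap_le]
      refine @measurable_pi_lambda _ _ _ (MeasurableSpace.generateFrom C) _ _ fun i => ?_
      have : @Measurable _ _ (MeasurableSpace.generateFrom C) _ (fun z : Ell2 => z i) := by
        intro B hB
        refine MeasurableSpace.measurableSet_generateFrom
          ⟨i, (fun x => x (Fin.last i)) ⁻¹' B, measurable_pi_apply _ hB, rfl⟩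
      exact (Complex.measurable_re.comp this).prodMk (Complex.measurable_im.comp this)
    · rintro _ ⟨n, A, hA, rfl⟩
      exact (Ell2.proj n).continuous.measurable hA
  have hpi : IsPiSystem C := by
    rintro _ ⟨n, A, hA, rfl⟩ _ ⟨k, B, hB, rfl⟩ _
    have em : ∀ j, (hj : j ≤ max n k) → Measurable fun (x : Fin (max n k + 1) → ℂ) (i : Fin (j + 1)) =>
        x ⟨i, by have := i.2; omega⟩ := fun j hj => measurable_pi_lambda _ fun i => measurable_pi_apply _
    exact ⟨max n k, _, (em n (le_max_left _ _) hA).inter (em k (le_max_right _ _) hB), rfl⟩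
  have hall : ∀ S : Set Ell2, MeasurableSet S → ∫ z in S, g z ∂(gaussP a r) = 0 := by
    intro S hS
    refine MeasurableSpace.induction_on_inter
      (C := fun S _ => ∫ z in S, g z ∂(gaussP a r) = 0) hgen hpi ?_ ?_ ?_ ?_ S hS
    · simp
    · rintro _ ⟨n, A, hA, rfl⟩
      exact key n A hA
    · intro S hS h0
      have h1 := integral_add_compl hS hgi
      have h2 := key 0 Set.univ MeasurableSet.univ
      rw [Set.preimage_univ, Measure.restrict_univ] at h2
      rw [h0, h2, zero_add] at h1
      exact h1
    · intro f hd hf h0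
      rw [integral_iUnion hf hd hgi.integrableOn]
      simp [h0]
  exact hgi.ae_eq_zero_of_forall_setIntegral_eq_zero fun S hS _ => hall S hS

theorem dbarGraph_functional (a : ℕ → ℝ) (ha : ∀ i, 0 < a i) (r : ℝ) (s t : ℕ)
    (p : L2Form a r s t × L2Form a r s (t + 1)) (hp : p ∈ dbarGraph a ha r s t) (h0 : p.1 = 0) :
    p.2 = 0 := by
  have hp' : IsWeakDbar a r p.1 p.2 := hp
  have hz := IsWeakDbar.zero ha r s t
  ext1
  funext q
  have hq : (p.2 q : Ell2 → ℂ) =ᵐ[gaussP a r] 0 := by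
    refine ae_zero_of_test a r (memLp_coeff ha r p.2 q) fun φ hφ => ?_
    have h1 := hp' q.1 q.2 φ hφ
    rw [h0, ← hz q.1 q.2 φ hφ] at h1
    have h2 : ∫ z, ((-1) ^ s * (0 : L2Form a r s (t + 1)) (q.1, q.2) z) * conj (φ z) ∂(gaussP a r)
        = 0 := by
      refine integral_eq_zero_of_ae ?_
      filter_upwards [coeff_zero ha r (q.1, q.2)] with z hz
      rw [hz]; simp
    rw [h2] at h1
    simp_rw [mul_assoc] at h1
    rw [integral_const_mul] at h1
    exact (mul_eq_zero.1 h1).resolve_left (by simp)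
  rw [← ae_weight ha r q] at hq
  exact (Lp.eq_zero_iff_ae_eq_zero).2 hq

/-- The operator `∂̄ : L²_{(s,t)}(ℓ², P_r) → L²_{(s,t+1)}(ℓ², P_r)` with domain `D_∂̄`. For a given
`(s,t)` the operator `T` is `∂̄` on `(s,t)`-forms and `S` is `∂̄` on `(s,t+1)`-forms. -/
def dbar (a : ℕ → ℝ) (ha : ∀ i, 0 < a i) (r : ℝ) (s t : ℕ) :
    L2Form a r s t →ₗ.[ℂ] L2Form a r s (t + 1) :=
  (dbarGraph a ha r s t).toLinearPMap

theorem dbar_graph (a : ℕ → ℝ) (ha : ∀ i, 0 < a i) (r : ℝ) (s t : ℕ) :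
    (dbar a ha r s t).graph = dbarGraph a ha r s t :=
  Submodule.toLinearPMap_graph_eq _ fun p hp h0 => dbarGraph_functional a ha r s t p hp h0

end

/-!
The operators split into finite matrices once forms are expanded in complex Hermite polynomials.

For a multiset `m` of the variables `z̄_j` and `z_j` let `herm m` be the polynomial obtained from `1` by
applying the creation operators `raise i` (`-δ_j` for `z̄_j`, its conjugate for `z_j`). Gaussian
integration by parts (`integral_partialZbar_mul_conj`) makes `raise i` adjoint to `∂/∂X_i`, and
`[∂/∂X_i, raise k] = c_i δ_{ik}` with `c_i = 1/(2r²a_j²)`, so that the `herm m` are orthogonal and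
`‖herm (i + m)‖² = (m_i + 1) c_i ‖herm m‖²`. They span the polynomials. The polynomials are dense in
`L²(P_r)` (`ae_zero_of_poly`): if `u` is orthogonal to them, the exponential moments of the Gaussian
law show that `∫ u exp(iL) dP_r = 0` for every real linear function `L` of finitely many coordinates,
hence `u` is orthogonal to all cylinder functions.

The weak equation defining `∂̄` extends from compactly supported test functions to polynomials
(`IsWeakDbar.poly`, by cutoffs). Tested with `herm m` it expresses each Hermite coefficient of `∂̄ f` as
a finite sum of coefficients of `f`. Conversely `∂̄` is explicit on the forms `herm m dz_I ∧ dz̄_J`, which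
lie in its domain; this yields the coefficients of the adjoint (`hermCoeff_adjoint`). Both operators
preserve `I` and the total content `Γ = m + J`, so the inequality can be proved for fixed `I` and `Γ`
and summed with Parseval's identity (`ofReal_norm_sq_form`). In particular no approximation of
`f ∈ D_S ∩ D_{T*}` in the graph norm is needed.

For fixed `I` and `Γ` only sets `K ⊆ A = {j | z̄_j ∈ Γ}` occur. With `n_j` the multiplicity of `z̄_j` in
`Γ`, the weights of the block are proportional to `ρ^|K| ∏_{j ∈ K} n_j`, where `ρ = 1/(2r²)`, and up to
signs `S` is the exterior multiplication by `∑_{i ∈ A} e_i`, while `T*` is `ρ` times the adjoint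
contraction. Hence
`‖T* f‖² + ‖S f‖² = ρ (∑_{j ∈ A} n_j) ‖f‖²` on the block (`contraction_add_wedge`). If the block
contains a nonzero `f_{I,K}` with `|K| = t + 1`, then `∑_{j ∈ A} n_j ≥ |A| ≥ t + 1`, which is the
claimed constant (`block_estimate`).
-/

open MeasureTheory ProbabilityTheory
open scoped ComplexConjugate ContDiff

noncomputable section

/-! ### Gaussian integration by parts on `ℓ²` -/

/-- Gaussian integration by parts on the real line. -/
theorem integral_deriv_gaussianReal {v : NNReal} (hv : v ≠ 0) {u u' : ℝ → ℂ}
    (hd : ∀ x, HasDerivAt u (u' x) x) (hu : Integrable u (gaussianReal 0 v))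
    (hu' : Integrable u' (gaussianReal 0 v))
    (hxu : Integrable (fun x : ℝ => (x : ℂ) * u x) (gaussianReal 0 v)) :
    ∫ x, u' x ∂(gaussianReal 0 v) = ∫ x : ℝ, ((x : ℂ) / (v : ℝ)) * u x ∂(gaussianReal 0 v) := by
  have key : ∀ w : ℝ → ℂ, Integrable w (gaussianReal 0 v) →
      Integrable (fun x => (gaussianPDFReal 0 v x : ℂ) * w x) := by
    intro w hw
    rw [gaussianReal_of_var_ne_zero _ hv, integrable_withDensity_iff_integrable_smul'
      (measurable_gaussianPDF _ _) (by simp [gaussianPDF])] at hw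
    refine hw.congr (Filter.Eventually.of_forall fun x => ?_)
    simp [gaussianPDF_def, ENNReal.toReal_ofReal, gaussianPDFReal_nonneg]
  have hg : ∀ x : ℝ, HasDerivAt (fun x => (gaussianPDFReal 0 v x : ℂ))
      (-((x : ℂ) / (v : ℝ)) * gaussianPDFReal 0 v x) x := by
    intro x
    have hv' : (v : ℝ) ≠ 0 := by exact_mod_cast hv
    have h1 : HasDerivAt (fun x : ℝ => -(x - 0) ^ 2 / (2 * (v : ℝ))) (-(x / v)) x := by
      have := (((hasDerivAt_id x).sub_const 0).pow 2).neg.div_const (2 * (v : ℝ))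
      convert! this using 1
      field_simp
      simp [mul_comm]
    have h2 := (h1.exp.const_mul ((Real.sqrt (2 * Real.pi * v))⁻¹)).ofReal_comp
    convert! h2 using 1
    simp only [gaussianPDFReal]
    push_cast
    ring_nf
  have hvc : ((v : ℝ) : ℂ) ≠ 0 := by exact_mod_cast hv
  have hxu' : Integrable (fun x : ℝ => ((x : ℂ) / (v : ℝ)) * u x) (gaussianReal 0 v) := by
    refine (hxu.const_mul (((v : ℝ) : ℂ)⁻¹)).congr (Filter.Eventually.of_forall fun x => ?_)
    simp only; field_simp
  have hz := integral_eq_zero_of_hasDerivAt_of_integrable (f := fun x => (gaussianPDFReal 0 v x : ℂ) * u x)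
    (f' := fun x => -((x : ℂ) / (v : ℝ)) * gaussianPDFReal 0 v x * u x
      + gaussianPDFReal 0 v x * u' x) (fun x => (hg x).mul (hd x))
    (by
      refine ((key _ hu').sub (key _ hxu')).congr (Filter.Eventually.of_forall fun x => ?_)
      simp only [Pi.sub_apply]; ring) (key _ hu)
  rw [integral_gaussianReal_eq_integral_smul hv, integral_gaussianReal_eq_integral_smul hv]
  simp only [Complex.real_smul]
  rw [← sub_eq_zero, ← integral_sub (key _ hu') (key _ hxu'), ← hz]
  refine integral_congr_ae (Filter.Eventually.of_forall fun x => ?_)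
  simp only; ring

/-- The law `N_{r a_j} × N_{r a_j}` of the coordinate `(x_j, y_j)`. -/
def gaussPair (a : ℕ → ℝ) (r : ℝ) (j : ℕ) : Measure (ℝ × ℝ) :=
  (gaussianReal 0 (Real.toNNReal ((r * a j) ^ 2))).prod
    (gaussianReal 0 (Real.toNNReal ((r * a j) ^ 2)))

instance (a : ℕ → ℝ) (r : ℝ) (j : ℕ) : IsProbabilityMeasure (gaussPair a r j) := by
  unfold gaussPair; infer_instance

/-- Resampling one coordinate preserves the product measure. -/
theorem gaussProduct_map_update (a : ℕ → ℝ) (r : ℝ) (j : ℕ) :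
    ((gaussProduct a r).prod (gaussPair a r j)).map
      (fun p : (ℕ → ℝ × ℝ) × (ℝ × ℝ) => Function.update p.1 j p.2) = gaussProduct a r := by
  have hm : Measurable (fun p : (ℕ → ℝ × ℝ) × (ℝ × ℝ) => Function.update p.1 j p.2) := by
    refine measurable_pi_lambda _ fun i => ?_
    by_cases h : i = j
    · subst h; simpa using measurable_snd
    · simpa [h, Function.comp_def] using (measurable_pi_apply i).comp measurable_fst
  conv_rhs => rw [gaussProduct]
  refine Measure.eq_infinitePi _ fun s t ht => ?_
  have ht' : MeasurableSet ((s : Set ℕ).pi t) :=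
    MeasurableSet.pi s.countable_toSet fun i _ => ht i
  have hpi : ∀ s : Finset ℕ, (gaussProduct a r) ((s : Set ℕ).pi t) = ∏ i ∈ s, gaussPair a r i (t i) :=
    fun s => Measure.infinitePi_pi _ fun i _ => ht i
  rw [Measure.map_apply hm ht']
  by_cases hj : j ∈ s
  · have : (fun p : (ℕ → ℝ × ℝ) × (ℝ × ℝ) => Function.update p.1 j p.2) ⁻¹' ((s : Set ℕ).pi t)
        = (((s.erase j : Finset ℕ) : Set ℕ).pi t) ×ˢ (t j) := by
      ext p
      simp only [Set.mem_preimage, Set.mem_pi, Set.mem_prod, Finset.mem_coe, Finset.mem_erase]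
      constructor
      · intro h
        refine ⟨fun i hi => ?_, ?_⟩
        · simpa [hi.1] using h i hi.2
        · simpa using h j hj
      · rintro ⟨h1, h2⟩ i hi
        by_cases hij : i = j
        · subst hij; simpa using h2
        · simpa [hij] using h1 i ⟨hij, hi⟩
    rw [this, Measure.prod_prod, hpi, Finset.prod_erase_mul _ _ hj]
    rfl
  · have : (fun p : (ℕ → ℝ × ℝ) × (ℝ × ℝ) => Function.update p.1 j p.2) ⁻¹' ((s : Set ℕ).pi t)
        = ((s : Set ℕ).pi t) ×ˢ Set.univ := by
      ext p
      simp only [Set.mem_preimage, Set.mem_pi, Set.mem_prod, Finset.mem_coe, Set.mem_univ, and_true]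
      refine forall₂_congr fun i hi => ?_
      have : i ≠ j := fun h => hj (h ▸ hi)
      simp [this]
    rw [this, Measure.prod_prod, hpi, measure_univ, mul_one]
    rfl

/-- Square summability makes `ℓ²` a set of full measure, so that no mass is lost by restricting. -/
theorem gaussP_map_coords (a : ℕ → ℝ) (r : ℝ) (hsum : Summable fun i => a i ^ 2) :
    (gaussP a r).map Ell2.coords = gaussProduct a r := by
  have := gaussP_prob a r hsum
  have : IsProbabilityMeasure ((gaussP a r).map Ell2.coords) :=
    Measure.isProbabilityMeasure_map Ell2.coords_measurableEmbedding.measurable.aemeasurable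
  exact Measure.eq_of_le_of_isProbabilityMeasure (gaussP_map_coords_le a r)

/-- Replace the `j`-th coordinate of `z` by `u + √-1 v`. -/
def Ell2.setCoord (j : ℕ) (z : Ell2) (p : ℝ × ℝ) : Ell2 :=
  z + (lp.single 2 j ((⟨p.1, p.2⟩ : ℂ) - z j) : Ell2)

theorem Ell2.setCoord_apply (j : ℕ) (z : Ell2) (p : ℝ × ℝ) (i : ℕ) :
    Ell2.setCoord j z p i = if i = j then ⟨p.1, p.2⟩ else z i := by
  unfold Ell2.setCoord
  by_cases h : i = j
  · subst h; simp
  · simp [h]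

theorem Ell2.coords_setCoord (j : ℕ) (z : Ell2) (p : ℝ × ℝ) :
    Ell2.coords (Ell2.setCoord j z p) = Function.update (Ell2.coords z) j p := by
  funext i
  by_cases h : i = j
  · subst h; simp [Ell2.coords, Ell2.setCoord_apply]
  · simp [Ell2.coords, Ell2.setCoord_apply, h]

theorem Ell2.measurable_setCoord (j : ℕ) :
    Measurable fun q : Ell2 × (ℝ × ℝ) => Ell2.setCoord j q.1 q.2 := by
  rw [← Ell2.coords_measurableEmbedding.measurable_comp_iff]
  refine measurable_pi_lambda _ fun i => ?_
  have : ∀ q : Ell2 × (ℝ × ℝ), (Ell2.coords ∘ fun q : Ell2 × (ℝ × ℝ) => Ell2.setCoord j q.1 q.2) q i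
      = if i = j then q.2 else Ell2.coords q.1 i := by
    intro q
    simp only [Function.comp, Ell2.coords_setCoord, Function.update_apply]
  simp only [this]
  by_cases h : i = j
  · simpa [h] using measurable_snd
  · simpa [h, Function.comp_def] using ((measurable_pi_apply i).comp
      Ell2.coords_measurableEmbedding.measurable).comp measurable_fst

/-- Resampling one coordinate preserves `P_r`. This reduces integrals over `ℓ²` to Gaussian integrals
in the two real variables of that coordinate. -/
theorem gaussP_map_setCoord (a : ℕ → ℝ) (r : ℝ) (hsum : Summable fun i => a i ^ 2) (j : ℕ) :
    MeasurePreserving (fun q : Ell2 × (ℝ × ℝ) => Ell2.setCoord j q.1 q.2)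
      ((gaussP a r).prod (gaussPair a r j)) (gaussP a r) := by
  refine ⟨Ell2.measurable_setCoord j, ?_⟩
  have hc := Ell2.coords_measurableEmbedding
  have h : Measure.map Ell2.coords (((gaussP a r).prod (gaussPair a r j)).map
      (fun q : Ell2 × (ℝ × ℝ) => Ell2.setCoord j q.1 q.2)) = (gaussP a r).map Ell2.coords := by
    have hm : Measurable (fun p : (ℕ → ℝ × ℝ) × (ℝ × ℝ) => Function.update p.1 j p.2) := by
      refine measurable_pi_lambda _ fun i => ?_
      by_cases h : i = j
      · subst h; simpa using measurable_snd
      · simpa [h, Function.comp_def] using (measurable_pi_apply i).comp measurable_fst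
    rw [Measure.map_map hc.measurable (Ell2.measurable_setCoord j), gaussP_map_coords a r hsum,
      ← gaussProduct_map_update a r j, ← gaussP_map_coords a r hsum]
    have : ((gaussP a r).map Ell2.coords).prod (gaussPair a r j)
        = ((gaussP a r).prod (gaussPair a r j)).map (Prod.map Ell2.coords id) := by
      rw [← Measure.map_prod_map _ _ hc.measurable measurable_id, Measure.map_id]
    rw [this, Measure.map_map hm (hc.measurable.prodMap measurable_id)]
    congr 1
    funext q
    simp [Ell2.coords_setCoord]
  have h2 := congrArg (Measure.comap Ell2.coords) h
  rwa [hc.comap_map, hc.comap_map] at h2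

theorem integral_deriv_fst_gaussian {v : NNReal} (hv : v ≠ 0) {U U' : ℝ × ℝ → ℂ}
    (hd : ∀ x y, HasDerivAt (fun s => U (s, y)) (U' (x, y)) x)
    (hU : Integrable U ((gaussianReal 0 v).prod (gaussianReal 0 v)))
    (hU' : Integrable U' ((gaussianReal 0 v).prod (gaussianReal 0 v)))
    (hxU : Integrable (fun p : ℝ × ℝ => (p.1 : ℂ) * U p)
      ((gaussianReal 0 v).prod (gaussianReal 0 v))) :
    ∫ p, U' p ∂((gaussianReal 0 v).prod (gaussianReal 0 v))
      = ((v : ℝ) : ℂ)⁻¹ * ∫ p : ℝ × ℝ, (p.1 : ℂ) * U p ∂((gaussianReal 0 v).prod (gaussianReal 0 v)) := by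
  rw [integral_prod_symm _ hU', integral_prod_symm _ hxU, ← integral_const_mul]
  refine integral_congr_ae ?_
  filter_upwards [hU.prod_left_ae, hU'.prod_left_ae, hxU.prod_left_ae] with y h1 h2 h3
  rw [integral_deriv_gaussianReal hv (fun x => hd x y) h1 h2 h3, ← integral_const_mul]
  refine integral_congr_ae (Filter.Eventually.of_forall fun x => ?_)
  simp only; ring

theorem integral_deriv_snd_gaussian {v : NNReal} (hv : v ≠ 0) {U U' : ℝ × ℝ → ℂ}
    (hd : ∀ x y, HasDerivAt (fun s => U (x, s)) (U' (x, y)) y)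
    (hU : Integrable U ((gaussianReal 0 v).prod (gaussianReal 0 v)))
    (hU' : Integrable U' ((gaussianReal 0 v).prod (gaussianReal 0 v)))
    (hxU : Integrable (fun p : ℝ × ℝ => (p.2 : ℂ) * U p)
      ((gaussianReal 0 v).prod (gaussianReal 0 v))) :
    ∫ p, U' p ∂((gaussianReal 0 v).prod (gaussianReal 0 v))
      = ((v : ℝ) : ℂ)⁻¹ * ∫ p : ℝ × ℝ, (p.2 : ℂ) * U p ∂((gaussianReal 0 v).prod (gaussianReal 0 v)) := by
  rw [← integral_prod_swap, ← integral_prod_swap (fun p : ℝ × ℝ => (p.2 : ℂ) * U p)]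
  exact integral_deriv_fst_gaussian hv (U := U ∘ Prod.swap) (U' := U' ∘ Prod.swap)
    (fun x y => hd y x) hU.swap hU'.swap hxU.swap

theorem Ell2.setCoord_eq (j : ℕ) (z : Ell2) (p : ℝ × ℝ) :
    Ell2.setCoord j z p = z - lp.single 2 j (z j) + p.1 • (lp.single 2 j (1 : ℂ) : Ell2)
      + p.2 • (lp.single 2 j Complex.I : Ell2) := by
  ext i
  rw [Ell2.setCoord_apply]
  change _ = z i - (lp.single 2 j (z j) : Ell2) i + p.1 • (lp.single 2 j (1 : ℂ) : Ell2) i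
    + p.2 • (lp.single 2 j Complex.I : Ell2) i
  by_cases h : i = j
  · subst h
    simp [Complex.ext_iff]
  · simp [h]

theorem Ell2.setCoord_re (j : ℕ) (z : Ell2) (p : ℝ × ℝ) : (Ell2.setCoord j z p j).re = p.1 := by
  simp [Ell2.setCoord_apply]

theorem Ell2.setCoord_im (j : ℕ) (z : Ell2) (p : ℝ × ℝ) : (Ell2.setCoord j z p j).im = p.2 := by
  simp [Ell2.setCoord_apply]

theorem toNNReal_var {a : ℕ → ℝ} (ha : ∀ i, 0 < a i) {r : ℝ} (hr : 0 < r) (j : ℕ) :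
    Real.toNNReal ((r * a j) ^ 2) ≠ 0 ∧ ((Real.toNNReal ((r * a j) ^ 2) : NNReal) : ℝ) = (r * a j) ^ 2 := by
  have h : 0 < (r * a j) ^ 2 := pow_pos (mul_pos hr (ha j)) 2
  exact ⟨by simpa using (Real.toNNReal_pos.2 h).ne', Real.coe_toNNReal _ h.le⟩

theorem integral_comp_measurePreserving {α β : Type*} [MeasurableSpace α] [MeasurableSpace β]
    {μ : Measure α} {ν : Measure β} {g : α → β} (hg : MeasurePreserving g μ ν) {w : β → ℂ}
    (hw : Integrable w ν) : ∫ y, w y ∂ν = ∫ x, (w ∘ g) x ∂μ := by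
  rw [← hg.map_eq, integral_map hg.measurable.aemeasurable
    (hg.map_eq.symm ▸ hw.aestronglyMeasurable)]
  rfl

/-- Gaussian integration by parts in the direction of the real part of the `j`-th coordinate. -/
theorem integral_dX {a : ℕ → ℝ} (ha : ∀ i, 0 < a i) {r : ℝ} (hr : 0 < r)
    (hsum : Summable fun i => a i ^ 2) (j : ℕ) {Φ : Ell2 → ℂ} (hΦ : Differentiable ℝ Φ)
    (h1 : Integrable Φ (gaussP a r)) (h2 : Integrable (dX j Φ) (gaussP a r))
    (h3 : Integrable (fun z : Ell2 => ((z j).re : ℂ) * Φ z) (gaussP a r)) :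
    ∫ z, dX j Φ z ∂(gaussP a r)
      = (((r * a j) ^ 2 : ℝ) : ℂ)⁻¹ * ∫ z : Ell2, ((z j).re : ℂ) * Φ z ∂(gaussP a r) := by
  have := gaussP_prob a r hsum
  have hR := gaussP_map_setCoord a r hsum j
  obtain ⟨hv0, hv⟩ := toNNReal_var ha hr j
  have i1 := hR.integrable_comp_of_integrable h1
  have i2 := hR.integrable_comp_of_integrable h2
  have i3 := hR.integrable_comp_of_integrable h3
  have e2 := integral_comp_measurePreserving hR h2
  have e3 := integral_comp_measurePreserving hR h3
  rw [e2, e3, integral_prod _ i2, integral_prod _ i3, ← integral_const_mul]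
  refine integral_congr_ae ?_
  filter_upwards [i1.prod_right_ae, i2.prod_right_ae, i3.prod_right_ae] with z k1 k2 k3
  simp only [Function.comp, Ell2.setCoord_re] at k1 k2 k3 ⊢
  rw [← hv]
  refine integral_deriv_fst_gaussian hv0 (U := fun p => Φ (Ell2.setCoord j z p)) (fun x y => ?_)
    k1 k2 k3
  have hl : HasDerivAt (fun s : ℝ => Ell2.setCoord j z (s, y)) (lp.single 2 j (1 : ℂ)) x := by
    simp only [Ell2.setCoord_eq]
    simpa using (((hasDerivAt_id x).smul_const (lp.single 2 j (1 : ℂ) : Ell2)).const_add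
      (z - lp.single 2 j (z j))).add_const (y • (lp.single 2 j Complex.I : Ell2))
  have := (hΦ (Ell2.setCoord j z (x, y))).hasFDerivAt.comp_hasDerivAt x hl
  rw [dX, (hΦ _).lineDeriv_eq_fderiv]
  exact this

/-- Gaussian integration by parts in the direction of the imaginary part of the `j`-th coordinate. -/
theorem integral_dY {a : ℕ → ℝ} (ha : ∀ i, 0 < a i) {r : ℝ} (hr : 0 < r)
    (hsum : Summable fun i => a i ^ 2) (j : ℕ) {Φ : Ell2 → ℂ} (hΦ : Differentiable ℝ Φ)
    (h1 : Integrable Φ (gaussP a r)) (h2 : Integrable (dY j Φ) (gaussP a r))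
    (h3 : Integrable (fun z : Ell2 => ((z j).im : ℂ) * Φ z) (gaussP a r)) :
    ∫ z, dY j Φ z ∂(gaussP a r)
      = (((r * a j) ^ 2 : ℝ) : ℂ)⁻¹ * ∫ z : Ell2, ((z j).im : ℂ) * Φ z ∂(gaussP a r) := by
  have := gaussP_prob a r hsum
  have hR := gaussP_map_setCoord a r hsum j
  obtain ⟨hv0, hv⟩ := toNNReal_var ha hr j
  have i1 := hR.integrable_comp_of_integrable h1
  have i2 := hR.integrable_comp_of_integrable h2
  have i3 := hR.integrable_comp_of_integrable h3
  have e2 := integral_comp_measurePreserving hR h2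
  have e3 := integral_comp_measurePreserving hR h3
  rw [e2, e3, integral_prod _ i2, integral_prod _ i3, ← integral_const_mul]
  refine integral_congr_ae ?_
  filter_upwards [i1.prod_right_ae, i2.prod_right_ae, i3.prod_right_ae] with z k1 k2 k3
  simp only [Function.comp, Ell2.setCoord_im] at k1 k2 k3 ⊢
  rw [← hv]
  refine integral_deriv_snd_gaussian hv0 (U := fun p => Φ (Ell2.setCoord j z p)) (fun x y => ?_)
    k1 k2 k3
  have hl : HasDerivAt (fun s : ℝ => Ell2.setCoord j z (x, s)) (lp.single 2 j Complex.I) y := by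
    simp only [Ell2.setCoord_eq]
    simpa using ((hasDerivAt_id y).smul_const (lp.single 2 j Complex.I : Ell2)).const_add
      (z - lp.single 2 j (z j) + x • (lp.single 2 j (1 : ℂ) : Ell2))
  have := (hΦ (Ell2.setCoord j z (x, y))).hasFDerivAt.comp_hasDerivAt y hl
  rw [dY, (hΦ _).lineDeriv_eq_fderiv]
  exact this

/-- The derivative `∂̄_j φ = (D_{x_j} φ + √-1 D_{y_j} φ) / 2`. -/
def partialZbar (j : ℕ) (φ : Ell2 → ℂ) (z : Ell2) : ℂ :=
  (1 / 2) * (dX j φ z + Complex.I * dY j φ z)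

theorem integral_partialZbar {a : ℕ → ℝ} (ha : ∀ i, 0 < a i) {r : ℝ} (hr : 0 < r)
    (hsum : Summable fun i => a i ^ 2) (j : ℕ) {Φ : Ell2 → ℂ} (hΦ : Differentiable ℝ Φ)
    (h1 : Integrable Φ (gaussP a r)) (h2 : Integrable (dX j Φ) (gaussP a r))
    (h2' : Integrable (dY j Φ) (gaussP a r))
    (h3 : Integrable (fun z : Ell2 => z j * Φ z) (gaussP a r)) :
    ∫ z, partialZbar j Φ z ∂(gaussP a r)
      = ∫ z : Ell2, z j / (2 * (r : ℂ) ^ 2 * (a j : ℂ) ^ 2) * Φ z ∂(gaussP a r) := by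
  have hm := Ell2.measurable_coord j
  have hx : Integrable (fun z : Ell2 => ((z j).re : ℂ) * Φ z) (gaussP a r) := by
    refine h3.mono ((Complex.measurable_ofReal.comp
      (Complex.measurable_re.comp hm)).aestronglyMeasurable.mul h1.aestronglyMeasurable)
      (Filter.Eventually.of_forall fun z => ?_)
    simp only [norm_mul, Complex.norm_real]
    gcongr
    exact Complex.abs_re_le_norm _
  have hy : Integrable (fun z : Ell2 => ((z j).im : ℂ) * Φ z) (gaussP a r) := by
    refine h3.mono ((Complex.measurable_ofReal.comp
      (Complex.measurable_im.comp hm)).aestronglyMeasurable.mul h1.aestronglyMeasurable)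
      (Filter.Eventually.of_forall fun z => ?_)
    simp only [norm_mul, Complex.norm_real]
    gcongr
    exact Complex.abs_im_le_norm _
  have e : ∀ z : Ell2, z j / (2 * (r : ℂ) ^ 2 * (a j : ℂ) ^ 2) * Φ z
      = (1 / 2) * ((((r * a j) ^ 2 : ℝ) : ℂ)⁻¹ * (((z j).re : ℂ) * Φ z)
        + Complex.I * ((((r * a j) ^ 2 : ℝ) : ℂ)⁻¹ * (((z j).im : ℂ) * Φ z))) := by
    intro z
    have hz := Complex.re_add_im (z j)
    have ha' : (a j : ℂ) ≠ 0 := by exact_mod_cast (ha j).ne'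
    have hr' : (r : ℂ) ≠ 0 := by exact_mod_cast hr.ne'
    conv_lhs => rw [← hz]
    push_cast
    field_simp
  simp only [e]
  simp only [partialZbar]
  rw [integral_const_mul, integral_const_mul, integral_add h2 (h2'.const_mul _),
    integral_add (hx.const_mul _) ((hy.const_mul _).const_mul _)]
  simp only [integral_const_mul]
  rw [integral_dX ha hr hsum j hΦ h1 h2 hx, integral_dY ha hr hsum j hΦ h1 h2' hy]

theorem dX_eq_fderiv {φ : Ell2 → ℂ} (h : Differentiable ℝ φ) (j : ℕ) (z : Ell2) :
    dX j φ z = fderiv ℝ φ z (lp.single 2 j (1 : ℂ)) := (h z).lineDeriv_eq_fderiv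

theorem dY_eq_fderiv {φ : Ell2 → ℂ} (h : Differentiable ℝ φ) (j : ℕ) (z : Ell2) :
    dY j φ z = fderiv ℝ φ z (lp.single 2 j Complex.I) := (h z).lineDeriv_eq_fderiv

theorem dX_mul_conj {u φ : Ell2 → ℂ} (hu : Differentiable ℝ u) (hφ : Differentiable ℝ φ) (j : ℕ)
    (z : Ell2) : dX j (fun z => u z * conj (φ z)) z
      = dX j u z * conj (φ z) + u z * conj (dX j φ z) := by
  have h1 : HasFDerivAt (fun z => conj (φ z)) _ z :=
    (Complex.conjCLE.toContinuousLinearMap.hasFDerivAt).comp z (hφ z).hasFDerivAt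
  have h2 : HasFDerivAt (fun z => u z * conj (φ z)) _ z := (hu z).hasFDerivAt.mul h1
  rw [dX, (h2.hasLineDerivAt _).lineDeriv, dX_eq_fderiv hu, dX_eq_fderiv hφ]
  simp
  ring

theorem dY_mul_conj {u φ : Ell2 → ℂ} (hu : Differentiable ℝ u) (hφ : Differentiable ℝ φ) (j : ℕ)
    (z : Ell2) : dY j (fun z => u z * conj (φ z)) z
      = dY j u z * conj (φ z) + u z * conj (dY j φ z) := by
  have h1 : HasFDerivAt (fun z => conj (φ z)) _ z :=
    (Complex.conjCLE.toContinuousLinearMap.hasFDerivAt).comp z (hφ z).hasFDerivAt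
  have h2 : HasFDerivAt (fun z => u z * conj (φ z)) _ z := (hu z).hasFDerivAt.mul h1
  rw [dY, (h2.hasLineDerivAt _).lineDeriv, dY_eq_fderiv hu, dY_eq_fderiv hφ]
  simp
  ring

theorem integrable_mul_conj {α : Type*} [MeasurableSpace α] {μ : Measure α} {u v : α → ℂ}
    (hu : MemLp u 2 μ) (hv : MemLp v 2 μ) : Integrable (fun z => u z * conj (v z)) μ :=
  hu.integrable_mul hv.star

/-- On differentiable functions `-δ_j` is the adjoint of `∂̄_j` with respect to the Gaussian measure. -/
theorem integral_partialZbar_mul_conj {a : ℕ → ℝ} (ha : ∀ i, 0 < a i) {r : ℝ} (hr : 0 < r)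
    (hsum : Summable fun i => a i ^ 2) (j : ℕ) {u φ : Ell2 → ℂ} (hu : Differentiable ℝ u)
    (hφ : Differentiable ℝ φ)
    (h1 : MemLp u 2 (gaussP a r)) (h2 : MemLp (dX j u) 2 (gaussP a r))
    (h3 : MemLp (dY j u) 2 (gaussP a r)) (h4 : MemLp (fun z : Ell2 => z j * u z) 2 (gaussP a r))
    (k1 : MemLp φ 2 (gaussP a r)) (k2 : MemLp (dX j φ) 2 (gaussP a r))
    (k3 : MemLp (dY j φ) 2 (gaussP a r)) :
    ∫ z, partialZbar j u z * conj (φ z) ∂(gaussP a r)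
      = - ∫ z, u z * conj (deltaOp a r j φ z) ∂(gaussP a r) := by
  have ex : dX j (fun z => u z * conj (φ z)) = fun z => dX j u z * conj (φ z) + u z * conj (dX j φ z) :=
    funext fun z => dX_mul_conj hu hφ j z
  have ey : dY j (fun z => u z * conj (φ z)) = fun z => dY j u z * conj (φ z) + u z * conj (dY j φ z) :=
    funext fun z => dY_mul_conj hu hφ j z
  have hd : Differentiable ℝ (fun z => u z * conj (φ z)) :=
    hu.mul (Complex.conjCLE.toContinuousLinearMap.differentiable.comp hφ)
  have ix : Integrable (dX j (fun z => u z * conj (φ z))) (gaussP a r) := by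
    rw [ex]; exact (integrable_mul_conj h2 k1).add (integrable_mul_conj h1 k2)
  have iy : Integrable (dY j (fun z => u z * conj (φ z))) (gaussP a r) := by
    rw [ey]; exact (integrable_mul_conj h3 k1).add (integrable_mul_conj h1 k3)
  have i3 : Integrable (fun z : Ell2 => z j * (u z * conj (φ z))) (gaussP a r) := by
    simp only [← mul_assoc]; exact integrable_mul_conj h4 k1
  have key := integral_partialZbar ha hr hsum j hd (integrable_mul_conj h1 k1) ix iy i3
  have e1 : ∀ z, partialZbar j (fun z => u z * conj (φ z)) z
      = partialZbar j u z * conj (φ z) + u z * conj (partialZ j φ z) := by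
    intro z
    simp only [partialZbar, partialZ, ex, ey]
    simp [Complex.conj_ofNat]
    ring
  have kZ : MemLp (partialZ j φ) 2 (gaussP a r) := (k2.sub (k3.const_mul _)).const_mul _
  have hZ : MemLp (partialZbar j u) 2 (gaussP a r) := (h2.add (h3.const_mul _)).const_mul _
  simp only [e1] at key
  rw [integral_add (integrable_mul_conj hZ k1) (integrable_mul_conj h1 kZ)] at key
  rw [eq_sub_of_add_eq key, ← integral_neg]
  have i3' : Integrable (fun z : Ell2 => z j / (2 * (r : ℂ) ^ 2 * (a j : ℂ) ^ 2) * (u z * conj (φ z)))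
      (gaussP a r) := by
    refine (i3.const_mul ((2 * (r : ℂ) ^ 2 * (a j : ℂ) ^ 2)⁻¹)).congr
      (Filter.Eventually.of_forall fun z => ?_)
    simp only; ring
  rw [← integral_sub i3' (integrable_mul_conj h1 kZ)]
  refine integral_congr_ae (Filter.Eventually.of_forall fun z => ?_)
  simp [deltaOp, Complex.conj_ofNat]
  ring

/-! ### Polynomials in the coordinates and Hermite polynomials -/

/-- The modes: `inl j` stands for the variable `z̄_j` and `inr j` for the variable `z_j`. -/
abbrev Mode : Type := ℕ ⊕ ℕ

/-- The value of the variable attached to a mode at the point `z`. -/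
def modeVal (z : Ell2) : Mode → ℂ := Sum.elim (fun j => conj (z j)) (fun j => z j)

/-- The function on `ℓ²` defined by a polynomial in the `z̄_j` and `z_j`. -/
def evalAt (p : MvPolynomial Mode ℂ) (z : Ell2) : ℂ := MvPolynomial.eval (modeVal z) p

@[simp] theorem evalAt_C (c : ℂ) (z : Ell2) : evalAt (MvPolynomial.C c) z = c := by simp [evalAt]
@[simp] theorem evalAt_one (z : Ell2) : evalAt 1 z = 1 := by simp [evalAt]
@[simp] theorem evalAt_zero (z : Ell2) : evalAt 0 z = 0 := by simp [evalAt]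
@[simp] theorem evalAt_X (i : Mode) (z : Ell2) : evalAt (MvPolynomial.X i) z = modeVal z i := by
  simp [evalAt]
@[simp] theorem evalAt_add (p q : MvPolynomial Mode ℂ) (z : Ell2) :
    evalAt (p + q) z = evalAt p z + evalAt q z := by simp [evalAt]
@[simp] theorem evalAt_sub (p q : MvPolynomial Mode ℂ) (z : Ell2) :
    evalAt (p - q) z = evalAt p z - evalAt q z := by simp [evalAt]
@[simp] theorem evalAt_mul (p q : MvPolynomial Mode ℂ) (z : Ell2) :
    evalAt (p * q) z = evalAt p z * evalAt q z := by simp [evalAt]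
@[simp] theorem evalAt_smul (c : ℂ) (p : MvPolynomial Mode ℂ) (z : Ell2) :
    evalAt (c • p) z = c * evalAt p z := by simp [evalAt]
@[simp] theorem evalAt_sum {α : Type*} (s : Finset α) (p : α → MvPolynomial Mode ℂ) (z : Ell2) :
    evalAt (∑ i ∈ s, p i) z = ∑ i ∈ s, evalAt (p i) z := by simp [evalAt]
@[simp] theorem evalAt_pow (p : MvPolynomial Mode ℂ) (n : ℕ) (z : Ell2) :
    evalAt (p ^ n) z = evalAt p z ^ n := by simp [evalAt]

/-- A polynomial is a smooth function of the first `k + 1` coordinates, for all large `k`. -/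
theorem exists_cylinder_evalAt (p : MvPolynomial Mode ℂ) :
    ∃ n, ∀ k, n ≤ k → ∃ F : (Fin (k + 1) → ℂ) → ℂ, ContDiff ℝ ∞ F ∧
      ∀ z : Ell2, evalAt p z = F (Ell2.proj k z) := by
  induction p using MvPolynomial.induction_on with
  | C c => exact ⟨0, fun k _ => ⟨fun _ => c, contDiff_const, fun z => by simp⟩⟩
  | add p q hp hq =>
    obtain ⟨n, hn⟩ := hp
    obtain ⟨m, hm⟩ := hq
    refine ⟨max n m, fun k hk => ?_⟩
    obtain ⟨F, hF, h1⟩ := hn k ((le_max_left _ _).trans hk)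
    obtain ⟨G, hG, h2⟩ := hm k ((le_max_right _ _).trans hk)
    exact ⟨fun x => F x + G x, hF.add hG, fun z => by simp [h1, h2]⟩
  | mul_X p i hp =>
    obtain ⟨n, hn⟩ := hp
    have hX : ∃ m, ∀ k, m ≤ k → ∃ F : (Fin (k + 1) → ℂ) → ℂ, ContDiff ℝ ∞ F ∧
        ∀ z : Ell2, modeVal z i = F (Ell2.proj k z) := by
      rcases i with j | j
      · exact ⟨j, fun k hk => ⟨fun x => conj (x ⟨j, by omega⟩),
          Complex.conjCLE.contDiff.comp (contDiff_apply ℝ ℂ _), fun z => rfl⟩⟩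
      · exact ⟨j, fun k hk => ⟨fun x => x ⟨j, by omega⟩, contDiff_apply ℝ ℂ _, fun z => rfl⟩⟩
    obtain ⟨m, hm⟩ := hX
    refine ⟨max n m, fun k hk => ?_⟩
    obtain ⟨F, hF, h1⟩ := hn k ((le_max_left _ _).trans hk)
    obtain ⟨G, hG, h2⟩ := hm k ((le_max_right _ _).trans hk)
    exact ⟨fun x => F x * G x, hF.mul hG, fun z => by simp [h1, h2]⟩

theorem contDiff_evalAt (p : MvPolynomial Mode ℂ) : ContDiff ℝ ∞ (evalAt p) := by
  obtain ⟨n, h⟩ := exists_cylinder_evalAt p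
  obtain ⟨F, hF, h1⟩ := h n le_rfl
  rw [funext h1]
  exact hF.comp (Ell2.proj n).contDiff

theorem differentiable_evalAt (p : MvPolynomial Mode ℂ) : Differentiable ℝ (evalAt p) :=
  (contDiff_evalAt p).differentiable (by simp)

theorem hasDerivAt_modeVal (z : Ell2) (j : ℕ) (c : ℂ) (i : Mode) :
    HasDerivAt (fun t : ℝ => modeVal (z + t • (lp.single 2 j c : Ell2)) i)
      (if i = Sum.inr j then c else if i = Sum.inl j then conj c else 0) 0 := by
  have hz : ∀ (t : ℝ) (k : ℕ), (z + t • (lp.single 2 j c : Ell2)) k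
      = z k + t • (if k = j then c else 0) := by
    intro t k
    change z k + t • (lp.single 2 j c : Ell2) k = _
    by_cases h : k = j
    · subst h; simp
    · simp [h]
  have h0 : ∀ k, HasDerivAt (fun t : ℝ => (z + t • (lp.single 2 j c : Ell2)) k)
      (if k = j then c else 0) 0 := by
    intro k
    simp only [hz]
    simpa using ((hasDerivAt_id (0 : ℝ)).smul_const (if k = j then c else 0)).const_add (z k)
  rcases i with k | k
  · have := (Complex.conjCLE.toContinuousLinearMap.hasFDerivAt).comp_hasDerivAt (0 : ℝ) (h0 k)
    refine this.congr_deriv ?_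
    by_cases h : k = j
    · subst h; simp
    · simp [h]
  · refine (h0 k).congr_deriv ?_
    by_cases h : k = j
    · subst h; simp
    · simp [h]

theorem hasDerivAt_evalAt (z : Ell2) (j : ℕ) (c : ℂ) (p : MvPolynomial Mode ℂ) :
    HasDerivAt (fun t : ℝ => evalAt p (z + t • (lp.single 2 j c : Ell2)))
      (c * evalAt (MvPolynomial.pderiv (Sum.inr j) p) z
        + conj c * evalAt (MvPolynomial.pderiv (Sum.inl j) p) z) 0 := by
  induction p using MvPolynomial.induction_on with
  | C b => simpa using hasDerivAt_const (0 : ℝ) b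
  | add p q hp hq =>
    simp only [evalAt_add, map_add]
    refine (hp.add hq).congr_deriv ?_
    ring
  | mul_X p i hp =>
    simp only [evalAt_mul, evalAt_X]
    refine (hp.mul (hasDerivAt_modeVal z j c i)).congr_deriv ?_
    simp only [zero_smul, add_zero, Derivation.leibniz, evalAt_add, smul_eq_mul, evalAt_mul, evalAt_X]
    rw [MvPolynomial.pderiv_X, MvPolynomial.pderiv_X]
    by_cases h1 : i = Sum.inr j
    · subst h1; simp; ring
    · by_cases h2 : i = Sum.inl j
      · subst h2; simp; ring
      · simp [h1, h2]; ring

theorem dX_evalAt (p : MvPolynomial Mode ℂ) (j : ℕ) : dX j (evalAt p)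
    = evalAt (MvPolynomial.pderiv (Sum.inr j) p + MvPolynomial.pderiv (Sum.inl j) p) := by
  funext z
  rw [dX, lineDeriv, (hasDerivAt_evalAt z j 1 p).deriv]
  simp

theorem dY_evalAt (p : MvPolynomial Mode ℂ) (j : ℕ) : dY j (evalAt p)
    = evalAt (Complex.I • (MvPolynomial.pderiv (Sum.inr j) p - MvPolynomial.pderiv (Sum.inl j) p)) := by
  funext z
  rw [dY, lineDeriv, (hasDerivAt_evalAt z j Complex.I p).deriv]
  simp
  ring

theorem partialZ_evalAt (p : MvPolynomial Mode ℂ) (j : ℕ) :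
    partialZ j (evalAt p) = evalAt (MvPolynomial.pderiv (Sum.inr j) p) := by
  funext z
  rw [partialZ, dX_evalAt, dY_evalAt]
  simp only [evalAt_add, evalAt_smul, evalAt_sub]
  linear_combination (-(1 / 2) * (evalAt (MvPolynomial.pderiv (Sum.inr j) p) z
    - evalAt (MvPolynomial.pderiv (Sum.inl j) p) z)) * Complex.I_mul_I

theorem partialZbar_evalAt (p : MvPolynomial Mode ℂ) (j : ℕ) :
    partialZbar j (evalAt p) = evalAt (MvPolynomial.pderiv (Sum.inl j) p) := by
  funext z
  rw [partialZbar, dX_evalAt, dY_evalAt]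
  simp only [evalAt_add, evalAt_smul, evalAt_sub]
  linear_combination ((1 / 2) * (evalAt (MvPolynomial.pderiv (Sum.inr j) p) z
    - evalAt (MvPolynomial.pderiv (Sum.inl j) p) z)) * Complex.I_mul_I

/-- The constant `1 / (2 r² a_j²)` of the commutation relation `[∂̄_j, -δ_j] = 1 / (2 r² a_j²)`. -/
def modeConst (a : ℕ → ℝ) (r : ℝ) (i : Mode) : ℝ := 1 / (2 * r ^ 2 * a (Sum.elim id id i) ^ 2)

theorem modeConst_pos {a : ℕ → ℝ} (ha : ∀ i, 0 < a i) {r : ℝ} (hr : 0 < r) (i : Mode) :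
    0 < modeConst a r i := by
  have := ha (Sum.elim id id i)
  unfold modeConst; positivity

theorem modeConst_swap (a : ℕ → ℝ) (r : ℝ) (i : Mode) : modeConst a r i.swap = modeConst a r i := by
  rcases i with j | j <;> rfl

/-- The creation operator of a mode, the adjoint of `∂/∂X_i`; for `i = inl j` it is `-δ_j`. -/
def raise (a : ℕ → ℝ) (r : ℝ) (i : Mode) (p : MvPolynomial Mode ℂ) : MvPolynomial Mode ℂ :=
  (modeConst a r i : ℂ) • (MvPolynomial.X i * p) - MvPolynomial.pderiv i.swap p

theorem pderiv_pderiv_comm {σ R : Type*} [CommRing R] (i k : σ) (p : MvPolynomial σ R) :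
    MvPolynomial.pderiv i (MvPolynomial.pderiv k p) = MvPolynomial.pderiv k (MvPolynomial.pderiv i p) := by
  classical
  have h : ⁅(MvPolynomial.pderiv i : Derivation R (MvPolynomial σ R) (MvPolynomial σ R)),
      (MvPolynomial.pderiv k : Derivation R (MvPolynomial σ R) (MvPolynomial σ R))⁆ = 0 := by
    refine MvPolynomial.derivation_ext fun l => ?_
    rw [Derivation.commutator_apply, MvPolynomial.pderiv_X, MvPolynomial.pderiv_X]
    simp [Pi.single_apply, apply_ite]
  have h2 := DFunLike.congr_fun h p
  rw [Derivation.commutator_apply] at h2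
  exact sub_eq_zero.1 h2

/-- The canonical commutation relations. -/
theorem pderiv_raise (a : ℕ → ℝ) (r : ℝ) (i k : Mode) (p : MvPolynomial Mode ℂ) :
    MvPolynomial.pderiv i (raise a r k p) = raise a r k (MvPolynomial.pderiv i p)
      + if i = k then (modeConst a r k : ℂ) • p else 0 := by
  unfold raise
  rw [map_sub, Derivation.map_smul, Derivation.leibniz, pderiv_pderiv_comm i k.swap, MvPolynomial.pderiv_X]
  by_cases h : i = k
  · subst h; simp; ring
  · have : k ≠ i := fun e => h e.symm
    simp [h]

theorem raise_comm (a : ℕ → ℝ) (r : ℝ) (i k : Mode) (p : MvPolynomial Mode ℂ) :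
    raise a r i (raise a r k p) = raise a r k (raise a r i p) := by
  have e : ∀ i k : Mode, raise a r i (raise a r k p)
      = ((modeConst a r i : ℂ) * (modeConst a r k : ℂ)) • (MvPolynomial.X i * MvPolynomial.X k * p)
        - (modeConst a r i : ℂ) • (MvPolynomial.X i * MvPolynomial.pderiv k.swap p)
        - (modeConst a r k : ℂ) • (MvPolynomial.X k * MvPolynomial.pderiv i.swap p)
        + MvPolynomial.pderiv i.swap (MvPolynomial.pderiv k.swap p)
        - if i.swap = k then (modeConst a r k : ℂ) • p else 0 := by
    intro i k
    conv_lhs => rw [raise, pderiv_raise]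
    unfold raise
    simp only [MvPolynomial.smul_eq_C_mul, map_mul]
    rw [pderiv_pderiv_comm k.swap i.swap]
    ring
  rw [e, e k i, pderiv_pderiv_comm i.swap k.swap]
  have h : (if i.swap = k then (modeConst a r k : ℂ) • p else 0)
      = if k.swap = i then (modeConst a r i : ℂ) • p else 0 := by
    by_cases h : i.swap = k
    · subst h; simp [modeConst_swap]
    · have : k.swap ≠ i := fun h' => h (by rw [← h', Sum.swap_swap])
      simp [h, this]
  rw [h, mul_comm (modeConst a r i : ℂ), mul_comm (MvPolynomial.X i) (MvPolynomial.X k)]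
  ring

instance (a : ℕ → ℝ) (r : ℝ) : LeftCommutative (raise a r) := ⟨raise_comm a r⟩

/-- The complex Hermite polynomials: `herm m` arises from `1` by applying the creation operators of
the modes in `m`. -/
def herm (a : ℕ → ℝ) (r : ℝ) (m : Multiset Mode) : MvPolynomial Mode ℂ :=
  m.foldr (raise a r) 1

@[simp] theorem herm_zero (a : ℕ → ℝ) (r : ℝ) : herm a r 0 = 1 := by simp [herm]

theorem herm_cons (a : ℕ → ℝ) (r : ℝ) (i : Mode) (m : Multiset Mode) :
    herm a r (i ::ₘ m) = raise a r i (herm a r m) := by simp [herm]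

theorem raise_smul (a : ℕ → ℝ) (r : ℝ) (i : Mode) (c : ℂ) (p : MvPolynomial Mode ℂ) :
    raise a r i (c • p) = c • raise a r i p := by
  unfold raise
  rw [Derivation.map_smul, smul_sub, mul_smul_comm, smul_comm]

/-- Differentiation is the annihilation operator of the Hermite polynomials. -/
theorem pderiv_herm (a : ℕ → ℝ) (r : ℝ) (i : Mode) (m : Multiset Mode) :
    MvPolynomial.pderiv i (herm a r m) = ((m.count i : ℂ) * modeConst a r i) • herm a r (m.erase i) := by
  induction m using Multiset.induction_on with
  | empty => simp
  | cons k m ih =>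
    rw [herm_cons, pderiv_raise, ih, raise_smul, ← herm_cons]
    by_cases h : i = k
    · subst h
      rw [if_pos rfl, Multiset.count_cons_self, Multiset.erase_cons_head]
      by_cases hi : i ∈ m
      · rw [Multiset.cons_erase hi, ← add_smul]
        congr 1
        push_cast; ring
      · rw [Multiset.count_eq_zero_of_notMem hi]; simp
    · rw [if_neg h, Multiset.count_cons_of_ne h, Multiset.erase_cons_tail _ (Ne.symm h)]
      simp

theorem deltaOp_evalAt (a : ℕ → ℝ) (r : ℝ) (j : ℕ) (p : MvPolynomial Mode ℂ) (z : Ell2) :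
    deltaOp a r j (evalAt p) z = - evalAt (raise a r (Sum.inl j) p) z := by
  rw [deltaOp, partialZ_evalAt, raise]
  simp [modeConst, modeVal]
  ring

/-! ### Orthogonality of the Hermite polynomials -/

theorem gaussP_map_re (a : ℕ → ℝ) (r : ℝ) (hsum : Summable fun i => a i ^ 2) (j : ℕ) :
    MeasurePreserving (fun z : Ell2 => (z j).re) (gaussP a r)
      (gaussianReal 0 (Real.toNNReal ((r * a j) ^ 2))) := by
  have h1 : MeasurePreserving Ell2.coords (gaussP a r) (gaussProduct a r) :=
    ⟨Ell2.coords_measurableEmbedding.measurable, gaussP_map_coords a r hsum⟩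
  have h2 : MeasurePreserving (Function.eval j) (gaussProduct a r) (gaussPair a r j) :=
    measurePreserving_eval_infinitePi (fun i => gaussPair a r i) j
  exact (measurePreserving_fst.comp h2).comp h1

theorem gaussP_map_im (a : ℕ → ℝ) (r : ℝ) (hsum : Summable fun i => a i ^ 2) (j : ℕ) :
    MeasurePreserving (fun z : Ell2 => (z j).im) (gaussP a r)
      (gaussianReal 0 (Real.toNNReal ((r * a j) ^ 2))) := by
  have h1 : MeasurePreserving Ell2.coords (gaussP a r) (gaussProduct a r) :=
    ⟨Ell2.coords_measurableEmbedding.measurable, gaussP_map_coords a r hsum⟩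
  have h2 : MeasurePreserving (Function.eval j) (gaussProduct a r) (gaussPair a r j) :=
    measurePreserving_eval_infinitePi (fun i => gaussPair a r i) j
  exact (measurePreserving_snd.comp h2).comp h1

/-- Being in `L^q` for every finite `q`; unlike a single `L^q`, this is stable under products. -/
def AllLp {α 𝕂 : Type*} [MeasurableSpace α] [NormedAddCommGroup 𝕂] (μ : Measure α) (u : α → 𝕂) : Prop :=
  ∀ q : ENNReal, q ≠ ⊤ → MemLp u q μ

theorem AllLp.mul {α 𝕂 : Type*} [MeasurableSpace α] [NormedRing 𝕂] {μ : Measure α}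
    {u v : α → 𝕂} (hu : AllLp μ u) (hv : AllLp μ v) : AllLp μ fun z => u z * v z := by
  intro q hq
  have h2 : 2 * q ≠ ⊤ := ENNReal.mul_ne_top (by norm_num) hq
  have : ENNReal.HolderTriple (2 * q) (2 * q) q := ⟨by
    rw [ENNReal.mul_inv (by simp) (by simp), ← add_mul, ENNReal.inv_two_add_inv_two, one_mul]⟩
  exact (hv _ h2).mul' (hu _ h2)

theorem AllLp.add {α 𝕂 : Type*} [MeasurableSpace α] [NormedAddCommGroup 𝕂] {μ : Measure α}
    {u v : α → 𝕂} (hu : AllLp μ u) (hv : AllLp μ v) : AllLp μ fun z => u z + v z :=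
  fun q hq => (hu q hq).add (hv q hq)

theorem allLp_coord (a : ℕ → ℝ) (r : ℝ) (hsum : Summable fun i => a i ^ 2) (j : ℕ) :
    AllLp (gaussP a r) fun z : Ell2 => z j := by
  intro q hq
  have h1 : MemLp (fun z : Ell2 => (z j).re) q (gaussP a r) :=
    (memLp_id_gaussianReal' q hq).comp_measurePreserving (gaussP_map_re a r hsum j)
  have h2 : MemLp (fun z : Ell2 => (z j).im) q (gaussP a r) :=
    (memLp_id_gaussianReal' q hq).comp_measurePreserving (gaussP_map_im a r hsum j)
  exact memLp_re_im_iff.1 ⟨h1, h2⟩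

theorem allLp_modeVal (a : ℕ → ℝ) (r : ℝ) (hsum : Summable fun i => a i ^ 2) (i : Mode) :
    AllLp (gaussP a r) fun z : Ell2 => modeVal z i := by
  rcases i with j | j
  · exact fun q hq => (allLp_coord a r hsum j q hq).star
  · exact allLp_coord a r hsum j

theorem allLp_evalAt (a : ℕ → ℝ) (r : ℝ) (hsum : Summable fun i => a i ^ 2)
    (p : MvPolynomial Mode ℂ) : AllLp (gaussP a r) (evalAt p) := by
  induction p using MvPolynomial.induction_on with
  | C c =>
    intro q _
    exact (memLp_const c).ae_eq (Filter.Eventually.of_forall fun z => (evalAt_C c z).symm)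
  | add p q hp hq =>
    intro s hs
    exact (hp.add hq s hs).ae_eq (Filter.Eventually.of_forall fun z => (evalAt_add p q z).symm)
  | mul_X p i hp =>
    intro s hs
    refine (hp.mul (allLp_modeVal a r hsum i) s hs).ae_eq (Filter.Eventually.of_forall fun z => ?_)
    simp

theorem memLp_evalAt (a : ℕ → ℝ) (r : ℝ) (hsum : Summable fun i => a i ^ 2)
    (p : MvPolynomial Mode ℂ) : MemLp (evalAt p) 2 (gaussP a r) :=
  allLp_evalAt a r hsum p 2 (by norm_num)

/-- Integration by parts of a polynomial against a function with derivatives in `L²`. -/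
theorem integral_pderiv_mul_conj_deltaOp {a : ℕ → ℝ} (ha : ∀ i, 0 < a i) {r : ℝ} (hr : 0 < r)
    (hsum : Summable fun i => a i ^ 2) (j : ℕ) (p : MvPolynomial Mode ℂ) {φ : Ell2 → ℂ}
    (hφ : Differentiable ℝ φ) (k1 : MemLp φ 2 (gaussP a r)) (k2 : MemLp (dX j φ) 2 (gaussP a r))
    (k3 : MemLp (dY j φ) 2 (gaussP a r)) :
    ∫ z, evalAt (MvPolynomial.pderiv (Sum.inl j) p) z * conj (φ z) ∂(gaussP a r)
      = - ∫ z, evalAt p z * conj (deltaOp a r j φ z) ∂(gaussP a r) := by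
  rw [← partialZbar_evalAt]
  refine integral_partialZbar_mul_conj ha hr hsum j (differentiable_evalAt p) hφ
    (memLp_evalAt a r hsum p) ?_ ?_ ?_ k1 k2 k3
  · rw [dX_evalAt]; exact memLp_evalAt a r hsum _
  · rw [dY_evalAt]; exact memLp_evalAt a r hsum _
  · refine (memLp_evalAt a r hsum (MvPolynomial.X (Sum.inr j) * p)).ae_eq
      (Filter.Eventually.of_forall fun z => ?_)
    simp [modeVal]

/-- The polynomial with complex conjugate values: conjugate the coefficients and swap `z_j`, `z̄_j`. -/
theorem exists_conj_poly (p : MvPolynomial Mode ℂ) :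
    ∃ q : MvPolynomial Mode ℂ, (∀ z, evalAt q z = conj (evalAt p z)) ∧
      ∀ (i : Mode) (z : Ell2), evalAt (MvPolynomial.pderiv i.swap q) z
        = conj (evalAt (MvPolynomial.pderiv i p) z) := by
  have hv : ∀ (i : Mode) (z : Ell2), modeVal z i.swap = conj (modeVal z i) := by
    rintro (j | j) z <;> simp [modeVal]
  induction p using MvPolynomial.induction_on with
  | C c => exact ⟨MvPolynomial.C (conj c), by simp, by simp⟩
  | add p q hp hq =>
    obtain ⟨p', h1, h2⟩ := hp
    obtain ⟨q', h3, h4⟩ := hq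
    exact ⟨p' + q', fun z => by rw [evalAt_add, evalAt_add, h1, h3, map_add],
      fun i z => by rw [map_add, map_add, evalAt_add, evalAt_add, h2, h4, map_add]⟩
  | mul_X p k hp =>
    obtain ⟨p', h1, h2⟩ := hp
    refine ⟨p' * MvPolynomial.X k.swap, by simp [h1, hv], fun i z => ?_⟩
    have hX : evalAt (MvPolynomial.pderiv i.swap (MvPolynomial.X k.swap)) z
        = conj (evalAt (MvPolynomial.pderiv i (MvPolynomial.X k)) z) := by
      rw [MvPolynomial.pderiv_X, MvPolynomial.pderiv_X]
      by_cases h : k = i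
      · subst h; simp
      · have : k.swap ≠ i.swap := fun e => h (by rw [← Sum.swap_swap k, e, Sum.swap_swap])
        simp [h, this]
    simp only [Derivation.leibniz, evalAt_add, smul_eq_mul, evalAt_mul, evalAt_X, h1, h2, hv, hX,
      map_add, map_mul]

/-- On polynomials `raise` is the adjoint of the derivative. For the variables `z_j` this follows from the
case of the `z̄_j` by complex conjugation. -/
theorem integral_pderiv_mul_conj {a : ℕ → ℝ} (ha : ∀ i, 0 < a i) {r : ℝ} (hr : 0 < r)
    (hsum : Summable fun i => a i ^ 2) (i : Mode) (p q : MvPolynomial Mode ℂ) :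
    ∫ z, evalAt (MvPolynomial.pderiv i p) z * conj (evalAt q z) ∂(gaussP a r)
      = ∫ z, evalAt p z * conj (evalAt (raise a r i q) z) ∂(gaussP a r) := by
  have key : ∀ (j : ℕ) (p q : MvPolynomial Mode ℂ),
      ∫ z, evalAt (MvPolynomial.pderiv (Sum.inl j) p) z * conj (evalAt q z) ∂(gaussP a r)
      = ∫ z, evalAt p z * conj (evalAt (raise a r (Sum.inl j) q) z) ∂(gaussP a r) := by
    intro j p q
    rw [integral_pderiv_mul_conj_deltaOp ha hr hsum j p (differentiable_evalAt q)
      (memLp_evalAt a r hsum q) (by rw [dX_evalAt]; exact memLp_evalAt a r hsum _)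
      (by rw [dY_evalAt]; exact memLp_evalAt a r hsum _), ← integral_neg]
    simp [deltaOp_evalAt]
  rcases i with j | j
  · exact key j p q
  · obtain ⟨p', h1, h2⟩ := exists_conj_poly p
    obtain ⟨q', h3, h4⟩ := exists_conj_poly q
    have h5 := congrArg conj (key j p' q')
    rw [← integral_conj, ← integral_conj] at h5
    refine Eq.trans (integral_congr_ae (Filter.Eventually.of_forall fun z => ?_))
      (h5.trans (integral_congr_ae (Filter.Eventually.of_forall fun z => ?_)))
    · have := h2 (Sum.inr j) z
      simp only [Sum.swap_inr] at this
      simp [this, h3]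
    · have := h4 (Sum.inl j) z
      simp only [Sum.swap_inl] at this
      simp [raise, this, h3, h1, modeVal, modeConst, Complex.conj_ofNat]

/-- The square of the `L²` norm of a Hermite polynomial. -/
def hermNorm (a : ℕ → ℝ) (r : ℝ) (m : Multiset Mode) : ℝ :=
  (∫ z, evalAt (herm a r m) z * conj (evalAt (herm a r m) z) ∂(gaussP a r)).re

theorem integral_conj_swap {α : Type*} [MeasurableSpace α] (μ : Measure α) (u v : α → ℂ) :
    ∫ z, u z * conj (v z) ∂μ = conj (∫ z, v z * conj (u z) ∂μ) := by
  rw [← integral_conj]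
  simp [mul_comm]

theorem integral_herm_cons {a : ℕ → ℝ} (ha : ∀ i, 0 < a i) {r : ℝ} (hr : 0 < r)
    (hsum : Summable fun i => a i ^ 2) (i : Mode) (m m' : Multiset Mode) :
    ∫ z, evalAt (herm a r m') z * conj (evalAt (herm a r (i ::ₘ m)) z) ∂(gaussP a r)
      = (m'.count i * modeConst a r i)
        * ∫ z, evalAt (herm a r (m'.erase i)) z * conj (evalAt (herm a r m) z) ∂(gaussP a r) := by
  rw [herm_cons, ← integral_pderiv_mul_conj ha hr hsum, pderiv_herm]
  simp only [evalAt_smul, mul_assoc]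
  rw [integral_const_mul, integral_const_mul]

theorem integral_herm_herm {a : ℕ → ℝ} (ha : ∀ i, 0 < a i) {r : ℝ} (hr : 0 < r)
    (hsum : Summable fun i => a i ^ 2) (m m' : Multiset Mode) (h : m' ≠ m) :
    ∫ z, evalAt (herm a r m') z * conj (evalAt (herm a r m) z) ∂(gaussP a r) = 0 := by
  induction m using Multiset.induction_on generalizing m' with
  | empty =>
    obtain ⟨i, hi⟩ := Multiset.exists_mem_of_ne_zero h
    rw [← Multiset.cons_erase hi, integral_conj_swap, integral_herm_cons ha hr hsum]
    simp
  | cons i m ih =>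
    rw [integral_herm_cons ha hr hsum]
    by_cases hi : i ∈ m'
    · rw [ih, mul_zero]
      intro e
      exact h (by rw [← e, Multiset.cons_erase hi])
    · simp [Multiset.count_eq_zero_of_notMem hi]

theorem hermNorm_cons {a : ℕ → ℝ} (ha : ∀ i, 0 < a i) {r : ℝ} (hr : 0 < r)
    (hsum : Summable fun i => a i ^ 2) (i : Mode) (m : Multiset Mode) :
    hermNorm a r (i ::ₘ m) = (m.count i + 1) * modeConst a r i * hermNorm a r m := by
  unfold hermNorm
  rw [integral_herm_cons ha hr hsum, Multiset.erase_cons_head, Multiset.count_cons_self]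
  have : (((m.count i + 1 : ℕ) : ℂ) * (modeConst a r i : ℂ))
      = (((m.count i + 1) * modeConst a r i : ℝ) : ℂ) := by push_cast; rfl
  rw [this, Complex.re_ofReal_mul]

theorem hermNorm_pos {a : ℕ → ℝ} (ha : ∀ i, 0 < a i) {r : ℝ} (hr : 0 < r)
    (hsum : Summable fun i => a i ^ 2) (m : Multiset Mode) : 0 < hermNorm a r m := by
  induction m using Multiset.induction_on with
  | empty =>
    have := gaussP_prob a r hsum
    simp [hermNorm]
  | cons i m ih =>
    rw [hermNorm_cons ha hr hsum]
    have := modeConst_pos ha hr i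
    positivity

theorem integral_herm_self (a : ℕ → ℝ) (r : ℝ) (m : Multiset Mode) :
    ∫ z, evalAt (herm a r m) z * conj (evalAt (herm a r m) z) ∂(gaussP a r) = hermNorm a r m := by
  refine Complex.ext (by simp [hermNorm]) ?_
  have := congrArg Complex.im (integral_conj_swap (gaussP a r) (evalAt (herm a r m)) (evalAt (herm a r m)))
  rw [Complex.conj_im] at this
  rw [Complex.ofReal_im]
  linarith

/-- The Hermite polynomials span all polynomials. -/
theorem mem_span_herm {a : ℕ → ℝ} (ha : ∀ i, 0 < a i) {r : ℝ} (hr : 0 < r)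
    (p : MvPolynomial Mode ℂ) : p ∈ Submodule.span ℂ (Set.range (herm a r)) := by
  induction p using MvPolynomial.induction_on with
  | C c =>
    have : (MvPolynomial.C c : MvPolynomial Mode ℂ) = c • herm a r 0 := by
      rw [herm_zero, MvPolynomial.smul_eq_C_mul, mul_one]
    rw [this]
    exact Submodule.smul_mem _ _ (Submodule.subset_span ⟨0, rfl⟩)
  | add p q hp hq => exact Submodule.add_mem _ hp hq
  | mul_X p i hp =>
    induction hp using Submodule.span_induction with
    | mem p h =>
      obtain ⟨m, rfl⟩ := h
      have hc : (modeConst a r i : ℂ) ≠ 0 := by exact_mod_cast (modeConst_pos ha hr i).ne'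
      have e : herm a r m * MvPolynomial.X i = (modeConst a r i : ℂ)⁻¹ • (herm a r (i ::ₘ m)
          + ((m.count i.swap : ℂ) * modeConst a r i.swap) • herm a r (m.erase i.swap)) := by
        rw [herm_cons, ← pderiv_herm, raise, sub_add_cancel, smul_smul, inv_mul_cancel₀ hc, one_smul,
          mul_comm]
      rw [e]
      exact Submodule.smul_mem _ _ (Submodule.add_mem _ (Submodule.subset_span ⟨_, rfl⟩)
        (Submodule.smul_mem _ _ (Submodule.subset_span ⟨_, rfl⟩)))
    | zero => simp
    | add p q _ _ hp hq => rw [add_mul]; exact Submodule.add_mem _ hp hq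
    | smul c p _ hp => rw [smul_mul_assoc]; exact Submodule.smul_mem _ _ hp

/-! ### Completeness of the polynomials in `L²(P_r)` -/

theorem allLp_exp_gaussianReal (v : NNReal) (c : ℝ) :
    AllLp (gaussianReal 0 v) fun x => Real.exp (c * x) := by
  intro q hq
  have hm : AEStronglyMeasurable (fun x => Real.exp (c * x)) (gaussianReal 0 v) := by fun_prop
  by_cases h0 : q = 0
  · subst h0; exact memLp_zero_iff_aestronglyMeasurable.2 hm
  rw [← integrable_norm_rpow_iff hm h0 hq]
  refine (integrable_exp_mul_gaussianReal (μ := 0) (v := v) (c * q.toReal)).congr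
    (Filter.Eventually.of_forall fun x => ?_)
  simp only [Real.norm_eq_abs, Real.abs_exp]
  rw [← Real.exp_mul]
  ring_nf

theorem AllLp.comp {α β : Type*} [MeasurableSpace α] [MeasurableSpace β] {μ : Measure α}
    {ν : Measure β} {u : β → ℝ} {g : α → β} (hu : AllLp ν u) (hg : MeasurePreserving g μ ν) :
    AllLp μ fun z => u (g z) := fun q hq => (hu q hq).comp_measurePreserving hg

theorem allLp_exp_abs_gaussianReal (v : NNReal) (c : ℝ) :
    AllLp (gaussianReal 0 v) fun x => Real.exp (c * |x|) := by
  intro q hq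
  refine ((allLp_exp_gaussianReal v c).add (allLp_exp_gaussianReal v (-c)) q hq).mono
    (by fun_prop) (Filter.Eventually.of_forall fun x => ?_)
  have h1 := Real.exp_pos (c * x)
  have h2 := Real.exp_pos (-c * x)
  rw [Real.norm_of_nonneg (Real.exp_pos _).le, Real.norm_of_nonneg (by positivity)]
  rcases abs_cases x with ⟨h, _⟩ | ⟨h, _⟩
  · rw [h]; linarith
  · rw [h, mul_neg, ← neg_mul]; linarith

theorem AllLp.prod {α κ : Type*} [MeasurableSpace α] {μ : Measure α} [IsFiniteMeasure μ]
    {u : κ → α → ℝ} (hu : ∀ i, AllLp μ (u i)) (s : Finset κ) : AllLp μ fun z => ∏ i ∈ s, u i z := by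
  classical
  induction s using Finset.induction_on with
  | empty => exact fun q _ => by simpa using memLp_const (1 : ℝ)
  | insert i s hi ih =>
    simp only [Finset.prod_insert hi]
    exact (hu i).mul ih

/-- Exponentials of continuous linear functions of finitely many coordinates are in every `L^q`. -/
theorem allLp_exp_dual (a : ℕ → ℝ) (r : ℝ) (hsum : Summable fun i => a i ^ 2) {n : ℕ}
    (L : StrongDual ℝ (Fin (n + 1) → ℂ)) :
    AllLp (gaussP a r) fun z => Real.exp |L (Ell2.proj n z)| := by
  have h1 : AllLp (gaussP a r) fun z : Ell2 => ∏ i ∈ (Finset.univ : Finset (Fin (n + 1))),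
      (Real.exp (‖L‖ * |(z i).re|) * Real.exp (‖L‖ * |(z i).im|)) :=
    AllLp.prod (u := fun (i : Fin (n + 1)) (z : Ell2) =>
      Real.exp (‖L‖ * |(z i).re|) * Real.exp (‖L‖ * |(z i).im|)) (fun i =>
      ((allLp_exp_abs_gaussianReal _ ‖L‖).comp (gaussP_map_re a r hsum i)).mul
        ((allLp_exp_abs_gaussianReal _ ‖L‖).comp (gaussP_map_im a r hsum i))) _
  intro q hq
  have hc : Continuous fun z => Real.exp |L (Ell2.proj n z)| :=
    Real.continuous_exp.comp (L.continuous.comp (Ell2.proj n).continuous).abs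
  refine (h1 q hq).mono hc.measurable.aestronglyMeasurable (Filter.Eventually.of_forall fun z => ?_)
  rw [Real.norm_of_nonneg (Real.exp_pos _).le, Real.norm_of_nonneg (by positivity)]
  simp only [← Real.exp_add]
  rw [← Real.exp_sum]
  refine Real.exp_le_exp.2 ?_
  have h2 : |L (Ell2.proj n z)| ≤ ‖L‖ * ‖Ell2.proj n z‖ := L.le_opNorm _
  have h3 : ‖Ell2.proj n z‖ ≤ ∑ i : Fin (n + 1), (|(z i).re| + |(z i).im|) := by
    refine (pi_norm_le_iff_of_nonneg (by positivity)).2 fun i => ?_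
    refine (Complex.norm_le_abs_re_add_abs_im (z i)).trans ?_
    exact Finset.single_le_sum (f := fun i : Fin (n + 1) => |(z i).re| + |(z i).im|)
      (fun i _ => by positivity) (Finset.mem_univ i)
  refine h2.trans ((mul_le_mul_of_nonneg_left h3 (norm_nonneg _)).trans_eq ?_)
  rw [Finset.mul_sum]
  exact Finset.sum_congr rfl fun i _ => by ring

/-- Real linear functions of finitely many coordinates are polynomials in the `z̄_j` and `z_j`. -/
theorem exists_poly_dual {n : ℕ} (L : StrongDual ℝ (Fin (n + 1) → ℂ)) :
    ∃ p : MvPolynomial Mode ℂ, ∀ z, evalAt p z = (L (Ell2.proj n z) : ℂ) := by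
  classical
  refine ⟨∑ i : Fin (n + 1),
    (((L (Pi.single i 1) : ℂ) / 2) • (MvPolynomial.X (Sum.inr (i : ℕ)) + MvPolynomial.X (Sum.inl (i : ℕ)))
    + ((L (Pi.single i Complex.I) : ℂ) / (2 * Complex.I)) •
      (MvPolynomial.X (Sum.inr (i : ℕ)) - MvPolynomial.X (Sum.inl (i : ℕ)))), fun z => ?_⟩
  have hx : Ell2.proj n z = ∑ i : Fin (n + 1), ((z i).re • (Pi.single i 1 : Fin (n + 1) → ℂ)
      + (z i).im • (Pi.single i Complex.I : Fin (n + 1) → ℂ)) := by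
    funext k
    rw [Finset.sum_apply, Finset.sum_eq_single k]
    · change z k = _
      simp
    · intro i _ hi
      simp [Ne.symm hi]
    · simp
  rw [hx, map_sum, evalAt_sum, Complex.ofReal_sum]
  refine Finset.sum_congr rfl fun i _ => ?_
  rw [map_add, map_smul, map_smul]
  simp only [evalAt_add, evalAt_smul, evalAt_sub, evalAt_X, modeVal, Sum.elim_inl, Sum.elim_inr,
    Complex.add_conj, Complex.sub_conj]
  push_cast
  simp only [smul_eq_mul, Complex.ofReal_mul]
  have := Complex.I_ne_zero
  field_simp

/-- A function orthogonal to all polynomials is orthogonal to the characters `exp(iL)`: the exponential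
series may be integrated termwise, since `exp |L|` lies in `L²`. -/
theorem integral_exp_dual_eq_zero {a : ℕ → ℝ} {r : ℝ} (hsum : Summable fun i => a i ^ 2)
    {u : Ell2 → ℝ} (hu : MemLp u 2 (gaussP a r))
    (h : ∀ p, ∫ z, (u z : ℂ) * evalAt p z ∂(gaussP a r) = 0) {n : ℕ}
    (L : StrongDual ℝ (Fin (n + 1) → ℂ)) :
    ∫ z, (u z : ℂ) * Complex.exp (L (Ell2.proj n z) * Complex.I) ∂(gaussP a r) = 0 := by
  obtain ⟨p, hp⟩ := exists_poly_dual L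
  have hL : Measurable fun z => L (Ell2.proj n z) :=
    (L.continuous.comp (Ell2.proj n).continuous).measurable
  have hLc : Measurable fun z => (L (Ell2.proj n z) : ℂ) := Complex.measurable_ofReal.comp hL
  have huc : AEStronglyMeasurable (fun z => (u z : ℂ)) (gaussP a r) := hu.ofReal.1
  have key := hasSum_integral_of_dominated_convergence (μ := gaussP a r)
    (F := fun (k : ℕ) z => (u z : ℂ) * ((L (Ell2.proj n z) * Complex.I) ^ k / (k.factorial : ℂ)))
    (f := fun z => (u z : ℂ) * Complex.exp (L (Ell2.proj n z) * Complex.I))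
    (fun k z => |u z| * (|L (Ell2.proj n z)| ^ k / k.factorial))
    (fun k => huc.mul (((hLc.mul_const _).pow_const k).div_const _).aestronglyMeasurable)
    (fun k => Filter.Eventually.of_forall fun z => by simp)
    (Filter.Eventually.of_forall fun z => (Real.summable_pow_div_factorial _).mul_left _)
    (by
      have : (fun z => ∑' k : ℕ, |u z| * (|L (Ell2.proj n z)| ^ k / k.factorial))
          = fun z => |u z| * Real.exp |L (Ell2.proj n z)| := by
        funext z
        rw [tsum_mul_left, Real.exp_eq_exp_ℝ, NormedSpace.exp_eq_tsum_div]
      rw [this]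
      exact hu.abs.integrable_mul (allLp_exp_dual a r hsum L 2 (by norm_num)))
    (Filter.Eventually.of_forall fun z => by
      have := NormedSpace.expSeries_div_hasSum_exp ((L (Ell2.proj n z) : ℂ) * Complex.I)
      rw [← Complex.exp_eq_exp_ℂ] at this
      exact this.mul_left _)
  have hz : ∀ k : ℕ, ∫ z, (u z : ℂ) * ((L (Ell2.proj n z) * Complex.I) ^ k / (k.factorial : ℂ))
      ∂(gaussP a r) = 0 := by
    intro k
    have := h ((Complex.I ^ k / (k.factorial : ℂ)) • p ^ k)
    rw [← this]
    refine integral_congr_ae (Filter.Eventually.of_forall fun z => ?_)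
    simp only [evalAt_smul, evalAt_pow, hp]
    ring
  simp only [hz] at key
  exact key.unique hasSum_zero

/-- A real function `u` in `L²(P_r)` orthogonal to all polynomials is orthogonal to all test functions:
the images of the finite measures `u⁺ P_r` and `u⁻ P_r` in finitely many coordinates have the same
characteristic function, so they agree. -/
theorem integral_test_eq_zero {a : ℕ → ℝ} {r : ℝ} (hsum : Summable fun i => a i ^ 2)
    {u : Ell2 → ℝ} (hu : MemLp u 2 (gaussP a r))
    (h : ∀ p, ∫ z, (u z : ℂ) * evalAt p z ∂(gaussP a r) = 0) {φ : Ell2 → ℂ} (hφ : IsTest φ) :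
    ∫ z, (u z : ℂ) * φ z ∂(gaussP a r) = 0 := by
  obtain ⟨n, F, hF, hc, hφF⟩ := hφ
  have hui : Integrable u (gaussP a r) := hu.integrable (by norm_num)
  have hp : Measurable (Ell2.proj n) := (Ell2.proj n).continuous.measurable
  -- the image of the finite measure `w⁺ P_r` in the first coordinates
  have aux : ∀ w : Ell2 → ℝ, Integrable w (gaussP a r) →
      ∃ ν : Measure (Fin (n + 1) → ℂ), IsFiniteMeasure ν ∧ ∀ G : (Fin (n + 1) → ℂ) → ℂ, Continuous G →
        ∫ x, G x ∂ν = ∫ z, ((max (w z) 0 : ℝ) : ℂ) * G (Ell2.proj n z) ∂(gaussP a r) := by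
    intro w hw
    refine ⟨((gaussP a r).withDensity fun z => ENNReal.ofReal (w z)).map (Ell2.proj n), ?_, ?_⟩
    · have := isFiniteMeasure_withDensity_ofReal hw.2
      infer_instance
    · intro G hG
      rw [integral_map hp.aemeasurable hG.aestronglyMeasurable,
        integral_withDensity_eq_integral_toReal_smul₀ hw.1.aemeasurable.ennreal_ofReal
          (Filter.Eventually.of_forall fun z => ENNReal.ofReal_lt_top)]
      simp [ENNReal.toReal_ofReal']
  obtain ⟨ν₁, hν₁, h₁⟩ := aux u hui
  obtain ⟨ν₂, hν₂, h₂⟩ := aux (fun z => - u z) hui.neg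
  have hdiff : ∀ (G : (Fin (n + 1) → ℂ) → ℂ) (C : ℝ), Continuous G → (∀ x, ‖G x‖ ≤ C) →
      ∫ x, G x ∂ν₁ - ∫ x, G x ∂ν₂ = ∫ z, (u z : ℂ) * G (Ell2.proj n z) ∂(gaussP a r) := by
    intro G C hG hC
    have hi : ∀ w : Ell2 → ℝ, Integrable w (gaussP a r) →
        Integrable (fun z => ((max (w z) 0 : ℝ) : ℂ) * G (Ell2.proj n z)) (gaussP a r) := by
      intro w hw
      exact Integrable.mul_bdd (c := C) hw.pos_part.ofReal
        (hG.comp (Ell2.proj n).continuous).aestronglyMeasurable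
        (Filter.Eventually.of_forall fun z => hC _)
    rw [h₁ G hG, h₂ G hG, ← integral_sub (hi _ hui) (hi (fun z => - u z) hui.neg)]
    refine integral_congr_ae (Filter.Eventually.of_forall fun z => ?_)
    simp only
    rw [← sub_mul, ← Complex.ofReal_sub]
    congr 2
    rcases le_total (u z) 0 with h | h
    · rw [max_eq_right h, max_eq_left (by linarith)]; ring
    · rw [max_eq_left h, max_eq_right (by linarith)]; ring
  have heq : ν₁ = ν₂ := by
    refine Measure.ext_of_charFunDual (funext fun L => ?_)
    rw [charFunDual_apply, charFunDual_apply, ← sub_eq_zero,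
      hdiff (fun x => Complex.exp (L x * Complex.I)) 1 (by fun_prop)
        (fun x => (Complex.norm_exp_ofReal_mul_I _).le)]
    exact integral_exp_dual_eq_zero hsum hu h L
  obtain ⟨C, hC⟩ := hF.continuous.bounded_above_of_compact_support hc
  have := hdiff F C hF.continuous hC
  rw [heq, sub_self] at this
  rw [this]
  refine integral_congr_ae (Filter.Eventually.of_forall fun z => ?_)
  simp only [hφF]
  rfl

/-- Completeness of the polynomials in `L²(P_r)`. -/
theorem ae_zero_of_poly {a : ℕ → ℝ} {r : ℝ} (hsum : Summable fun i => a i ^ 2) {g : Ell2 → ℂ}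
    (hg : MemLp g 2 (gaussP a r)) (h : ∀ p, ∫ z, g z * conj (evalAt p z) ∂(gaussP a r) = 0) :
    g =ᵐ[gaussP a r] 0 := by
  have h1 : ∀ p, ∫ z, g z * evalAt p z ∂(gaussP a r) = 0 := by
    intro p
    obtain ⟨q, hq, -⟩ := exists_conj_poly p
    rw [← h q]
    simp [hq]
  have h2 : ∀ p, ∫ z, conj (g z) * evalAt p z ∂(gaussP a r) = 0 := by
    intro p
    have := congrArg conj (h p)
    rw [← integral_conj] at this
    simpa using this
  have hi1 : ∀ p, Integrable (fun z => g z * evalAt p z) (gaussP a r) := fun p =>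
    hg.integrable_mul (memLp_evalAt a r hsum p)
  have hi2 : ∀ p, Integrable (fun z => conj (g z) * evalAt p z) (gaussP a r) := fun p =>
    hg.star.integrable_mul (memLp_evalAt a r hsum p)
  have hre : ∀ p, ∫ z, ((g z).re : ℂ) * evalAt p z ∂(gaussP a r) = 0 := by
    intro p
    have : ∀ z, ((g z).re : ℂ) * evalAt p z = (1 / 2) * (g z * evalAt p z + conj (g z) * evalAt p z) := by
      intro z; rw [← add_mul, Complex.add_conj]; push_cast; ring
    simp only [this]
    rw [integral_const_mul, integral_add (hi1 p) (hi2 p), h1, h2]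
    simp
  have him : ∀ p, ∫ z, ((g z).im : ℂ) * evalAt p z ∂(gaussP a r) = 0 := by
    intro p
    have : ∀ z, ((g z).im : ℂ) * evalAt p z
        = (1 / (2 * Complex.I)) * (g z * evalAt p z - conj (g z) * evalAt p z) := by
      intro z; rw [← sub_mul, Complex.sub_conj]; push_cast
      have := Complex.I_ne_zero
      field_simp
    simp only [this]
    rw [integral_const_mul, integral_sub (hi1 p) (hi2 p), h1, h2]
    simp
  refine ae_zero_of_test a r hg fun φ hφ => ?_
  have hφc : IsTest fun z => conj (φ z) := by
    obtain ⟨n, F, hF, hc, hφF⟩ := hφ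
    exact ⟨n, fun x => conj (F x), Complex.conjCLE.contDiff.comp hF,
      hc.comp_left (g := fun x : ℂ => conj x) (by simp), fun z => congrArg conj (hφF z)⟩
  have e1 : ∫ z, ((g z).re : ℂ) * conj (φ z) ∂(gaussP a r) = 0 :=
    integral_test_eq_zero hsum hg.re hre hφc
  have e2 : ∫ z, ((g z).im : ℂ) * conj (φ z) ∂(gaussP a r) = 0 :=
    integral_test_eq_zero hsum hg.im him hφc
  have hm := memLp_test a r hφ 2
  have i1 : Integrable (fun z => ((g z).re : ℂ) * conj (φ z)) (gaussP a r) :=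
    integrable_mul_conj hg.re.ofReal hm
  have i2 : Integrable (fun z => ((g z).im : ℂ) * conj (φ z)) (gaussP a r) :=
    integrable_mul_conj hg.im.ofReal hm
  have : ∀ z, g z * conj (φ z) = ((g z).re : ℂ) * conj (φ z) + Complex.I * (((g z).im : ℂ) * conj (φ z)) := by
    intro z
    conv_lhs => rw [← Complex.re_add_im (g z)]
    ring
  simp only [this]
  rw [integral_add i1 (i2.const_mul _), integral_const_mul, e1, e2]
  simp

/-! ### Parseval identity and polynomial test functions -/

theorem inner_toLp_toLp {α : Type*} [MeasurableSpace α] {μ : Measure α} {u v : α → ℂ}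
    (hu : MemLp u 2 μ) (hv : MemLp v 2 μ) :
    inner ℂ (hu.toLp u) (hv.toLp v) = ∫ z, v z * conj (u z) ∂μ := by
  rw [L2.inner_def]
  refine integral_congr_ae ?_
  filter_upwards [hu.coeFn_toLp, hv.coeFn_toLp] with z h1 h2
  rw [h1, h2, RCLike.inner_apply]

/-- The unnormalized Hermite coefficient of a function. -/
def hermCoeff (a : ℕ → ℝ) (r : ℝ) (g : Ell2 → ℂ) (m : Multiset Mode) : ℂ :=
  ∫ z, g z * conj (evalAt (herm a r m) z) ∂(gaussP a r)

/-- Parseval's identity for the Hermite expansion in `L²(P_r)`. -/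
theorem hasSum_hermCoeff {a : ℕ → ℝ} (ha : ∀ i, 0 < a i) {r : ℝ} (hr : 0 < r)
    (hsum : Summable fun i => a i ^ 2) {g : Ell2 → ℂ} (hg : MemLp g 2 (gaussP a r)) :
    HasSum (fun m => ‖hermCoeff a r g m‖ ^ 2 / hermNorm a r m) (∫ z, ‖g z‖ ^ 2 ∂(gaussP a r)) := by
  have hN := hermNorm_pos ha hr hsum
  let e : Multiset Mode → Lp ℂ 2 (gaussP a r) := fun m => (memLp_evalAt a r hsum (herm a r m)).toLp _
  let v : Multiset Mode → Lp ℂ 2 (gaussP a r) := fun m => (((Real.sqrt (hermNorm a r m))⁻¹ : ℝ) : ℂ) • e m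
  have hin : ∀ m (G : Lp ℂ 2 (gaussP a r)), inner ℂ (v m) G
      = (((Real.sqrt (hermNorm a r m))⁻¹ : ℝ) : ℂ) * inner ℂ (e m) G := by
    intro m G
    rw [inner_smul_left, Complex.conj_ofReal]
  have hee : ∀ m m', inner ℂ (e m) (e m') = if m = m' then (hermNorm a r m : ℂ) else 0 := by
    intro m m'
    rw [inner_toLp_toLp]
    split_ifs with h
    · subst h; exact integral_herm_self a r m
    · exact integral_herm_herm ha hr hsum m m' (Ne.symm h)
  have hv : Orthonormal ℂ v := by
    rw [orthonormal_iff_ite]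
    intro m m'
    rw [hin, inner_smul_right, hee]
    split_ifs with h
    · subst h
      rw [← mul_assoc, ← Complex.ofReal_mul, ← mul_inv, Real.mul_self_sqrt (hN m).le,
        ← Complex.ofReal_mul, inv_mul_cancel₀ (hN m).ne', Complex.ofReal_one]
    · simp
  have hsp : (Submodule.span ℂ (Set.range v))ᗮ = ⊥ := by
    rw [Submodule.eq_bot_iff]
    intro G hG
    have h0 : ∀ m, inner ℂ (e m) G = 0 := by
      intro m
      have := (Submodule.mem_orthogonal _ _).1 hG (v m) (Submodule.subset_span ⟨m, rfl⟩)
      rw [hin] at this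
      refine (mul_eq_zero.1 this).resolve_left ?_
      have := Real.sqrt_pos.2 (hN m)
      exact_mod_cast (inv_pos.2 this).ne'
    have hG0 : (G : Ell2 → ℂ) =ᵐ[gaussP a r] 0 := by
      refine ae_zero_of_poly hsum (Lp.memLp G) fun p => ?_
      have hp := mem_span_herm ha hr p
      induction hp using Submodule.span_induction with
      | mem p h =>
        obtain ⟨m, rfl⟩ := h
        have := h0 m
        conv at this => lhs; arg 3; rw [← Lp.toLp_coeFn G (Lp.memLp G)]
        rwa [inner_toLp_toLp] at this
      | zero => simp
      | add p q _ _ hp hq =>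
        simp only [evalAt_add, map_add, mul_add]
        rw [integral_add (integrable_mul_conj (Lp.memLp G) (memLp_evalAt a r hsum p))
          (integrable_mul_conj (Lp.memLp G) (memLp_evalAt a r hsum q)), hp, hq, add_zero]
      | smul c p _ hp =>
        simp only [evalAt_smul, map_mul, mul_left_comm _ (conj c)]
        rw [integral_const_mul, hp, mul_zero]
    exact (Lp.eq_zero_iff_ae_eq_zero).2 hG0
  let b := HilbertBasis.mkOfOrthogonalEqBot hv hsp
  have hb : ∀ m, b m = v m := fun m => by
    rw [HilbertBasis.coe_mkOfOrthogonalEqBot]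
  have key := b.hasSum_inner_mul_inner (hg.toLp g) (hg.toLp g)
  have key2 := Complex.hasSum_re key
  have e1 : ∀ m, (inner ℂ (hg.toLp g) (b m) * inner ℂ (b m) (hg.toLp g)).re
      = ‖hermCoeff a r g m‖ ^ 2 / hermNorm a r m := by
    intro m
    rw [← inner_conj_symm, Complex.conj_mul', hb, hin, inner_toLp_toLp]
    rw [norm_mul, ← Complex.ofReal_pow, Complex.ofReal_re, mul_pow, Complex.norm_real,
      Real.norm_eq_abs, sq_abs, inv_pow, Real.sq_sqrt (hN m).le]
    simp only [hermCoeff]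
    field_simp
  have e2 : (inner ℂ (hg.toLp g) (hg.toLp g)).re = ∫ z, ‖g z‖ ^ 2 ∂(gaussP a r) := by
    rw [inner_toLp_toLp]
    have : ∀ z, g z * conj (g z) = ((‖g z‖ ^ 2 : ℝ) : ℂ) := by
      intro z; rw [Complex.mul_conj']; push_cast; rfl
    simp only [this]
    rw [integral_complex_ofReal, Complex.ofReal_re]
  simp only [e1, e2] at key2
  exact key2

theorem norm_sq_component {a : ℕ → ℝ} (ha : ∀ i, 0 < a i) {r : ℝ} {s t : ℕ} (f : L2Form a r s t)
    (p : MultiIdx s × MultiIdx t) :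
    ‖f p‖ ^ 2 = weight a p * ∫ z, ‖f p z‖ ^ 2 ∂(gaussP a r) := by
  have h1 : ‖f p‖ ^ 2 = (inner ℂ (f p) (f p)).re := (inner_self_eq_norm_sq (𝕜 := ℂ) (f p)).symm
  rw [h1, L2.inner_def, integral_smul_measure, ENNReal.toReal_ofReal (weight_pos ha p).le]
  have : ∀ z, inner ℂ (f p z) (f p z) = ((‖f p z‖ ^ 2 : ℝ) : ℂ) := by
    intro z; rw [inner_self_eq_norm_sq_to_K]; push_cast; rfl
  simp only [this]
  rw [integral_complex_ofReal, Complex.real_smul, ← Complex.ofReal_mul, Complex.ofReal_re]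

theorem hasSum_component {a : ℕ → ℝ} (ha : ∀ i, 0 < a i) {r : ℝ} (hr : 0 < r)
    (hsum : Summable fun i => a i ^ 2) {s t : ℕ} (f : L2Form a r s t)
    (p : MultiIdx s × MultiIdx t) :
    HasSum (fun m => weight a p * (‖hermCoeff a r (f p) m‖ ^ 2 / hermNorm a r m)) (‖f p‖ ^ 2) := by
  rw [norm_sq_component ha]
  exact (hasSum_hermCoeff ha hr hsum (memLp_coeff ha r f p)).mul_left _

theorem hasSum_norm_sq_form {a : ℕ → ℝ} {r : ℝ} {s t : ℕ} (f : L2Form a r s t) :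
    HasSum (fun p => ‖f p‖ ^ 2) (‖f‖ ^ 2) := by
  have := lp.hasSum_norm (p := 2) (by norm_num) f
  simpa using this

/-- Cutoff functions depending on finitely many coordinates, with derivatives tending to `0`. -/
theorem exists_cutoff (n : ℕ) : ∃ ψ : ℕ → Ell2 → ℂ,
    (∀ k, ∃ G : (Fin (n + 1) → ℂ) → ℂ, ContDiff ℝ ∞ G ∧ HasCompactSupport G ∧
      ∀ z, ψ k z = G (Ell2.proj n z)) ∧
    (∀ k z, ‖ψ k z‖ ≤ 1) ∧ (∀ z, Filter.Tendsto (fun k => ψ k z) Filter.atTop (nhds 1)) ∧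
    ∀ v : Ell2, ∃ C, ∀ k z, ‖fderiv ℝ (ψ k) z v‖ ≤ C / (k + 1) := by
  let χ : ContDiffBump (0 : Fin (n + 1) → ℂ) := ⟨1, 2, by norm_num, by norm_num⟩
  have hχ : ContDiff ℝ ∞ (χ : (Fin (n + 1) → ℂ) → ℝ) := χ.contDiff
  let A : (k : ℕ) → (Fin (n + 1) → ℂ) →L[ℝ] (Fin (n + 1) → ℂ) := fun k =>
    ((k : ℝ) + 1)⁻¹ • ContinuousLinearMap.id ℝ _
  have hc : ∀ k : ℕ, ((k : ℝ) + 1)⁻¹ ≠ 0 := fun k => by positivity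
  refine ⟨fun k z => (χ (A k (Ell2.proj n z)) : ℂ), fun k => ⟨fun x => (χ (A k x) : ℂ), ?_, ?_, fun z => rfl⟩,
    ?_, ?_, ?_⟩
  · exact Complex.ofRealCLM.contDiff.comp (hχ.comp (A k).contDiff)
  · have h1 : HasCompactSupport fun x => χ (((k : ℝ) + 1)⁻¹ • x) :=
      χ.hasCompactSupport.comp_homeomorph (Homeomorph.smulOfNeZero _ (hc k))
    exact h1.comp_left (g := fun x : ℝ => (x : ℂ)) (by simp)
  · intro k z
    rw [Complex.norm_real, Real.norm_of_nonneg χ.nonneg]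
    exact χ.le_one
  · intro z
    have h1 : Filter.Tendsto (fun k : ℕ => A k (Ell2.proj n z)) Filter.atTop (nhds 0) := by
      have := (tendsto_one_div_add_atTop_nhds_zero_nat (𝕜 := ℝ)).smul_const (Ell2.proj n z)
      simpa [A] using this
    have h2 := (χ.continuous.tendsto 0).comp h1
    rw [χ.one_of_mem_closedBall (by simp [χ])] at h2
    have h3 := (Complex.continuous_ofReal.tendsto 1).comp h2
    simpa [Function.comp_def] using h3
  · intro v
    obtain ⟨C, hC⟩ := (hχ.continuous_fderiv (by simp)).bounded_above_of_compact_support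
      (χ.hasCompactSupport.fderiv (𝕜 := ℝ))
    refine ⟨C * ‖Ell2.proj n v‖, fun k z => ?_⟩
    have hd : HasFDerivAt (fun z => (χ (A k (Ell2.proj n z)) : ℂ)) _ z :=
      (Complex.ofRealCLM.hasFDerivAt (x := χ (A k (Ell2.proj n z)))).comp z
        (((hχ.differentiable (by simp) (A k (Ell2.proj n z))).hasFDerivAt.comp z
          ((A k).comp (Ell2.proj n)).hasFDerivAt))
    rw [hd.fderiv]
    have e : A k (Ell2.proj n v) = ((k : ℝ) + 1)⁻¹ • Ell2.proj n v := rfl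
    simp only [ContinuousLinearMap.comp_apply, Complex.ofRealCLM_apply, Complex.norm_real, e, map_smul,
      norm_smul]
    rw [Real.norm_of_nonneg (by positivity), inv_mul_eq_div]
    gcongr
    exact (ContinuousLinearMap.le_opNorm _ _).trans (by gcongr; exact hC _)

theorem IsTest.differentiable {φ : Ell2 → ℂ} (h : IsTest φ) : Differentiable ℝ φ := by
  obtain ⟨n, F, hF, -, hφF⟩ := h
  have : φ = fun z => F (Ell2.proj n z) := funext hφF
  rw [this]
  exact (hF.comp (Ell2.proj n).contDiff).differentiable (by simp)

/-- Approximation of a polynomial by test functions, in a way that allows passing to the limit under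
the integral. -/
theorem exists_test_approx (a : ℕ → ℝ) (r : ℝ) (p : MvPolynomial Mode ℂ) : ∃ φ : ℕ → Ell2 → ℂ,
    (∀ k, IsTest (φ k)) ∧ (∀ k z, ‖φ k z‖ ≤ ‖evalAt p z‖) ∧
    (∀ z, Filter.Tendsto (fun k => φ k z) Filter.atTop (nhds (evalAt p z))) ∧
    ∀ j, (∃ C, ∀ k z, ‖deltaOp a r j (φ k) z‖ ≤ ‖deltaOp a r j (evalAt p) z‖ + C * ‖evalAt p z‖) ∧
      ∀ z, Filter.Tendsto (fun k => deltaOp a r j (φ k) z) Filter.atTop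
        (nhds (deltaOp a r j (evalAt p) z)) := by
  obtain ⟨n, hn⟩ := exists_cylinder_evalAt p
  obtain ⟨F, hF, hpF⟩ := hn n le_rfl
  obtain ⟨ψ, h1, h2, h3, h4⟩ := exists_cutoff n
  have hψd : ∀ k, Differentiable ℝ (ψ k) := by
    intro k
    obtain ⟨G, hG, hc, hψG⟩ := h1 k
    rw [funext hψG]
    exact (hG.comp (Ell2.proj n).contDiff).differentiable (by simp)
  refine ⟨fun k z => evalAt p z * conj (ψ k z), fun k => ?_, fun k z => ?_, fun z => ?_, fun j => ?_⟩
  · obtain ⟨G, hG, hc, hψG⟩ := h1 k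
    refine ⟨n, fun x => F x * conj (G x), hF.mul (Complex.conjCLE.contDiff.comp hG),
      HasCompactSupport.mul_left (hc.comp_left (g := fun x : ℂ => conj x) (by simp)), fun z => ?_⟩
    change evalAt p z * conj (ψ k z) = F (Ell2.proj n z) * conj (G (Ell2.proj n z))
    rw [hpF, hψG]
  · rw [norm_mul, RCLike.norm_conj]
    exact mul_le_of_le_one_right (norm_nonneg _) (h2 k z)
  · have := ((Complex.continuous_conj.tendsto 1).comp (h3 z)).const_mul (evalAt p z)
    simpa using this
  · obtain ⟨C₁, hC₁⟩ := h4 (lp.single 2 j (1 : ℂ))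
    obtain ⟨C₂, hC₂⟩ := h4 (lp.single 2 j Complex.I)
    have hx : ∀ k z, ‖dX j (ψ k) z‖ ≤ C₁ / (k + 1) := fun k z => by
      rw [dX_eq_fderiv (hψd k)]; exact hC₁ k z
    have hy : ∀ k z, ‖dY j (ψ k) z‖ ≤ C₂ / (k + 1) := fun k z => by
      rw [dY_eq_fderiv (hψd k)]; exact hC₂ k z
    have e : ∀ k z, deltaOp a r j (fun z => evalAt p z * conj (ψ k z)) z
        = deltaOp a r j (evalAt p) z * conj (ψ k z)
          + evalAt p z * ((1 / 2) * (conj (dX j (ψ k) z) - Complex.I * conj (dY j (ψ k) z))) := by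
      intro k z
      simp only [deltaOp, partialZ]
      rw [dX_mul_conj (differentiable_evalAt p) (hψd k), dY_mul_conj (differentiable_evalAt p) (hψd k)]
      ring
    have hb : ∀ k z, ‖(1 / 2 : ℂ) * (conj (dX j (ψ k) z) - Complex.I * conj (dY j (ψ k) z))‖
        ≤ (C₁ + C₂) * (1 / (k + 1)) := by
      intro k z
      rw [norm_mul]
      have : ‖conj (dX j (ψ k) z) - Complex.I * conj (dY j (ψ k) z)‖ ≤ C₁ / (k + 1) + C₂ / (k + 1) := by
        refine (norm_sub_le _ _).trans (add_le_add ?_ ?_)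
        · rw [RCLike.norm_conj]; exact hx k z
        · rw [norm_mul, Complex.norm_I, one_mul, RCLike.norm_conj]; exact hy k z
      have h0 := (norm_nonneg _).trans this
      have h12 : ‖(1 / 2 : ℂ)‖ = 1 / 2 := by norm_num
      rw [h12]
      calc _ ≤ 1 / 2 * (C₁ / (k + 1) + C₂ / (k + 1)) := by gcongr
        _ ≤ C₁ / (k + 1) + C₂ / (k + 1) := by linarith
        _ = _ := by ring
    have hC : 0 ≤ C₁ + C₂ := by
      have := (norm_nonneg _).trans (hb 0 0)
      simpa using this
    refine ⟨⟨C₁ + C₂, fun k z => ?_⟩, fun z => ?_⟩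
    · rw [e]
      refine (norm_add_le _ _).trans (add_le_add ?_ ?_)
      · rw [norm_mul, RCLike.norm_conj]
        exact mul_le_of_le_one_right (norm_nonneg _) (h2 k z)
      · rw [norm_mul, mul_comm]
        gcongr
        refine (hb k z).trans (mul_le_of_le_one_right hC ?_)
        rw [div_le_one (by positivity)]
        linarith [(Nat.cast_nonneg k : (0 : ℝ) ≤ k)]
    · simp only [e]
      have t1 := ((Complex.continuous_conj.tendsto 1).comp (h3 z)).const_mul (deltaOp a r j (evalAt p) z)
      have t2 : Filter.Tendsto (fun k : ℕ => (1 / 2 : ℂ) * (conj (dX j (ψ k) z)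
          - Complex.I * conj (dY j (ψ k) z))) Filter.atTop (nhds 0) := by
        refine squeeze_zero_norm (fun k => hb k z) ?_
        simpa using (tendsto_one_div_add_atTop_nhds_zero_nat (𝕜 := ℝ)).const_mul (C₁ + C₂)
      have t3 := t1.add (t2.const_mul (evalAt p z))
      simpa using t3

/-- The weak equation `g = ∂̄ f`, which is tested with test functions, also holds for polynomials. -/
theorem IsWeakDbar.poly {a : ℕ → ℝ} (ha : ∀ i, 0 < a i) {r : ℝ} (hsum : Summable fun i => a i ^ 2)
    {s t : ℕ} {f : L2Form a r s t} {g : L2Form a r s (t + 1)} (h : IsWeakDbar a r f g)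
    (I : MultiIdx s) (K : MultiIdx (t + 1)) (p : MvPolynomial Mode ℂ) :
    (-1) ^ s * ∫ z, g (I, K) z * conj (evalAt p z) ∂(gaussP a r)
      = ∑ i ∈ K.1.attach, epsSign i.1 (K.1.erase i.1) K.1 *
        ∫ z, f (I, ⟨K.1.erase i.1, by rw [Finset.card_erase_of_mem i.2, K.2]; rfl⟩) z
          * conj (evalAt (raise a r (Sum.inl i.1) p) z) ∂(gaussP a r) := by
  obtain ⟨φ, hφ, hb, hlim, hδ⟩ := exists_test_approx a r p
  -- passage to the limit under the integral sign
  have lim1 : ∀ u : Ell2 → ℂ, MemLp u 2 (gaussP a r) →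
      Filter.Tendsto (fun k => ∫ z, u z * conj (φ k z) ∂(gaussP a r)) Filter.atTop
        (nhds (∫ z, u z * conj (evalAt p z) ∂(gaussP a r))) := by
    intro u hu
    refine tendsto_integral_of_dominated_convergence (fun z => ‖u z‖ * ‖evalAt p z‖)
      (fun k => (integrable_mul_conj hu (memLp_test a r (hφ k) 2)).1)
      (hu.norm.integrable_mul (memLp_evalAt a r hsum p).norm)
      (fun k => Filter.Eventually.of_forall fun z => ?_)
      (Filter.Eventually.of_forall fun z => ?_)
    · rw [norm_mul, RCLike.norm_conj]
      gcongr
      exact hb k z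
    · exact ((Complex.continuous_conj.tendsto _).comp (hlim z)).const_mul _
  have lim2 : ∀ (j : ℕ) (u : Ell2 → ℂ), MemLp u 2 (gaussP a r) →
      Filter.Tendsto (fun k => ∫ z, u z * conj (deltaOp a r j (φ k) z) ∂(gaussP a r)) Filter.atTop
        (nhds (∫ z, u z * conj (deltaOp a r j (evalAt p) z) ∂(gaussP a r))) := by
    intro j u hu
    obtain ⟨⟨C, hC⟩, hl⟩ := hδ j
    have hp := memLp_evalAt a r hsum p
    have hdp : MemLp (deltaOp a r j (evalAt p)) 2 (gaussP a r) := by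
      rw [funext fun z => deltaOp_evalAt a r j p z]
      exact (memLp_evalAt a r hsum _).neg
    refine tendsto_integral_of_dominated_convergence
      (fun z => ‖u z‖ * (‖deltaOp a r j (evalAt p) z‖ + C * ‖evalAt p z‖))
      (fun k => (integrable_mul_conj hu (memLp_deltaOp a r (hφ k) j)).1)
      (hu.norm.integrable_mul (hdp.norm.add (hp.norm.const_mul C)))
      (fun k => Filter.Eventually.of_forall fun z => ?_)
      (Filter.Eventually.of_forall fun z => ?_)
    · rw [norm_mul, RCLike.norm_conj]
      gcongr
      exact hC k z
    · exact ((Complex.continuous_conj.tendsto _).comp (hl z)).const_mul _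
  have hc : ∀ i : {x // x ∈ K.1}, (K.1.erase i.1).card = t := fun i => by
    rw [Finset.card_erase_of_mem i.2, K.2]; rfl
  have hk : ∀ k, (-1) ^ s * ∫ z, g (I, K) z * conj (φ k z) ∂(gaussP a r)
      = ∑ i ∈ K.1.attach, -(epsSign i.1 (K.1.erase i.1) K.1 *
        ∫ z, f (I, ⟨K.1.erase i.1, hc i⟩) z * conj (deltaOp a r i.1 (φ k) z) ∂(gaussP a r)) := by
    intro k
    have h0 := h I K (φ k) (hφ k)
    simp only [dbarPairing_eq, mul_assoc] at h0
    rw [integral_const_mul, integral_finsetSum] at h0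
    · rw [h0, Finset.sum_neg_distrib]
      simp only [integral_const_mul]
    · intro i _
      exact (integrable_mul_conj (memLp_coeff ha r f _) (memLp_deltaOp a r (hφ k) _)).const_mul _
  have l1 := (lim1 _ (memLp_coeff ha r g (I, K))).const_mul ((-1 : ℂ) ^ s)
  simp only [hk] at l1
  have l2 := tendsto_finsetSum K.1.attach fun i _ =>
    ((lim2 i.1 _ (memLp_coeff ha r f (I, ⟨K.1.erase i.1, hc i⟩))).const_mul
      (epsSign i.1 (K.1.erase i.1) K.1)).neg
  rw [tendsto_nhds_unique l1 l2]
  refine Finset.sum_congr rfl fun i _ => ?_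
  rw [← mul_neg, ← integral_neg]
  simp [deltaOp_evalAt]

/-! ### Polynomial forms and the adjoint of `∂̄` -/

/-- The form with finitely many nonzero coefficients, all of them polynomials. -/
def polyForm (a : ℕ → ℝ) (r : ℝ) (hsum : Summable fun i => a i ^ 2) {s t : ℕ}
    (c : MultiIdx s × MultiIdx t → MvPolynomial Mode ℂ) (S : Finset (MultiIdx s × MultiIdx t))
    (hc : ∀ p ∉ S, c p = 0) : L2Form a r s t :=
  ⟨fun p => ((memLp_evalAt a r hsum (c p)).smul_measure
      (c := ENNReal.ofReal (weight a p)) ENNReal.ofReal_ne_top).toLp _, by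
    refine memℓp_gen (summable_of_ne_finset_zero (s := S) fun p hp => ?_)
    have : ((memLp_evalAt a r hsum (c p)).smul_measure
      (c := ENNReal.ofReal (weight a p)) ENNReal.ofReal_ne_top).toLp _ = 0 := by
      rw [Lp.eq_zero_iff_ae_eq_zero]
      refine (MemLp.coeFn_toLp _).trans (Filter.Eventually.of_forall fun z => ?_)
      rw [hc p hp]; simp
    rw [this]; simp⟩

theorem coeff_polyForm {a : ℕ → ℝ} (ha : ∀ i, 0 < a i) (r : ℝ) (hsum : Summable fun i => a i ^ 2)
    {s t : ℕ} (c : MultiIdx s × MultiIdx t → MvPolynomial Mode ℂ)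
    (S : Finset (MultiIdx s × MultiIdx t)) (hc : ∀ p ∉ S, c p = 0) (p : MultiIdx s × MultiIdx t) :
    ∀ᵐ z ∂(gaussP a r), polyForm a r hsum c S hc p z = evalAt (c p) z := by
  rw [← ae_weight ha r p]
  exact ((memLp_evalAt a r hsum (c p)).smul_measure ENNReal.ofReal_ne_top).coeFn_toLp

theorem inner_polyForm {a : ℕ → ℝ} (ha : ∀ i, 0 < a i) (r : ℝ) (hsum : Summable fun i => a i ^ 2)
    {s t : ℕ} (c : MultiIdx s × MultiIdx t → MvPolynomial Mode ℂ)
    (S : Finset (MultiIdx s × MultiIdx t)) (hc : ∀ p ∉ S, c p = 0) (f : L2Form a r s t) :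
    inner ℂ (polyForm a r hsum c S hc) f
      = ∑ p ∈ S, (weight a p : ℂ) * ∫ z, f p z * conj (evalAt (c p) z) ∂(gaussP a r) := by
  have h : ∀ p, inner ℂ (polyForm a r hsum c S hc p) (f p)
      = (weight a p : ℂ) * ∫ z, f p z * conj (evalAt (c p) z) ∂(gaussP a r) := by
    intro p
    rw [L2.inner_def, integral_smul_measure, ENNReal.toReal_ofReal (weight_pos ha p).le,
      Complex.real_smul]
    congr 1
    refine integral_congr_ae ?_
    filter_upwards [coeff_polyForm ha r hsum c S hc p] with z hz
    rw [hz, RCLike.inner_apply]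
  rw [lp.inner_eq_tsum, tsum_eq_sum (s := S)]
  · exact Finset.sum_congr rfl fun p _ => h p
  · intro p hp
    rw [h, hc p hp]
    simp

/-- Polynomial forms lie in the domain of `∂̄`, and there `∂̄` is computed by differentiating the
coefficients. -/
theorem isWeakDbar_polyForm {a : ℕ → ℝ} (ha : ∀ i, 0 < a i) {r : ℝ} (hr : 0 < r)
    (hsum : Summable fun i => a i ^ 2) {s t : ℕ} (c : MultiIdx s × MultiIdx t → MvPolynomial Mode ℂ)
    (S : Finset (MultiIdx s × MultiIdx t)) (hc : ∀ p ∉ S, c p = 0)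
    (d : MultiIdx s × MultiIdx (t + 1) → MvPolynomial Mode ℂ)
    (S' : Finset (MultiIdx s × MultiIdx (t + 1))) (hd : ∀ p ∉ S', d p = 0)
    (h : ∀ I (K : MultiIdx (t + 1)), d (I, K) = (-1 : ℂ) ^ s • ∑ i ∈ K.1.attach,
      epsSign i.1 (K.1.erase i.1) K.1 • MvPolynomial.pderiv (Sum.inl i.1)
        (c (I, ⟨K.1.erase i.1, by rw [Finset.card_erase_of_mem i.2, K.2]; rfl⟩))) :
    IsWeakDbar a r (polyForm a r hsum c S hc) (polyForm a r hsum d S' hd) := by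
  intro I K φ hφ
  have hφd := hφ.differentiable
  have hcard : ∀ i : {x // x ∈ K.1}, (K.1.erase i.1).card = t := fun i => by
    rw [Finset.card_erase_of_mem i.2, K.2]; rfl
  have e1 : ∫ z, ((-1) ^ s * polyForm a r hsum d S' hd (I, K) z) * conj (φ z) ∂(gaussP a r)
      = ∫ z, ∑ i ∈ K.1.attach, epsSign i.1 (K.1.erase i.1) K.1 *
        (evalAt (MvPolynomial.pderiv (Sum.inl i.1) (c (I, ⟨K.1.erase i.1, hcard i⟩))) z * conj (φ z))
        ∂(gaussP a r) := by
    refine integral_congr_ae ?_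
    filter_upwards [coeff_polyForm ha r hsum d S' hd (I, K)] with z hz
    rw [hz, h, evalAt_smul, ← mul_assoc, ← mul_pow, neg_one_mul, neg_neg, one_pow, one_mul,
      evalAt_sum, Finset.sum_mul]
    refine Finset.sum_congr rfl fun i _ => ?_
    rw [evalAt_smul, mul_assoc]
  have e2 : ∫ z, dbarPairing a r (polyForm a r hsum c S hc) I K φ z ∂(gaussP a r)
      = ∫ z, ∑ i ∈ K.1.attach, epsSign i.1 (K.1.erase i.1) K.1 *
        (evalAt (c (I, ⟨K.1.erase i.1, hcard i⟩)) z * conj (deltaOp a r i.1 φ z)) ∂(gaussP a r) := by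
    refine integral_congr_ae ?_
    have : ∀ᵐ z ∂(gaussP a r), ∀ i : {x // x ∈ K.1},
        polyForm a r hsum c S hc (I, ⟨K.1.erase i.1, hcard i⟩) z
          = evalAt (c (I, ⟨K.1.erase i.1, hcard i⟩)) z :=
      ae_all_iff.2 fun i => coeff_polyForm ha r hsum c S hc _
    filter_upwards [this] with z hz
    rw [dbarPairing_eq]
    refine Finset.sum_congr rfl fun i _ => ?_
    rw [hz i, mul_assoc]
  rw [e1, e2, integral_finsetSum, integral_finsetSum, ← Finset.sum_neg_distrib]
  · refine Finset.sum_congr rfl fun i _ => ?_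
    rw [integral_const_mul, integral_const_mul, integral_pderiv_mul_conj_deltaOp ha hr hsum i.1 _ hφd
      (memLp_test a r hφ 2) (memLp_lineDeriv a r hφ _) (memLp_lineDeriv a r hφ _), mul_neg]
  · intro i _
    exact (integrable_mul_conj (memLp_evalAt a r hsum _) (memLp_deltaOp a r hφ i.1)).const_mul _
  · intro i _
    exact (integrable_mul_conj (memLp_evalAt a r hsum _) (memLp_test a r hφ 2)).const_mul _

theorem dbar_apply_of_isWeakDbar {a : ℕ → ℝ} (ha : ∀ i, 0 < a i) {r : ℝ} {s t : ℕ}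
    {f : L2Form a r s t} {g : L2Form a r s (t + 1)} (h : IsWeakDbar a r f g) :
    ∃ hf : f ∈ (dbar a ha r s t).domain, dbar a ha r s t ⟨f, hf⟩ = g := by
  have hg : (f, g) ∈ (dbar a ha r s t).graph := by rw [dbar_graph]; exact h
  obtain ⟨y, hy1, hy2⟩ := (LinearPMap.mem_graph_iff _).1 hg
  simp only at hy1 hy2
  subst hy1
  exact ⟨y.2, hy2⟩

theorem isWeakDbar_dbar {a : ℕ → ℝ} (ha : ∀ i, 0 < a i) {r : ℝ} {s t : ℕ}
    (f : (dbar a ha r s t).domain) : IsWeakDbar a r (f : L2Form a r s t) (dbar a ha r s t f) := by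
  have hg := LinearPMap.mem_graph (dbar a ha r s t) f
  rw [dbar_graph] at hg
  exact hg

/-- The indices `j` such that the mode `z̄_j` occurs in `m`. -/
def leftModes (m : Multiset Mode) : Finset ℕ := m.toFinset.toLeft

theorem mem_leftModes {m : Multiset Mode} {j : ℕ} : j ∈ leftModes m ↔ Sum.inl j ∈ m := by
  simp [leftModes]

/-- The form `herm m dz_I ∧ dz̄_J`. -/
def hermForm (a : ℕ → ℝ) (r : ℝ) (hsum : Summable fun i => a i ^ 2) {s t : ℕ}
    (q : MultiIdx s × MultiIdx t) (m : Multiset Mode) : L2Form a r s t :=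
  polyForm a r hsum (Pi.single q (herm a r m)) {q} fun p hp => by
    rw [Pi.single_apply, if_neg (by simpa using hp)]

theorem inner_hermForm {a : ℕ → ℝ} (ha : ∀ i, 0 < a i) (r : ℝ) (hsum : Summable fun i => a i ^ 2)
    {s t : ℕ} (q : MultiIdx s × MultiIdx t) (m : Multiset Mode) (f : L2Form a r s t) :
    inner ℂ (hermForm a r hsum q m) f = weight a q * hermCoeff a r (f q) m := by
  rw [hermForm, inner_polyForm ha]
  simp [hermCoeff]

/-- The indices `(I, J ∪ {j})` of the coefficients of `∂̄ (herm m dz_I ∧ dz̄_J)`. -/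
def insertIdx {s t : ℕ} (q : MultiIdx s × MultiIdx t) (m : Multiset Mode)
    (j : {x // x ∈ leftModes m \ q.2.1}) : MultiIdx s × MultiIdx (t + 1) :=
  (q.1, ⟨insert j.1 q.2.1, by
    rw [Finset.card_insert_of_notMem (Finset.mem_sdiff.1 j.2).2, q.2.2]⟩)

theorem insertIdx_injective {s t : ℕ} (q : MultiIdx s × MultiIdx t) (m : Multiset Mode) :
    Function.Injective (insertIdx q m) := by
  intro j k h
  have h1 : insert j.1 q.2.1 = insert k.1 q.2.1 := congrArg (fun p => p.2.1) h
  have h2 : j.1 ∈ insert k.1 q.2.1 := h1 ▸ Finset.mem_insert_self _ _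
  exact Subtype.ext ((Finset.mem_insert.1 h2).resolve_right (Finset.mem_sdiff.1 j.2).2)

/-- The coefficients of `∂̄ (herm m dz_I ∧ dz̄_J)`. -/
def hermDbar (a : ℕ → ℝ) (r : ℝ) {s t : ℕ} (q : MultiIdx s × MultiIdx t) (m : Multiset Mode)
    (p : MultiIdx s × MultiIdx (t + 1)) : MvPolynomial Mode ℂ :=
  (-1 : ℂ) ^ s • ∑ i ∈ p.2.1.attach,
      epsSign i.1 (p.2.1.erase i.1) p.2.1 • MvPolynomial.pderiv (Sum.inl i.1)
        ((Pi.single q (herm a r m) : MultiIdx s × MultiIdx t → MvPolynomial Mode ℂ)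
          (p.1, ⟨p.2.1.erase i.1, by rw [Finset.card_erase_of_mem i.2, p.2.2]; rfl⟩))

theorem hermDbar_eq_zero (a : ℕ → ℝ) (r : ℝ) {s t : ℕ} (q : MultiIdx s × MultiIdx t)
    (m : Multiset Mode) (p : MultiIdx s × MultiIdx (t + 1))
    (hp : p ∉ Finset.univ.image (insertIdx q m)) : hermDbar a r q m p = 0 := by
  unfold hermDbar
  rw [Finset.sum_eq_zero, smul_zero]
  intro i _
  rw [Pi.single_apply]
  split_ifs with h
  · subst h
    rw [pderiv_herm]
    by_cases hi : Sum.inl i.1 ∈ m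
    · have hi' : i.1 ∈ leftModes m \ p.2.1.erase i.1 := by simp [mem_leftModes, hi]
      refine absurd (Finset.mem_image.2 ⟨⟨i.1, hi'⟩, Finset.mem_univ _, ?_⟩) hp
      exact Prod.ext_iff.2 ⟨rfl, Subtype.ext (Finset.insert_erase i.2)⟩
    · rw [Multiset.count_eq_zero_of_notMem hi]
      simp
  · simp

theorem epsSign_erase_insert {j : ℕ} {J : Finset ℕ} (hj : j ∉ J) :
    epsSign j J (insert j J) = (-1) ^ (J.filter (· < j)).card := by
  simp [epsSign, hj]

theorem hermDbar_insertIdx (a : ℕ → ℝ) (r : ℝ) {s t : ℕ} (q : MultiIdx s × MultiIdx t)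
    (m : Multiset Mode) (j : {x // x ∈ leftModes m \ q.2.1}) :
    hermDbar a r q m (insertIdx q m j) = ((-1 : ℂ) ^ s * (epsSign j.1 q.2.1 (insert j.1 q.2.1) *
      ((m.count (Sum.inl j.1) : ℂ) * modeConst a r (Sum.inl j.1)))) • herm a r (m.erase (Sum.inl j.1)) := by
  have hj := (Finset.mem_sdiff.1 j.2).2
  unfold hermDbar
  rw [mul_smul]
  congr 1
  rw [Finset.sum_eq_single ⟨j.1, Finset.mem_insert_self _ _⟩]
  · have h1 : (insertIdx q m j).2.1.erase j.1 = q.2.1 := Finset.erase_insert hj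
    rw [Pi.single_apply, if_pos, pderiv_herm, smul_smul, h1]
    · rfl
    · exact Prod.ext_iff.2 ⟨rfl, Subtype.ext h1⟩
  · intro i _ hi
    rw [Pi.single_apply, if_neg, map_zero, smul_zero]
    intro h
    have h1 : (insert j.1 q.2.1).erase i.1 = q.2.1 := congrArg (fun p => p.2.1) h
    have hne : j.1 ≠ i.1 := fun e => hi (Subtype.ext e.symm)
    have h2 : j.1 ∈ (insert j.1 q.2.1).erase i.1 :=
      Finset.mem_erase.2 ⟨hne, Finset.mem_insert_self _ _⟩
    rw [h1] at h2
    exact hj h2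
  · intro h
    exact absurd (Finset.mem_attach _ _) h

theorem isWeakDbar_hermForm {a : ℕ → ℝ} (ha : ∀ i, 0 < a i) {r : ℝ} (hr : 0 < r)
    (hsum : Summable fun i => a i ^ 2) {s t : ℕ} (q : MultiIdx s × MultiIdx t) (m : Multiset Mode) :
    IsWeakDbar a r (hermForm a r hsum q m) (polyForm a r hsum (hermDbar a r q m)
      (Finset.univ.image (insertIdx q m)) (hermDbar_eq_zero a r q m)) :=
  isWeakDbar_polyForm ha hr hsum _ _ _ _ _ _ fun _ _ => rfl

/-- The forms `herm m dz_I ∧ dz̄_J` are total. -/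
theorem eq_zero_of_inner_hermForm {a : ℕ → ℝ} (ha : ∀ i, 0 < a i) {r : ℝ} (hr : 0 < r)
    (hsum : Summable fun i => a i ^ 2) {s t : ℕ} (f : L2Form a r s t)
    (h : ∀ q m, inner ℂ (hermForm a r hsum q m) f = 0) : f = 0 := by
  have h1 : ∀ q m, hermCoeff a r (f q) m = 0 := fun q m => by
    have := h q m
    rw [inner_hermForm ha] at this
    exact (mul_eq_zero.1 this).resolve_left (by exact_mod_cast (weight_pos ha q).ne')
  have h2 : ∀ q, ‖f q‖ ^ 2 = 0 := fun q => by
    have := hasSum_component ha hr hsum f q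
    simp only [h1] at this
    simp only [norm_zero, ne_eq, OfNat.ofNat_ne_zero, not_false_eq_true, zero_pow, zero_div,
      mul_zero] at this
    exact this.unique hasSum_zero
  have h3 := hasSum_norm_sq_form f
  simp only [h2] at h3
  have := h3.unique hasSum_zero
  simpa using this

theorem dense_dbar_domain {a : ℕ → ℝ} (ha : ∀ i, 0 < a i) {r : ℝ} (hr : 0 < r)
    (hsum : Summable fun i => a i ^ 2) (s t : ℕ) :
    Dense ((dbar a ha r s t).domain : Set (L2Form a r s t)) := by
  rw [Submodule.dense_iff_topologicalClosure_eq_top, Submodule.topologicalClosure_eq_top_iff,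
    Submodule.eq_bot_iff]
  intro f hf
  refine eq_zero_of_inner_hermForm ha hr hsum f fun q m => ?_
  exact (Submodule.mem_orthogonal _ _).1 hf _
    (dbar_apply_of_isWeakDbar ha (isWeakDbar_hermForm ha hr hsum q m)).1

/-- The Hermite coefficients of the adjoint of `∂̄`, found by pairing with `∂̄ (herm m dz_I ∧ dz̄_J)`. The
weight ratio `a_j²` cancels against the commutator constant `1 / (2 r² a_j²)`. -/
theorem hermCoeff_adjoint {a : ℕ → ℝ} (ha : ∀ i, 0 < a i) {r : ℝ} (hr : 0 < r)
    (hsum : Summable fun i => a i ^ 2) {s t : ℕ} (f : (dbar a ha r s t).adjoint.domain)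
    (q : MultiIdx s × MultiIdx t) (m : Multiset Mode) :
    hermCoeff a r ((dbar a ha r s t).adjoint f q) m
      = ((-1) ^ s / (2 * r ^ 2)) * ∑ j : {x // x ∈ leftModes m \ q.2.1},
        epsSign j.1 q.2.1 (insert j.1 q.2.1) * (m.count (Sum.inl j.1) *
          hermCoeff a r ((f : L2Form a r s (t + 1)) (insertIdx q m j)) (m.erase (Sum.inl j.1))) := by
  obtain ⟨hm, hT⟩ := dbar_apply_of_isWeakDbar ha (isWeakDbar_hermForm ha hr hsum q m)
  have h1 := LinearPMap.adjoint_isFormalAdjoint (dense_dbar_domain ha hr hsum s t) f ⟨_, hm⟩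
  rw [hT] at h1
  have h2 := congrArg conj h1
  rw [inner_conj_symm, inner_conj_symm, inner_hermForm ha, inner_polyForm ha,
    Finset.sum_image fun _ _ _ _ h => insertIdx_injective q m h] at h2
  have hw : (weight a q : ℂ) ≠ 0 := by exact_mod_cast (weight_pos ha q).ne'
  have hr' : (r : ℂ) ≠ 0 := by exact_mod_cast hr.ne'
  refine mul_left_cancel₀ hw (h2.trans ?_)
  rw [Finset.mul_sum, Finset.mul_sum]
  refine Finset.sum_congr rfl fun j _ => ?_
  have hj := (Finset.mem_sdiff.1 j.2).2
  have ha' : (a j.1 : ℂ) ≠ 0 := by exact_mod_cast (ha j.1).ne'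
  have hwj : (weight a (insertIdx q m j) : ℂ) = weight a q * a j.1 ^ 2 := by
    simp only [weight, insertIdx, Finset.prod_insert hj]
    push_cast; ring
  rw [hermDbar_insertIdx, epsSign_erase_insert hj, hwj]
  simp only [evalAt_smul, map_mul, map_pow, map_neg, map_one, map_natCast, Complex.conj_ofReal]
  have : ∀ z, (f : L2Form a r s (t + 1)) (insertIdx q m j) z * ((-1) ^ s * ((-1) ^ (q.2.1.filter (· < j.1)).card
        * ((m.count (Sum.inl j.1) : ℂ) * modeConst a r (Sum.inl j.1)))
        * conj (evalAt (herm a r (m.erase (Sum.inl j.1))) z))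
      = ((-1) ^ s * ((-1) ^ (q.2.1.filter (· < j.1)).card
        * ((m.count (Sum.inl j.1) : ℂ) * modeConst a r (Sum.inl j.1))))
        * ((f : L2Form a r s (t + 1)) (insertIdx q m j) z * conj (evalAt (herm a r (m.erase (Sum.inl j.1))) z)) :=
    fun z => by ring
  simp only [this]
  rw [integral_const_mul]
  simp only [hermCoeff, modeConst, Sum.elim_inl, id]
  push_cast
  field_simp

/-! ### Contraction and exterior multiplication on a finite block -/

theorem sum_powerset_insert {M : Type*} [AddCommMonoid M] {A : Finset ℕ} {i : ℕ} (hi : i ∈ A)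
    (h : Finset ℕ → M) :
    ∑ J ∈ A.powerset with i ∉ J, h (insert i J) = ∑ K ∈ A.powerset with i ∈ K, h K := by
  refine Finset.sum_nbij' (fun J => insert i J) (fun K => K.erase i) ?_ ?_ ?_ ?_ ?_
  · intro J hJ
    simp only [Finset.mem_filter, Finset.mem_powerset] at hJ ⊢
    exact ⟨Finset.insert_subset hi hJ.1, Finset.mem_insert_self _ _⟩
  · intro K hK
    simp only [Finset.mem_filter, Finset.mem_powerset] at hK ⊢
    exact ⟨(Finset.erase_subset _ _).trans hK.1, Finset.notMem_erase _ _⟩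
  · intro J hJ
    exact Finset.erase_insert (Finset.mem_filter.1 hJ).2
  · intro K hK
    exact Finset.insert_erase (Finset.mem_filter.1 hK).2
  · intro J _; rfl

theorem sum_powerset_insert_insert {M : Type*} [AddCommMonoid M] {A : Finset ℕ} {i j : ℕ} (hi : i ∈ A)
    (hj : j ∈ A) (hij : i ≠ j) (h : Finset ℕ → M) :
    ∑ J ∈ A.powerset with i ∉ J ∧ j ∉ J, h (insert i (insert j J))
      = ∑ K ∈ A.powerset with i ∈ K ∧ j ∈ K, h K := by
  refine Finset.sum_nbij' (fun J => insert i (insert j J)) (fun K => (K.erase i).erase j) ?_ ?_ ?_ ?_ ?_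
  · intro J hJ
    simp only [Finset.mem_filter, Finset.mem_powerset] at hJ ⊢
    exact ⟨Finset.insert_subset hi (Finset.insert_subset hj hJ.1), by simp, by simp⟩
  · intro K hK
    simp only [Finset.mem_filter, Finset.mem_powerset] at hK ⊢
    exact ⟨((Finset.erase_subset _ _).trans (Finset.erase_subset _ _)).trans hK.1, by simp, by simp⟩
  · intro J hJ
    have h := (Finset.mem_filter.1 hJ).2
    rw [Finset.erase_insert (by simp [hij, h.1]), Finset.erase_insert h.2]
  · intro K hK
    have h := (Finset.mem_filter.1 hK).2
    rw [Finset.insert_erase (Finset.mem_erase.2 ⟨hij.symm, h.2⟩), Finset.insert_erase h.1]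
  · intro J _; rfl

/-- The sign of the permutation that sorts `(j, j_1, …, j_t)`, where `J = {j_1 < … < j_t}`. -/
def insSign (j : ℕ) (J : Finset ℕ) : ℂ := (-1) ^ (J.filter (· < j)).card

theorem insSign_mul_self (j : ℕ) (J : Finset ℕ) : insSign j J * insSign j J = 1 := by
  rw [insSign, ← mul_pow]; simp

theorem conj_insSign (j : ℕ) (J : Finset ℕ) : conj (insSign j J) = insSign j J := by
  simp [insSign]

theorem insSign_insert {i j : ℕ} {J : Finset ℕ} (hj : j ∉ J) :
    insSign i (insert j J) = (if j < i then -1 else 1) * insSign i J := by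
  unfold insSign
  rw [Finset.filter_insert]
  split_ifs with h
  · rw [Finset.card_insert_of_notMem (by simp [hj]), pow_succ]; ring
  · simp

theorem insSign_anticomm {i j : ℕ} {J : Finset ℕ} (hij : i ≠ j) (hi : i ∉ J) (hj : j ∉ J) :
    insSign i (insert j J) * insSign j (insert i J) = - (insSign i J * insSign j J) := by
  rw [insSign_insert hj, insSign_insert hi]
  rcases lt_or_gt_of_ne hij with h | h
  · simp [h, not_lt.2 h.le]
  · simp [h, not_lt.2 h.le]

/-- The identity `|e ⌟ u|² + |e ∧ u|² = |e|² |u|²` in the exterior algebra with orthogonal basis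
`e_j`, `j ∈ A`, where `|e_j|² = n_j` and `e = ∑ e_j`. It holds because the contraction is the adjoint of
the exterior multiplication and the two anticommute up to `|e|² = ∑ n_j`. -/
theorem contraction_add_wedge (A : Finset ℕ) (n : ℕ → ℂ) (hn : ∀ j, conj (n j) = n j)
    (u : Finset ℕ → ℂ) :
    ∑ J ∈ A.powerset, (∏ j ∈ J, n j) * ((∑ j ∈ A \ J, insSign j J * (n j * u (insert j J)))
        * conj (∑ j ∈ A \ J, insSign j J * (n j * u (insert j J))))
      + ∑ L ∈ A.powerset, (∏ j ∈ L, n j) * ((∑ i ∈ L, insSign i (L.erase i) * u (L.erase i))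
        * conj (∑ i ∈ L, insSign i (L.erase i) * u (L.erase i)))
      = (∑ j ∈ A, n j) * ∑ K ∈ A.powerset, (∏ j ∈ K, n j) * (u K * conj (u K)) := by
  have hF : ∑ J ∈ A.powerset, (∏ j ∈ J, n j) * ((∑ j ∈ A \ J, insSign j J * (n j * u (insert j J)))
        * conj (∑ j ∈ A \ J, insSign j J * (n j * u (insert j J))))
      = ∑ i ∈ A, ∑ j ∈ A, ∑ J ∈ A.powerset with i ∉ J ∧ j ∉ J, (∏ j ∈ J, n j) *
        (insSign i J * insSign j J * (n i * n j * (u (insert i J) * conj (u (insert j J))))) := by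
    have : ∀ J ∈ A.powerset, (∏ j ∈ J, n j) * ((∑ j ∈ A \ J, insSign j J * (n j * u (insert j J)))
        * conj (∑ j ∈ A \ J, insSign j J * (n j * u (insert j J))))
        = ∑ i ∈ A, ∑ j ∈ A, if i ∉ J ∧ j ∉ J then (∏ j ∈ J, n j) *
        (insSign i J * insSign j J * (n i * n j * (u (insert i J) * conj (u (insert j J))))) else 0 := by
      intro J _
      rw [map_sum, Finset.sum_mul_sum, Finset.mul_sum, Finset.sdiff_eq_filter, Finset.sum_filter]
      refine Finset.sum_congr rfl fun i _ => ?_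
      by_cases hi : i ∉ J
      · rw [if_pos hi, Finset.mul_sum, Finset.sum_filter]
        refine Finset.sum_congr rfl fun j _ => ?_
        by_cases hj : j ∉ J
        · rw [if_pos hj, if_pos ⟨hi, hj⟩, map_mul, map_mul, conj_insSign, hn]; ring
        · rw [if_neg hj, if_neg fun h => hj h.2]
      · rw [if_neg hi]
        exact (Finset.sum_eq_zero fun j _ => if_neg fun h => hi h.1).symm
    rw [Finset.sum_congr rfl this, Finset.sum_comm]
    refine Finset.sum_congr rfl fun i _ => ?_
    rw [Finset.sum_comm]
    exact Finset.sum_congr rfl fun j _ => (Finset.sum_filter _ _).symm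
  have hG : ∑ L ∈ A.powerset, (∏ j ∈ L, n j) * ((∑ i ∈ L, insSign i (L.erase i) * u (L.erase i))
        * conj (∑ i ∈ L, insSign i (L.erase i) * u (L.erase i)))
      = ∑ i ∈ A, ∑ j ∈ A, ∑ L ∈ A.powerset with i ∈ L ∧ j ∈ L, (∏ j ∈ L, n j) *
        (insSign j (L.erase j) * insSign i (L.erase i) * (u (L.erase j) * conj (u (L.erase i)))) := by
    have : ∀ L ∈ A.powerset, (∏ j ∈ L, n j) * ((∑ i ∈ L, insSign i (L.erase i) * u (L.erase i))
        * conj (∑ i ∈ L, insSign i (L.erase i) * u (L.erase i)))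
        = ∑ i ∈ A, ∑ j ∈ A, if i ∈ L ∧ j ∈ L then (∏ j ∈ L, n j) *
        (insSign j (L.erase j) * insSign i (L.erase i) * (u (L.erase j) * conj (u (L.erase i)))) else 0 := by
      intro L hL
      have hA : ∀ h : ℕ → ℂ, ∑ i ∈ L, h i = ∑ i ∈ A, if i ∈ L then h i else 0 := by
        intro h
        rw [← Finset.sum_filter, Finset.filter_mem_eq_inter,
          Finset.inter_eq_right.2 (Finset.mem_powerset.1 hL)]
      rw [map_sum, Finset.sum_mul_sum, Finset.mul_sum]
      simp only [Finset.mul_sum]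
      rw [Finset.sum_comm, hA]
      refine Finset.sum_congr rfl fun i _ => ?_
      split_ifs with hi
      · rw [hA]
        refine Finset.sum_congr rfl fun j _ => ?_
        by_cases hj : j ∈ L
        · rw [if_pos hj, if_pos ⟨hi, hj⟩, map_mul, conj_insSign]; ring
        · rw [if_neg hj, if_neg fun h => hj h.2]
      · exact (Finset.sum_eq_zero fun j _ => if_neg fun h => hi h.1).symm
    rw [Finset.sum_congr rfl this, Finset.sum_comm]
    refine Finset.sum_congr rfl fun i _ => ?_
    rw [Finset.sum_comm]
    exact Finset.sum_congr rfl fun j _ => (Finset.sum_filter _ _).symm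
  rw [hF, hG, ← Finset.sum_add_distrib, Finset.sum_mul]
  refine Finset.sum_congr rfl fun i hi => ?_
  rw [← Finset.sum_add_distrib, Finset.sum_eq_single i]
  · -- the diagonal terms
    simp only [and_self]
    rw [Finset.mul_sum, ← Finset.sum_filter_add_sum_filter_not A.powerset (fun K => i ∈ K)]
    congr 1
    · rw [← sum_powerset_insert hi]
      refine Finset.sum_congr rfl fun J hJ => ?_
      rw [insSign_mul_self, Finset.prod_insert (Finset.mem_filter.1 hJ).2]
      ring
    · rw [← sum_powerset_insert hi]
      refine Finset.sum_congr rfl fun J hJ => ?_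
      rw [insSign_mul_self, Finset.prod_insert (Finset.mem_filter.1 hJ).2,
        Finset.erase_insert (Finset.mem_filter.1 hJ).2]
      ring
  · -- the off-diagonal terms cancel by the anticommutation of the signs
    intro j hj hji
    rw [← sum_powerset_insert_insert hi hj hji.symm, ← Finset.sum_add_distrib]
    refine Finset.sum_eq_zero fun J hJ => ?_
    have h := (Finset.mem_filter.1 hJ).2
    have e1 : (insert i (insert j J)).erase i = insert j J :=
      Finset.erase_insert (by simp [hji.symm, h.1])
    have e2 : (insert i (insert j J)).erase j = insert i J := by
      rw [Finset.insert_comm]; exact Finset.erase_insert (by simp [hji, h.2])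
    rw [e1, e2, mul_comm (insSign j (insert i J)), insSign_anticomm hji.symm h.1 h.2,
      Finset.prod_insert (by simp [hji.symm, h.1]), Finset.prod_insert h.2]
    ring
  · exact fun h => absurd hi h

/-- The estimate on a single block, where the operators are finite matrices. The constant `t + 1` arises
from `∑_{j ∈ A} n_j ≥ |A| ≥ t + 1`, which holds unless `u` vanishes on the subsets of `A`. -/
theorem block_estimate (A : Finset ℕ) (n : ℕ → ℕ) (hn : ∀ j ∈ A, 1 ≤ n j) {ρ : ℝ} (hρ : 0 ≤ ρ)
    {D : Finset ℕ → ℝ} (hD0 : 0 ≤ D ∅)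
    (hD : ∀ K ⊆ A, ∀ j ∈ A \ K, D (insert j K) = n j * ρ * D K) (t : ℕ)
    {u : Finset ℕ → ℂ} (hu : ∀ K, K.card ≠ t + 1 → u K = 0) :
    ρ * (t + 1) * ∑ K ∈ A.powerset, D K * ‖u K‖ ^ 2
      ≤ ∑ J ∈ A.powerset, D J * ‖(ρ : ℂ) * ∑ j ∈ A \ J, insSign j J * (n j * u (insert j J))‖ ^ 2
        + ∑ L ∈ A.powerset, D L * ‖∑ i ∈ L, insSign i (L.erase i) * u (L.erase i)‖ ^ 2 := by
  -- the weights are those of the exterior algebra up to a factor depending on the degree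
  have hDK : ∀ K ⊆ A, D K = D ∅ * ((∏ j ∈ K, (n j : ℝ)) * ρ ^ K.card) := by
    intro K
    induction K using Finset.induction_on with
    | empty => simp
    | insert j K hj ih =>
      intro hK
      have hK' := (Finset.subset_insert j K).trans hK
      rw [hD K hK' j (Finset.mem_sdiff.2 ⟨hK (Finset.mem_insert_self _ _), hj⟩), ih hK',
        Finset.prod_insert hj, Finset.card_insert_of_notMem hj, pow_succ]
      ring
  -- the identity of the exterior algebra, in real form
  have key : ∑ J ∈ A.powerset, (∏ j ∈ J, (n j : ℝ))
        * ‖∑ j ∈ A \ J, insSign j J * (n j * u (insert j J))‖ ^ 2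
      + ∑ L ∈ A.powerset, (∏ j ∈ L, (n j : ℝ)) * ‖∑ i ∈ L, insSign i (L.erase i) * u (L.erase i)‖ ^ 2
      = (∑ j ∈ A, (n j : ℝ)) * ∑ K ∈ A.powerset, (∏ j ∈ K, (n j : ℝ)) * ‖u K‖ ^ 2 := by
    have h := contraction_add_wedge A (fun j => (n j : ℂ)) (fun j => by simp) u
    simp only [Complex.mul_conj'] at h
    exact_mod_cast h
  have e1 : ∀ J ∈ A.powerset, D J * ‖(ρ : ℂ) * ∑ j ∈ A \ J, insSign j J * (n j * u (insert j J))‖ ^ 2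
      = D ∅ * ρ ^ (t + 2) * ((∏ j ∈ J, (n j : ℝ))
        * ‖∑ j ∈ A \ J, insSign j J * (n j * u (insert j J))‖ ^ 2) := by
    intro J hJ
    by_cases hJt : J.card = t
    · rw [hDK J (Finset.mem_powerset.1 hJ), hJt, norm_mul, Complex.norm_real, mul_pow,
        Real.norm_eq_abs, sq_abs]
      ring
    · have : ∑ j ∈ A \ J, insSign j J * (n j * u (insert j J)) = 0 := by
        refine Finset.sum_eq_zero fun j hj => ?_
        rw [hu, mul_zero, mul_zero]
        rw [Finset.card_insert_of_notMem (Finset.mem_sdiff.1 hj).2]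
        omega
      rw [this]; simp
  have e2 : ∀ L ∈ A.powerset, D L * ‖∑ i ∈ L, insSign i (L.erase i) * u (L.erase i)‖ ^ 2
      = D ∅ * ρ ^ (t + 2) * ((∏ j ∈ L, (n j : ℝ))
        * ‖∑ i ∈ L, insSign i (L.erase i) * u (L.erase i)‖ ^ 2) := by
    intro L hL
    by_cases hLt : L.card = t + 2
    · rw [hDK L (Finset.mem_powerset.1 hL), hLt]; ring
    · have : ∑ i ∈ L, insSign i (L.erase i) * u (L.erase i) = 0 := by
        refine Finset.sum_eq_zero fun i hi => ?_
        rw [hu, mul_zero]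
        rw [Finset.card_erase_of_mem hi]
        have := Finset.card_pos.2 ⟨i, hi⟩
        omega
      rw [this]; simp
  have e3 : ∀ K ∈ A.powerset, D K * ‖u K‖ ^ 2
      = D ∅ * ρ ^ (t + 1) * ((∏ j ∈ K, (n j : ℝ)) * ‖u K‖ ^ 2) := by
    intro K hK
    by_cases hKt : K.card = t + 1
    · rw [hDK K (Finset.mem_powerset.1 hK), hKt]; ring
    · rw [hu K hKt]; simp
  rw [Finset.sum_congr rfl e1, Finset.sum_congr rfl e2, Finset.sum_congr rfl e3, ← Finset.mul_sum,
    ← Finset.mul_sum, ← Finset.mul_sum, ← mul_add, key]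
  by_cases hA : t + 1 ≤ A.card
  · have h1 : ((t : ℝ) + 1) ≤ ∑ j ∈ A, (n j : ℝ) := by
      have h2 : A.card ≤ ∑ j ∈ A, n j := by
        simpa using Finset.card_nsmul_le_sum A n 1 hn
      exact_mod_cast hA.trans h2
    have h3 : 0 ≤ ∑ K ∈ A.powerset, (∏ j ∈ K, (n j : ℝ)) * ‖u K‖ ^ 2 := by positivity
    calc _ = D ∅ * ρ ^ (t + 2) * ((t + 1) * ∑ K ∈ A.powerset, (∏ j ∈ K, (n j : ℝ)) * ‖u K‖ ^ 2) := by
          ring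
      _ ≤ _ := by gcongr
  · have : ∑ K ∈ A.powerset, (∏ j ∈ K, (n j : ℝ)) * ‖u K‖ ^ 2 = 0 := by
      refine Finset.sum_eq_zero fun K hK => ?_
      have := Finset.card_le_card (Finset.mem_powerset.1 hK)
      rw [hu K (by omega)]; simp
    rw [this]; simp

/-! ### Decomposition of forms into blocks -/

/-- The Hermite coefficients of the component `f_{I,K}` of a form, extended by zero to sets `K` of the
wrong cardinality. -/
def formCoeff (a : ℕ → ℝ) (r : ℝ) {s t : ℕ} (f : L2Form a r s t) (I : MultiIdx s) (K : Finset ℕ)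
    (m : Multiset Mode) : ℂ :=
  if h : K.card = t then hermCoeff a r (f (I, ⟨K, h⟩)) m else 0

theorem formCoeff_of_card_ne (a : ℕ → ℝ) (r : ℝ) {s t : ℕ} (f : L2Form a r s t) (I : MultiIdx s)
    {K : Finset ℕ} (h : K.card ≠ t) (m : Multiset Mode) : formCoeff a r f I K m = 0 :=
  dif_neg h

/-- The multiset of the modes `z̄_j` with `j ∈ K`. -/
def barModes (K : Finset ℕ) : Multiset Mode := K.val.map Sum.inl

theorem nodup_barModes (K : Finset ℕ) : (barModes K).Nodup :=
  K.nodup.map Sum.inl_injective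

theorem mem_barModes {K : Finset ℕ} {j : ℕ} : Sum.inl j ∈ barModes K ↔ j ∈ K := by
  simp [barModes]

theorem barModes_le {K : Finset ℕ} {Γ : Multiset Mode} : barModes K ≤ Γ ↔ K ⊆ leftModes Γ := by
  rw [Multiset.le_iff_subset (nodup_barModes K)]
  constructor
  · intro h j hj
    exact mem_leftModes.2 (h (mem_barModes.2 hj))
  · intro h x hx
    obtain ⟨j, hj, rfl⟩ := Multiset.mem_map.1 hx
    exact mem_leftModes.1 (h hj)

theorem barModes_insert {j : ℕ} {K : Finset ℕ} (hj : j ∉ K) :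
    barModes (insert j K) = Sum.inl j ::ₘ barModes K := by
  rw [barModes, Finset.insert_val_of_notMem hj, Multiset.map_cons]; rfl

theorem erase_sub_barModes {j : ℕ} {K : Finset ℕ} (hj : j ∉ K) (Γ : Multiset Mode) :
    (Γ - barModes K).erase (Sum.inl j) = Γ - barModes (insert j K) := by
  rw [barModes_insert hj, Multiset.sub_cons, ← Multiset.sub_singleton, ← Multiset.sub_singleton,
    tsub_right_comm]

theorem count_sub_barModes {j : ℕ} {K : Finset ℕ} (hj : j ∉ K) (Γ : Multiset Mode) :
    (Γ - barModes K).count (Sum.inl j) = Γ.count (Sum.inl j) := by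
  rw [Multiset.count_sub, Multiset.count_eq_zero_of_notMem (fun h => hj (mem_barModes.1 h))]
  rfl

theorem cons_sub_barModes {j : ℕ} {K : Finset ℕ} {Γ : Multiset Mode} (hj : j ∈ leftModes Γ)
    (hjK : j ∉ K) : Sum.inl j ::ₘ (Γ - barModes (insert j K)) = Γ - barModes K := by
  rw [← erase_sub_barModes hjK, Multiset.cons_erase]
  rw [← Multiset.count_pos, count_sub_barModes hjK, Multiset.count_pos]
  exact mem_leftModes.1 hj

/-- The weight with which `|f_{I,K}|²` enters the norm on the block of total mode content `Γ`; the
factor coming from `I` is left out. -/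
def blockWeight (a : ℕ → ℝ) (r : ℝ) (Γ : Multiset Mode) (K : Finset ℕ) : ℝ :=
  (∏ j ∈ K, a j ^ 2) / hermNorm a r (Γ - barModes K)

theorem blockWeight_nonneg {a : ℕ → ℝ} (ha : ∀ i, 0 < a i) {r : ℝ} (hr : 0 < r)
    (hsum : Summable fun i => a i ^ 2) (Γ : Multiset Mode) (K : Finset ℕ) :
    0 ≤ blockWeight a r Γ K :=
  div_nonneg (Finset.prod_nonneg fun _ _ => sq_nonneg _) (hermNorm_pos ha hr hsum _).le

theorem blockWeight_insert {a : ℕ → ℝ} (ha : ∀ i, 0 < a i) {r : ℝ} (hr : 0 < r)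
    (hsum : Summable fun i => a i ^ 2) {Γ : Multiset Mode} {j : ℕ} {K : Finset ℕ}
    (hj : j ∈ leftModes Γ) (hjK : j ∉ K) :
    blockWeight a r Γ (insert j K)
      = (Γ.count (Sum.inl j) : ℕ) * (1 / (2 * r ^ 2)) * blockWeight a r Γ K := by
  have h1 : hermNorm a r (Γ - barModes K) = Γ.count (Sum.inl j) * modeConst a r (Sum.inl j)
      * hermNorm a r (Γ - barModes (insert j K)) := by
    conv_lhs => rw [← cons_sub_barModes hj hjK]
    rw [hermNorm_cons ha hr hsum, ← count_sub_barModes hjK Γ, ← cons_sub_barModes hj hjK,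
      Multiset.count_cons_self]
    push_cast; ring
  have h2 := hermNorm_pos ha hr hsum (Γ - barModes (insert j K))
  have h3 : (Γ.count (Sum.inl j) : ℝ) ≠ 0 := by
    exact_mod_cast (Multiset.count_pos.2 (mem_leftModes.1 hj)).ne'
  have h4 := (ha j).ne'
  unfold blockWeight
  rw [h1, Finset.prod_insert hjK]
  simp only [modeConst, Sum.elim_inl, id]
  field_simp

/-- Parseval's identity for forms, arranged in blocks: the coefficients `(K, m)` are grouped
according to the total mode content `Γ = m + K`, which `∂̄` and its adjoint preserve. -/
theorem ofReal_norm_sq_form {a : ℕ → ℝ} (ha : ∀ i, 0 < a i) {r : ℝ} (hr : 0 < r)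
    (hsum : Summable fun i => a i ^ 2) {s t : ℕ} (f : L2Form a r s t) :
    ENNReal.ofReal (‖f‖ ^ 2) = ∑' (I : MultiIdx s) (Γ : Multiset Mode),
      ENNReal.ofReal ((∏ i ∈ I.1, a i ^ 2) * ∑ K ∈ (leftModes Γ).powerset,
        blockWeight a r Γ K * ‖formCoeff a r f I K (Γ - barModes K)‖ ^ 2) := by
  have hw : ∀ I : MultiIdx s, 0 ≤ ∏ i ∈ I.1, a i ^ 2 := fun I =>
    Finset.prod_nonneg fun _ _ => sq_nonneg _
  let F : MultiIdx s → Finset ℕ → Multiset Mode → ENNReal := fun I K m =>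
    ENNReal.ofReal ((∏ i ∈ I.1, a i ^ 2) *
      ((∏ j ∈ K, a j ^ 2) / hermNorm a r m * ‖formCoeff a r f I K m‖ ^ 2))
  have e1 : ∀ p : MultiIdx s × MultiIdx t, ENNReal.ofReal (‖f p‖ ^ 2) = ∑' m, F p.1 p.2.1 m := by
    intro p
    have h := hasSum_component ha hr hsum f p
    rw [← h.tsum_eq, ENNReal.ofReal_tsum_of_nonneg _ h.summable]
    · refine tsum_congr fun m => ?_
      simp only [F, formCoeff, dif_pos p.2.2, weight]
      congr 1
      ring
    · exact fun m => mul_nonneg (weight_pos ha p).le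
        (div_nonneg (sq_nonneg _) (hermNorm_pos ha hr hsum m).le)
  have e2 : ∀ I K, ∑' m, F I K m
      = ∑' Γ, if K ∈ (leftModes Γ).powerset then F I K (Γ - barModes K) else 0 := by
    intro I K
    rw [← (add_left_injective (barModes K)).tsum_eq
      (f := fun Γ => if K ∈ (leftModes Γ).powerset then F I K (Γ - barModes K) else 0)]
    · refine tsum_congr fun m => ?_
      rw [if_pos (Finset.mem_powerset.2 (barModes_le.1 (Multiset.le_add_left _ _))),
        Multiset.add_sub_cancel_right]
    · intro Γ hΓ
      have h : K ∈ (leftModes Γ).powerset := by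
        by_contra h
        exact hΓ (if_neg h)
      exact ⟨Γ - barModes K, Multiset.sub_add_cancel (barModes_le.2 (Finset.mem_powerset.1 h))⟩
  have h0 := hasSum_norm_sq_form f
  rw [← h0.tsum_eq, ENNReal.ofReal_tsum_of_nonneg (fun p => sq_nonneg _) h0.summable,
    tsum_congr e1, ENNReal.tsum_prod (f := fun I (K : MultiIdx t) => ∑' m, F I K.1 m)]
  refine tsum_congr fun I => ?_
  rw [Subtype.val_injective.tsum_eq (f := fun K => ∑' m, F I K m)]
  · rw [tsum_congr (e2 I), ENNReal.tsum_comm]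
    refine tsum_congr fun Γ => ?_
    rw [tsum_eq_sum (s := (leftModes Γ).powerset) fun K hK => if_neg hK, Finset.mul_sum,
      ENNReal.ofReal_sum_of_nonneg]
    · exact Finset.sum_congr rfl fun K hK => if_pos hK
    · exact fun K _ => mul_nonneg (hw I) (mul_nonneg (blockWeight_nonneg ha hr hsum _ _)
        (sq_nonneg _))
  · intro K hK
    by_contra h
    refine hK (ENNReal.tsum_eq_zero.2 fun m => ?_)
    have : K.card ≠ t := fun hc => h ⟨⟨K, hc⟩, rfl⟩
    simp [F, formCoeff_of_card_ne a r f I this]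

/-- On a block the adjoint of `∂̄` acts as a contraction. -/
theorem formCoeff_adjoint {a : ℕ → ℝ} (ha : ∀ i, 0 < a i) {r : ℝ} (hr : 0 < r)
    (hsum : Summable fun i => a i ^ 2) {s t : ℕ} (f : (dbar a ha r s t).adjoint.domain)
    (I : MultiIdx s) (Γ : Multiset Mode) (J : Finset ℕ) :
    formCoeff a r ((dbar a ha r s t).adjoint f) I J (Γ - barModes J)
      = (-1) ^ s * (((1 / (2 * r ^ 2) : ℝ) : ℂ) * ∑ j ∈ leftModes Γ \ J, insSign j J *
        (Γ.count (Sum.inl j) * formCoeff a r (f : L2Form a r s (t + 1)) I (insert j J)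
          (Γ - barModes (insert j J)))) := by
  by_cases hJ : J.card = t
  · rw [formCoeff, dif_pos hJ, hermCoeff_adjoint ha hr hsum]
    have hA : leftModes (Γ - barModes J) \ J = leftModes Γ \ J := by
      ext j
      simp only [Finset.mem_sdiff, and_congr_left_iff]
      intro hj
      rw [mem_leftModes, mem_leftModes, ← Multiset.count_pos, count_sub_barModes hj,
        Multiset.count_pos]
    rw [← hA, ← Finset.sum_coe_sort (leftModes (Γ - barModes J) \ J) fun j => insSign j J *
      (Γ.count (Sum.inl j) * formCoeff a r (f : L2Form a r s (t + 1)) I (insert j J)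
        (Γ - barModes (insert j J))), ← mul_assoc]
    congr 1
    · push_cast; ring
    · refine Finset.sum_congr rfl fun j _ => ?_
      have hj := (Finset.mem_sdiff.1 j.2).2
      have hc : (insert j.1 J).card = t + 1 := by rw [Finset.card_insert_of_notMem hj, hJ]
      rw [epsSign_erase_insert hj, count_sub_barModes hj, erase_sub_barModes hj, formCoeff,
        dif_pos hc]
      rfl
  · rw [formCoeff_of_card_ne _ _ _ _ hJ, Finset.sum_eq_zero, mul_zero, mul_zero]
    intro j hj
    rw [formCoeff_of_card_ne, mul_zero, mul_zero]
    rw [Finset.card_insert_of_notMem (Finset.mem_sdiff.1 hj).2]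
    omega

/-- On a block `∂̄` acts as an exterior multiplication. -/
theorem formCoeff_dbar {a : ℕ → ℝ} (ha : ∀ i, 0 < a i) {r : ℝ}
    (hsum : Summable fun i => a i ^ 2) {s t : ℕ} {f : L2Form a r s t} {g : L2Form a r s (t + 1)}
    (h : IsWeakDbar a r f g) (I : MultiIdx s) {Γ : Multiset Mode} {L : Finset ℕ}
    (hL : L ⊆ leftModes Γ) :
    (-1) ^ s * formCoeff a r g I L (Γ - barModes L)
      = ∑ i ∈ L, insSign i (L.erase i) * formCoeff a r f I (L.erase i) (Γ - barModes (L.erase i)) := by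
  by_cases hc : L.card = t + 1
  · rw [formCoeff, dif_pos hc, hermCoeff, h.poly ha hsum I ⟨L, hc⟩, ← Finset.sum_attach L]
    refine Finset.sum_congr rfl fun i _ => ?_
    have hi : i.1 ∉ L.erase i.1 := Finset.notMem_erase _ _
    have hc' : (L.erase i.1).card = t := by rw [Finset.card_erase_of_mem i.2, hc]; rfl
    have e := cons_sub_barModes (hL i.2) hi
    have e' := epsSign_erase_insert hi
    rw [Finset.insert_erase i.2] at e e'
    rw [← herm_cons, e, formCoeff, dif_pos hc', e']
    rfl
  · rw [formCoeff_of_card_ne _ _ _ _ hc, mul_zero, Finset.sum_eq_zero]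
    intro i hi
    rw [formCoeff_of_card_ne, mul_zero]
    rw [Finset.card_erase_of_mem hi]
    have := Finset.card_pos.2 ⟨i, hi⟩
    omega

theorem mainTheorem2 (a : ℕ → ℝ) (ha : ∀ i, 0 < a i) (hsum : Summable a) (r : ℝ) (hr : 0 < r)
    (s t : ℕ) (f : L2Form a r s (t + 1)) (hS : f ∈ (dbar a ha r s (t + 1)).domain)
    (hT : f ∈ (dbar a ha r s t).adjoint.domain) :
    ((t : ℝ) + 1) / (2 * r ^ 2) * ‖f‖ ^ 2
      ≤ ‖(dbar a ha r s t).adjoint ⟨f, hT⟩‖ ^ 2 + ‖dbar a ha r s (t + 1) ⟨f, hS⟩‖ ^ 2 := by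
  have hsum2 : Summable fun i => a i ^ 2 := by
    refine hsum.of_norm_bounded_eventually_nat ?_
    filter_upwards [hsum.tendsto_atTop_zero.eventually_le_const one_pos] with i hi
    rw [Real.norm_of_nonneg (sq_nonneg _), sq]
    exact mul_le_of_le_one_right (ha i).le hi
  have hρ : 0 ≤ 1 / (2 * r ^ 2) := by positivity
  have hc : ((t : ℝ) + 1) / (2 * r ^ 2) = 1 / (2 * r ^ 2) * (t + 1) := by ring
  have hn1 : ‖(-1 : ℂ) ^ s‖ = 1 := by simp
  rw [hc, ← ENNReal.ofReal_le_ofReal_iff (by positivity), ENNReal.ofReal_mul (by positivity),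
    ENNReal.ofReal_add (sq_nonneg _) (sq_nonneg _), ofReal_norm_sq_form ha hr hsum2,
    ofReal_norm_sq_form ha hr hsum2, ofReal_norm_sq_form ha hr hsum2, ← ENNReal.tsum_mul_left,
    ← ENNReal.tsum_add]
  refine ENNReal.tsum_le_tsum fun I => ?_
  rw [← ENNReal.tsum_mul_left, ← ENNReal.tsum_add]
  refine ENNReal.tsum_le_tsum fun Γ => ?_
  have hw : 0 ≤ ∏ i ∈ I.1, a i ^ 2 := Finset.prod_nonneg fun _ _ => sq_nonneg _
  have hN : ∀ {t' : ℕ} (g : L2Form a r s t'), 0 ≤ ∑ K ∈ (leftModes Γ).powerset,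
      blockWeight a r Γ K * ‖formCoeff a r g I K (Γ - barModes K)‖ ^ 2 := fun g =>
    Finset.sum_nonneg fun K _ => mul_nonneg (blockWeight_nonneg ha hr hsum2 _ _) (sq_nonneg _)
  rw [← ENNReal.ofReal_mul (by positivity), ← ENNReal.ofReal_add (mul_nonneg hw (hN _))
    (mul_nonneg hw (hN _)), ← mul_add, mul_left_comm]
  refine ENNReal.ofReal_le_ofReal (mul_le_mul_of_nonneg_left ?_ hw)
  refine (block_estimate (leftModes Γ) (fun j => Γ.count (Sum.inl j))
    (fun j hj => Multiset.count_pos.2 (mem_leftModes.1 hj)) hρ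
    (D := blockWeight a r Γ) (blockWeight_nonneg ha hr hsum2 _ _)
    (fun K _ j hj => blockWeight_insert ha hr hsum2 (Finset.mem_sdiff.1 hj).1
      (Finset.mem_sdiff.1 hj).2) t
    (u := fun K => formCoeff a r f I K (Γ - barModes K))
    (fun K hK => formCoeff_of_card_ne a r f I hK _)).trans_eq ?_
  congr 1
  · refine Finset.sum_congr rfl fun J _ => ?_
    have h := congrArg norm (formCoeff_adjoint ha hr hsum2 ⟨f, hT⟩ I Γ J)
    rw [norm_mul, hn1, one_mul] at h
    rw [h]
  · refine Finset.sum_congr rfl fun L hL => ?_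
    rw [← formCoeff_dbar ha hsum2 (isWeakDbar_dbar ha ⟨f, hS⟩) I (Finset.mem_powerset.1 hL),
      norm_mul, hn1, one_mul]

end
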